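/- Let $\Bbbk$ be an algebraically closed field of characteristic zero and let $D=D(0,1)$ be the down-up algebra generated by $u,d$ with relations $u^2d=du^2$ and $ud^2=d^2u$, which is connected graded with $\deg u=\deg d=1$. Let $G$ be the dihedral group of order $8$, $\rho\in G$ the rotation of order $4$ and $r\in G$ a reflection. There is a homogeneous $G$-coaction $D\to D\otimes \Bbbk G$ with $u\mapsto u\otimes\rho$, $d\mapsto d\otimes r$, that is, a $G$-grading $D=\bigoplus_{g\in G}D_g$ compatible with the $\mathbb N$-grading in which $\deg_G u=\rho$ and $\deg_G d=r$; the elements $\rho,r$ generate $G$. Write $D^{co\,G}=D_e$ for the fixed subring. Then: (a) The homological codeterminant of the coaction (the element $g\in G$ such that the induced coaction on the one-dimensional space $\mathrm{Ext}^{3}_D(\Bbbk,D)$, the only nonzero $\mathrm{Ext}^i_D(\Bbbk,D)$, is $\mathfrak e\mapsto \mathfrak e\otimes g^{-1}$) is $\rho^2$, and only $\rho^2$; since $\rho^2\neq e$, it is not trivial. (b) $D^{co\,G}=\Bbbk[(du)^2,(ud)^2,u^4,d^2]$, the subalgebra generated by these elements. It is commutative, and $x\mapsto (du)^2$, $y\mapsto(ud)^2$,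 $z\mapsto u^4$, $t\mapsto d^2$ induces an isomorphism of algebras $\Bbbk[x,y,z,t]/(xy-zt^2)\cong D^{co\,G}$. As a consequence, $D^{co\,G}$ is a commutative (graded) complete intersection; it is Artin-Schelter Gorenstein but not Artin-Schelter regular. So a fixed subring of a coaction can be AS Gorenstein while the homological determinant is nontrivial. (c) As right modules over $B=D^{co\,G}$, the components are as follows, where $M(-s)_n=M_{n-s}$: 1. $D_e=B$; 2. $D_\rho=uB\cong B(-1)$ (as graded modules); 3. $D_{\rho^2}=u^2B\cong B(-2)$ (as graded modules); 4. $D_{\rho^3}=u^3B+dud\,B$; 5. $D_r=dB+udu\,B$; 6. $D_{\rho r}=ud\,B+u^2du\,B=uD_r$; 7. $D_{\rho^2r}=u^2d\,B+u^3du\,B=u^2D_r$; 8. $D_{\rho^3r}=u^3d\,B+du\,B$. -/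

import Mathlib

open CategoryTheory
open scoped TensorProduct

universe u

noncomputable section

/-! ### Graded algebras and Artin-Schelter conditions -/

section ArtinSchelter

variable {k : Type u} [Field k] {A : Type u} [Ring A] [Algebra k A]

/-- `A = k ⊕ A₁ ⊕ A₂ ⊕ ⋯` is a connected `ℕ`-graded algebra. -/
structure IsConnectedGraded (𝒜 : ℕ → Submodule k A) : Prop where
  gradedMonoid : SetLike.GradedMonoid 𝒜
  internal : DirectSum.IsInternal 𝒜
  zero_eq : 𝒜 0 = Submodule.span k {1}
  nontrivial : Nontrivial A

/-- The left ideal generated by the elements of positive degree. -/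
def augmentationIdeal (𝒜 : ℕ → Submodule k A) : Ideal A :=
  Ideal.span {a | ∃ n, 0 < n ∧ a ∈ 𝒜 n}

/-- The trivial left module `k = A / A₊`. -/
def trivialModule (𝒜 : ℕ → Submodule k A) : ModuleCat.{u} A :=
  ModuleCat.of A (A ⧸ augmentationIdeal 𝒜)

/-- The left module `k` satisfies `Ext^i_A(k, A) = 0` for `i ≠ d` and `Ext^d_A(k, A)` is
one-dimensional over `k`, that is, isomorphic to a shift of `k`. -/
structure ExtTrivialModule (𝒜 : ℕ → Submodule k A) (d : ℕ) : Prop where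
  vanishing : ∀ i, i ≠ d →
    Subsingleton (Abelian.Ext.{u} (trivialModule 𝒜) (ModuleCat.of A A) i)
  finrank_eq_one :
    Module.finrank k (Abelian.Ext.{u} (trivialModule 𝒜) (ModuleCat.of A A) d) = 1

/-- The grading of the opposite algebra; left modules over `Aᵐᵒᵖ` are right modules over `A`. -/
def oppositeGrading (𝒜 : ℕ → Submodule k A) : ℕ → Submodule k Aᵐᵒᵖ :=
  fun n => (𝒜 n).map (MulOpposite.opLinearEquiv k : A ≃ₗ[k] Aᵐᵒᵖ).toLinearMap

/-- Artin-Schelter Gorenstein of dimension `d`: connected graded, of injective dimension `d` on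
both sides, and satisfying the Ext-condition on both sides. -/
structure IsASGorenstein (𝒜 : ℕ → Submodule k A) (d : ℕ) : Prop where
  connected : IsConnectedGraded 𝒜
  injectiveDimension_left : injectiveDimension (ModuleCat.of A A) = d
  injectiveDimension_right : injectiveDimension (ModuleCat.of Aᵐᵒᵖ Aᵐᵒᵖ) = d
  ext_left : ExtTrivialModule 𝒜 d
  ext_right : ExtTrivialModule (oppositeGrading 𝒜) d

variable (k A) in
/-- The Gelfand-Kirillov dimension. -/
def gkDimension : ENNReal :=
  ⨆ V : {V : Submodule k A // V.FG},
    Filter.limsup (fun n : ℕ =>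
      ENNReal.ofReal (Real.log (Module.finrank k ↥((1 ⊔ V.1) ^ n)) / Real.log n)) Filter.atTop

/-- Every left module over `R` has projective dimension at most `n`, for some `n`. -/
def HasFiniteGlobalDimension (R : Type u) [Ring R] : Prop :=
  ∃ n : ℕ, ∀ M : ModuleCat.{u} R, HasProjectiveDimensionLE M n

/-- Artin-Schelter regular of dimension `d`: AS Gorenstein, of finite global dimension, and of
finite Gelfand-Kirillov dimension. -/
structure IsASRegular (𝒜 : ℕ → Submodule k A) (d : ℕ) : Prop where
  gorenstein : IsASGorenstein 𝒜 d
  globalDimension_left : HasFiniteGlobalDimension A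
  globalDimension_right : HasFiniteGlobalDimension Aᵐᵒᵖ
  gkDimension_lt_top : gkDimension k A < ⊤

/-- A (graded, commutative) complete intersection: a polynomial ring with generators in positive
degrees, modulo a regular sequence of homogeneous elements. -/
def IsCompleteIntersection (𝒜 : ℕ → Submodule k A) : Prop :=
  ∃ (n : ℕ) (w : Fin n → ℕ) (fs : List (MvPolynomial (Fin n) k)),
    (∀ i, 0 < w i) ∧
    (∀ f ∈ fs, ∃ m, MvPolynomial.IsWeightedHomogeneous w f m) ∧
    RingTheory.Sequence.IsRegular (MvPolynomial (Fin n) k) fs ∧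
    ∃ e : (MvPolynomial (Fin n) k ⧸ Ideal.ofList fs) ≃ₐ[k] A,
      ∀ i, e (Ideal.Quotient.mk _ (MvPolynomial.X i)) ∈ 𝒜 (w i)

end ArtinSchelter

/-! ### Group coactions -/

section Coaction

variable {k : Type u} [Field k] {A : Type u} [Ring A] [Algebra k A] {G : Type} [Group G]

/-- A right `G`-coaction: an algebra map `A → A ⊗ kG` which is counital and coassociative. -/
structure IsCoaction (δ : A →ₐ[k] A ⊗[k] MonoidAlgebra k G) : Prop where
  counit : (TensorProduct.rid k A).toLinearMap ∘ₗ
    (Coalgebra.counit (R := k) (A := MonoidAlgebra k G)).lTensor A ∘ₗ δ.toLinearMap =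
      LinearMap.id
  coassoc : (TensorProduct.assoc k A (MonoidAlgebra k G) (MonoidAlgebra k G)).toLinearMap ∘ₗ
    δ.toLinearMap.rTensor (MonoidAlgebra k G) ∘ₗ δ.toLinearMap =
      (Coalgebra.comul (R := k) (A := MonoidAlgebra k G)).lTensor A ∘ₗ δ.toLinearMap

/-- The `g`-component `A_g = {a | δ a = a ⊗ g}`; its elements have `G`-degree `g`. -/
def component (δ : A →ₐ[k] A ⊗[k] MonoidAlgebra k G) (g : G) : Submodule k A :=
  LinearMap.eqLocus δ.toLinearMap
    ((TensorProduct.mk k A (MonoidAlgebra k G)).flip (MonoidAlgebra.of k G g))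

/-- The fixed subring `A^{co G} = {a | δ a = a ⊗ 1}`. -/
def fixedSubring (δ : A →ₐ[k] A ⊗[k] MonoidAlgebra k G) : Subalgebra k A :=
  AlgHom.equalizer δ Algebra.TensorProduct.includeLeft

/-- The grading induced on the fixed subring. -/
def fixedGrading (δ : A →ₐ[k] A ⊗[k] MonoidAlgebra k G) (𝒜 : ℕ → Submodule k A) :
    ℕ → Submodule k (fixedSubring δ) :=
  fun n => (𝒜 n).comap (fixedSubring δ).val.toLinearMap

/-- The `g`-component as a right module over the fixed subring. -/
def rightComponent (δ : A →ₐ[k] A ⊗[k] MonoidAlgebra k G) (g : G) :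
    Submodule (fixedSubring δ).op A where
  carrier := {a | a ∈ component δ g}
  add_mem' := fun ha hb => (component δ g).add_mem ha hb
  zero_mem' := (component δ g).zero_mem
  smul_mem' := by
    rintro ⟨⟨b⟩, hb⟩ a ha
    have hb' : δ b = b ⊗ₜ[k] (1 : MonoidAlgebra k G) := hb
    have ha' : δ a = a ⊗ₜ[k] MonoidAlgebra.of k G g := ha
    change δ (a * b) = (a * b) ⊗ₜ[k] MonoidAlgebra.of k G g
    rw [map_mul, ha', hb', Algebra.TensorProduct.tmul_mul_tmul, mul_one]

/-- Left multiplication by `a`, as a map of right modules over a subalgebra. -/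
def leftMul (B : Subalgebra k A) (a : A) : A →ₗ[B.op] A where
  toFun x := a * x
  map_add' := mul_add a
  map_smul' := by
    rintro ⟨⟨b⟩, hb⟩ x
    exact (mul_assoc a x b).symm

/-- A projective resolution of the left module `k = A / A₊` together with `G`-gradings, for an
algebra with a `G`-grading `A_g A_h ⊆ A_{gh}`. -/
structure GradedResolution (𝒜 : ℕ → Submodule k A) (𝒢 : G → Submodule k A) where
  /-- The underlying projective resolution. -/
  res : ProjectiveResolution (trivialModule 𝒜)
  /-- The homogeneous pieces of each term. -/
  piece : ∀ n, G → AddSubgroup (res.complex.X n)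
  internal : ∀ n, letI := Classical.decEq G; DirectSum.IsInternal (piece n)
  smul_mem : ∀ n (g h : G) (a : A) (x : res.complex.X n),
    a ∈ 𝒢 g → x ∈ piece n h → a • x ∈ piece n (g * h)
  d_mem : ∀ n (h : G) (x : res.complex.X (n + 1)),
    x ∈ piece (n + 1) h → (res.complex.d (n + 1) n).hom x ∈ piece n h
  augmentation_mem : ∀ (h : G) (x : res.complex.X 0), x ∈ piece 0 h →
    ∃ a ∈ 𝒢 h, ((res.π.f 0 ≫
      (HomologicalComplex.singleObjXSelf (ComplexShape.down ℕ) 0 (trivialModule 𝒜)).hom).hom x : A ⧸ augmentationIdeal 𝒜) =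
        Submodule.Quotient.mk a

/-- `e ∈ Ext^n_A(k, A)` has `G`-degree `g` for the `G`-grading of `Ext^n_A(k, A)`: it is the class
of a cocycle `P_n → A` taking each `(P_n)_h` to `A_{hg}`, for a graded projective resolution. -/
def IsExtHomogeneous (𝒜 : ℕ → Submodule k A) (𝒢 : G → Submodule k A) (n : ℕ) (g : G)
    (e : Abelian.Ext.{u} (trivialModule 𝒜) (ModuleCat.of A A) n) : Prop :=
  ∃ (P : GradedResolution 𝒜 𝒢) (f : P.res.complex.X n ⟶ ModuleCat.of A A)
    (hf : P.res.complex.d (n + 1) n ≫ f = 0),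
    (∀ (h : G) (x : P.res.complex.X n), x ∈ P.piece n h → (f.hom x : A) ∈ 𝒢 (h * g)) ∧
    P.res.extMk f (n + 1) rfl hf = e

/-- `g` is the homological codeterminant of the coaction `δ`: where `d` is the unique degree in
which `Ext_A(k, A)` lives (the injective dimension, when `A` is AS Gorenstein), the coaction on the
line `Ext^d_A(k, A)` is `e ↦ e ⊗ g⁻¹`. -/
def IsHomologicalCodeterminant (𝒜 : ℕ → Submodule k A)
    (δ : A →ₐ[k] A ⊗[k] MonoidAlgebra k G) (g : G) : Prop :=
  ∃ d, ExtTrivialModule 𝒜 d ∧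
    ∃ e : Abelian.Ext.{u} (trivialModule 𝒜) (ModuleCat.of A A) d,
      e ≠ 0 ∧ IsExtHomogeneous 𝒜 (component δ) d g⁻¹ e

end Coaction

/-! ### Down-up algebras -/

section DownUp

variable {k : Type u} [Field k]

/-- The relations `u²d = α udu + β du²` and `ud² = α dud + β d²u`, where `u` and `d` are the
generators `0` and `1` of the free algebra. -/
inductive DownUpRel (α β : k) : FreeAlgebra k (Fin 2) → FreeAlgebra k (Fin 2) → Prop
  | uud : DownUpRel α β
      (FreeAlgebra.ι k 0 * FreeAlgebra.ι k 0 * FreeAlgebra.ι k 1)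
      (α • (FreeAlgebra.ι k 0 * FreeAlgebra.ι k 1 * FreeAlgebra.ι k 0) +
        β • (FreeAlgebra.ι k 1 * FreeAlgebra.ι k 0 * FreeAlgebra.ι k 0))
  | udd : DownUpRel α β
      (FreeAlgebra.ι k 0 * FreeAlgebra.ι k 1 * FreeAlgebra.ι k 1)
      (α • (FreeAlgebra.ι k 1 * FreeAlgebra.ι k 0 * FreeAlgebra.ι k 1) +
        β • (FreeAlgebra.ι k 1 * FreeAlgebra.ι k 1 * FreeAlgebra.ι k 0))

/-- The down-up algebra `D(α, β)`. -/
abbrev DownUpAlgebra (α β : k) : Type u := RingQuot (DownUpRel α β)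

namespace DownUpAlgebra

/-- The generator `u`. -/
def up (α β : k) : DownUpAlgebra α β := RingQuot.mkAlgHom k (DownUpRel α β) (FreeAlgebra.ι k 0)

/-- The generator `d`. -/
def down (α β : k) : DownUpAlgebra α β := RingQuot.mkAlgHom k (DownUpRel α β) (FreeAlgebra.ι k 1)

/-- The `ℕ`-grading with `deg u = deg d = 1`. -/
def grading (α β : k) (n : ℕ) : Submodule k (DownUpAlgebra α β) :=
  Submodule.span k {up α β, down α β} ^ n

end DownUpAlgebra

end DownUp

/-! ### The coaction of the dihedral group of order eight -/

/-- The rotation `ρ` of order four. -/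
def rho8 : DihedralGroup 4 := DihedralGroup.r 1

/-- The reflection `r`. -/
def refl8 : DihedralGroup 4 := DihedralGroup.sr 0

section Dihedral

variable (k : Type u) [Field k]

open DownUpAlgebra

/-- The down-up algebra `D(0, 1)`. -/
abbrev DD : Type u := DownUpAlgebra (0 : k) 1

/-- The element `u` of `D(0, 1)`. -/
abbrev uu : DD k := up 0 1

/-- The element `d` of `D(0, 1)`. -/
abbrev dd : DD k := down 0 1

lemma uu_rel : uu k * uu k * dd k = dd k * uu k * uu k := by
  have h := RingQuot.mkAlgHom_rel k (DownUpRel.uud (α := (0 : k)) (β := 1))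
  simpa [up, down] using h

lemma dd_rel : uu k * dd k * dd k = dd k * dd k * uu k := by
  have h := RingQuot.mkAlgHom_rel k (DownUpRel.udd (α := (0 : k)) (β := 1))
  simpa [up, down] using h

/-- The values `u ↦ u ⊗ ρ` and `d ↦ d ⊗ r` of the coaction on the generators. -/
def dihedralCoactionFun : Fin 2 → DD k ⊗[k] MonoidAlgebra k (DihedralGroup 4) :=
  ![uu k ⊗ₜ[k] MonoidAlgebra.of k (DihedralGroup 4) rho8,
    dd k ⊗ₜ[k] MonoidAlgebra.of k (DihedralGroup 4) refl8]

/-- The coaction of the dihedral group on `D(0, 1)` with `deg_G u = ρ` and `deg_G d = r`. -/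
def dihedralCoaction : DD k →ₐ[k] DD k ⊗[k] MonoidAlgebra k (DihedralGroup 4) :=
  RingQuot.liftAlgHom k
    ⟨FreeAlgebra.lift k (dihedralCoactionFun k), by
      have h1 : rho8 * rho8 * refl8 = refl8 * rho8 * rho8 := by decide
      have h2 : rho8 * refl8 * refl8 = refl8 * refl8 * rho8 := by decide
      rintro x y (_ | _)
      · simp only [map_mul, FreeAlgebra.lift_ι_apply, zero_smul, one_smul,
          zero_add, dihedralCoactionFun, Matrix.cons_val_zero, Matrix.cons_val_one,
          Algebra.TensorProduct.tmul_mul_tmul]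
        simp only [← map_mul (MonoidAlgebra.of k (DihedralGroup 4))]
        rw [h1, uu_rel]
      · simp only [map_mul, FreeAlgebra.lift_ι_apply, zero_smul, one_smul,
          zero_add, dihedralCoactionFun, Matrix.cons_val_zero, Matrix.cons_val_one,
          Algebra.TensorProduct.tmul_mul_tmul]
        simp only [← map_mul (MonoidAlgebra.of k (DihedralGroup 4))]
        rw [h2, dd_rel]⟩

/-- The fixed subring of `D(0, 1)`. -/
abbrev fixedDD : Subalgebra k (DD k) := fixedSubring (dihedralCoaction k)

/-- The grading of `D(0, 1)` with `deg u = deg d = 1`. -/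
abbrev gradingDD : ℕ → Submodule k (DD k) := grading 0 1

/-- The grading induced on the fixed subring of `D(0, 1)`. -/
abbrev gradingFixedDD : ℕ → Submodule k (fixedDD k) :=
  fixedGrading (dihedralCoaction k) (gradingDD k)

/-- The component `D_g`, as a right module over the fixed subring. -/
abbrev compDD (g : DihedralGroup 4) : Submodule (fixedDD k).op (DD k) :=
  rightComponent (dihedralCoaction k) g

/-- `M(-s) ≅ N` as graded right modules over the fixed subring. -/
def ShiftIso (s : ℕ) (M N : Submodule (fixedDD k).op (DD k)) : Prop :=
  ∃ e : M ≃ₗ[(fixedDD k).op] N,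
    ∀ (n : ℕ) (x : M), (x : DD k) ∈ gradingDD k n ↔ (e x : DD k) ∈ gradingDD k (n + s)

end Dihedral

end

/-! Everything rests on the monomials `u ^ i * (d * u) ^ j * d ^ l`. They form a basis of `D`, and
left multiplication by `u` or by `d` carries it injectively into itself. The monomials are
homogeneous for both gradings, so the pieces of either grading are spans of monomials
(`gradingDD_eq`, `component_dihedralCoaction`), and so are right ideals such as `uD`. Questions
about `D` become questions about exponents.

Fixed subring `B`. The elements `u²` and `d²` are central, and the group degree of a monomial
depends only on its exponents modulo `(4, 2, 2)`. Right multiplication by the proposed generators of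
`B` raises exponents by exactly these periods, so each component is generated over `B` by its two
reduced monomials (`monom_mem_of_reduced`). In degrees `1`, `ρ` and `ρ²` one of the two is
redundant. Modulo `xy = zt²` the normal forms `z^a x^b t^c` and `z^a y^(b+1) t^c` span, and they map
to distinct basis monomials; hence the presentation (`exists_hypersurfaceQuot_algEquiv`).

Homology of `B`. Put `w = x + y` and `S = k[w, z, t]`. Then `B` is free over `S` on `1, x`, with `x²
= wx - zt²`. The coefficient of `x` is a Frobenius form, so `B ≅ Hom_S(B, S)` and the injective
dimension of `B` is at most that of `S` (`hasInjectiveDimensionLT_of_frobenius`). The variables of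
`S` are a regular sequence on `B` with quotient `k[x]/(x²)`, whose socle is a line; this gives the
Ext-condition (`ext_of_isWeaklyRegular`). On the other hand, `x * y = z * t²` makes the ideals `(x,
z)` and `(x, t²)` syzygies of each other. Finite global dimension would make `(x, z)` projective,
which is impossible (`not_hasFiniteGlobalDimension_of_periodic`).

Codeterminant. The trivial module has a free resolution `0 → D → D² → D² → D` which is homogeneous
for the group, with last generator in degree `ρ²`. Its dual is exact except at the end, where the
cokernel is `D / (dD + uD) = k`; the class with value `1` on the last generator therefore spans
`Ext³` and has degree `ρ⁻²`. For uniqueness, a homogeneous class may be given on any graded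
resolution. `exists_graded_comparison` pulls it back homogeneously to the explicit one, and a
cocycle of another degree takes its value in some `D_g` with `g ≠ 1`, where the augmentation
vanishes. -/

noncomputable section

/-! ### Normal monomials and the action of the generators on exponents -/

section Monomials

/-- The action of `u` from the left on the exponents of the monomials `u ^ i * (d * u) ^ j * d ^ l`. -/
def shiftUp (x : ℕ × ℕ × ℕ) : ℕ × ℕ × ℕ := (x.1 + 1, x.2.1, x.2.2)

/-- The action of `d` from the left on the exponents of the monomials `u ^ i * (d * u) ^ j * d ^ l`. -/
def shiftDown (x : ℕ × ℕ × ℕ) : ℕ × ℕ × ℕ :=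
  if x.1 % 2 = 1 then (x.1 - 1, x.2.1 + 1, x.2.2)
  else if x.2.1 = 0 then (x.1, 0, x.2.2 + 1)
  else (x.1 + 1, x.2.1 - 1, x.2.2 + 2)

lemma shiftUp_injective : Function.Injective shiftUp := by
  rintro ⟨i, j, l⟩ ⟨i', j', l'⟩ h
  simpa [shiftUp] using h

/-- The three branches have disjoint images: they are told apart by the parity of the first exponent
and by whether the second one vanishes. -/
lemma shiftDown_injective : Function.Injective shiftDown := by
  rintro ⟨i, j, l⟩ ⟨i', j', l'⟩ h
  simp only [shiftDown] at h
  split_ifs at h <;> simp only [Prod.mk.injEq] at h ⊢ <;> grind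

/-- This and the next lemma are the two defining relations on exponents; they make the free module
on exponents a module over `D`. -/
lemma shiftUp_shiftUp_shiftDown (x : ℕ × ℕ × ℕ) :
    shiftUp (shiftUp (shiftDown x)) = shiftDown (shiftUp (shiftUp x)) := by
  obtain ⟨i, j, l⟩ := x
  simp only [shiftUp, shiftDown]
  grind

lemma shiftUp_shiftDown_shiftDown (x : ℕ × ℕ × ℕ) :
    shiftUp (shiftDown (shiftDown x)) = shiftDown (shiftDown (shiftUp x)) := by
  obtain ⟨i, j, l⟩ := x
  simp only [shiftUp, shiftDown]
  grind

end Monomials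

/-! ### The monomial basis of `D(0, 1)` -/

section Basis

variable (k : Type u) [Field k]

open DownUpAlgebra

lemma uu_sq_comm : Commute (uu k * uu k) (dd k) := by
  rw [Commute, SemiconjBy, uu_rel, mul_assoc]

lemma dd_sq_comm : Commute (dd k * dd k) (uu k) := by
  rw [Commute, SemiconjBy, ← dd_rel, mul_assoc]

lemma adjoin_uu_dd : Algebra.adjoin k {uu k, dd k} = ⊤ := by
  rw [eq_top_iff]
  rintro a -
  obtain ⟨a, rfl⟩ := RingQuot.mkAlgHom_surjective k (DownUpRel (0 : k) 1) a
  induction a using FreeAlgebra.induction with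
  | grade0 r => rw [AlgHom.commutes]; exact Subalgebra.algebraMap_mem _ r
  | grade1 i =>
    fin_cases i
    · exact Algebra.subset_adjoin (Or.inl rfl)
    · exact Algebra.subset_adjoin (Or.inr rfl)
  | mul a b ha hb => rw [map_mul]; exact mul_mem ha hb
  | add a b ha hb => rw [map_add]; exact add_mem ha hb

/-- Induction on the generators of `D(0, 1)`. -/
lemma DD_induction {p : DD k → Prop} (hc : ∀ r, p (algebraMap k _ r)) (hu : p (uu k))
    (hd : p (dd k)) (hadd : ∀ a b, p a → p b → p (a + b)) (hmul : ∀ a b, p a → p b → p (a * b))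
    (a : DD k) : p a := by
  have ha : a ∈ Algebra.adjoin k {uu k, dd k} := by rw [adjoin_uu_dd]; trivial
  induction ha using Algebra.adjoin_induction with
  | mem x hx =>
    obtain rfl | rfl := hx
    exacts [hu, hd]
  | algebraMap r => exact hc r
  | add x y _ _ hx hy => exact hadd x y hx hy
  | mul x y _ _ hx hy => exact hmul x y hx hy

/-- The monomial `u ^ i * (d * u) ^ j * d ^ l`. -/
def monom (x : ℕ × ℕ × ℕ) : DD k := uu k ^ x.1 * (dd k * uu k) ^ x.2.1 * dd k ^ x.2.2

lemma uu_mul_monom (x : ℕ × ℕ × ℕ) : uu k * monom k x = monom k (shiftUp x) := by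
  simp only [monom, shiftUp, pow_succ', mul_assoc]

/-- The factor `d` passes the even part of `u ^ i`. A leftover `u` turns it into a new `du`;
otherwise it meets the first `du`, where `d * du = u * d²`, and `d²` moves to the right end. -/
lemma dd_mul_monom (x : ℕ × ℕ × ℕ) : dd k * monom k x = monom k (shiftDown x) := by
  obtain ⟨i, j, l⟩ := x
  have hu : ∀ m, dd k * (uu k * uu k) ^ m = (uu k * uu k) ^ m * dd k := fun m =>
    ((uu_sq_comm k).pow_left m).eq.symm
  have hd : ∀ n, dd k * dd k * (dd k * uu k) ^ n = (dd k * uu k) ^ n * (dd k * dd k) := fun n =>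
    (((Commute.refl (dd k)).mul_left (Commute.refl (dd k))).mul_right (dd_sq_comm k)).pow_right n
  simp only [shiftDown, monom]
  split_ifs with h1 h2
  · obtain ⟨m, rfl⟩ : ∃ m, i = 2 * m + 1 := ⟨i / 2, by omega⟩
    rw [Nat.add_sub_cancel, pow_succ, pow_mul, pow_two, pow_succ']
    simp only [← mul_assoc]
    rw [hu]
  · obtain ⟨m, rfl⟩ : ∃ m, i = 2 * m := ⟨i / 2, by omega⟩
    rw [pow_mul, pow_two, h2]
    simp only [pow_zero, mul_one, ← mul_assoc]
    rw [hu, pow_succ']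
    simp only [mul_assoc]
  · obtain ⟨m, rfl⟩ : ∃ m, i = 2 * m := ⟨i / 2, by omega⟩
    obtain ⟨n, rfl⟩ : ∃ n, j = n + 1 := ⟨j - 1, by omega⟩
    rw [pow_mul, pow_two, Nat.add_sub_cancel, pow_succ' (dd k * uu k), pow_succ _ (2 * m), pow_mul,
      pow_two, ← mul_assoc, ← mul_assoc, hu]
    calc _ = (uu k * uu k) ^ m * (dd k * dd k * uu k) * (dd k * uu k) ^ n * dd k ^ l := by
          simp only [mul_assoc]
      _ = (uu k * uu k) ^ m * uu k * (dd k * dd k * (dd k * uu k) ^ n) * dd k ^ l := by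
          rw [(dd_sq_comm k).eq]; simp only [mul_assoc]
      _ = _ := by rw [hd]; simp only [mul_assoc, add_comm l, pow_add, pow_two]

/-- The monomial representation of `D(0, 1)`. -/
def monomRep : DD k →ₐ[k] Module.End k (ℕ × ℕ × ℕ →₀ k) :=
  RingQuot.liftAlgHom k
    ⟨FreeAlgebra.lift k ![Finsupp.lmapDomain k k shiftUp, Finsupp.lmapDomain k k shiftDown], by
      rintro x y (_ | _)
      · ext x : 1
        refine LinearMap.ext_ring ?_
        simp [Finsupp.mapDomain_single, shiftUp_shiftUp_shiftDown]
      · ext x : 1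
        refine LinearMap.ext_ring ?_
        simp [Finsupp.mapDomain_single, shiftUp_shiftDown_shiftDown]⟩

lemma monomRep_uu : monomRep k (uu k) = Finsupp.lmapDomain k k shiftUp := by
  simp [monomRep, up]

lemma monomRep_dd : monomRep k (dd k) = Finsupp.lmapDomain k k shiftDown := by
  simp [monomRep, down]

lemma monomRep_uu_single (x : ℕ × ℕ × ℕ) :
    monomRep k (uu k) (Finsupp.single x 1) = Finsupp.single (shiftUp x) 1 := by
  simp [monomRep_uu, Finsupp.mapDomain_single]

lemma monomRep_dd_single (x : ℕ × ℕ × ℕ) :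
    monomRep k (dd k) (Finsupp.single x 1) = Finsupp.single (shiftDown x) 1 := by
  simp [monomRep_dd, Finsupp.mapDomain_single]

/-- Sending exponents to monomials is `D`-linear. Evaluated on the vector of the monomial `1`, this
shows that the monomials span. -/
lemma linearCombination_monomRep (a : DD k) : ∀ v : ℕ × ℕ × ℕ →₀ k,
    Finsupp.linearCombination k (monom k) (monomRep k a v) =
      a * Finsupp.linearCombination k (monom k) v := by
  have key : ∀ (a : DD k) (φ : ℕ × ℕ × ℕ → ℕ × ℕ × ℕ),
      monomRep k a = Finsupp.lmapDomain k k φ → (∀ x, a * monom k x = monom k (φ x)) →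
      ∀ v, Finsupp.linearCombination k (monom k) (monomRep k a v) =
        a * Finsupp.linearCombination k (monom k) v := by
    intro a φ ha hφ v
    rw [ha]
    induction v using Finsupp.induction_linear with
    | zero => simp
    | add v w hv hw => rw [map_add, map_add, map_add, mul_add, hv, hw]
    | single x c => simp [Finsupp.mapDomain_single, hφ]
  induction a using DD_induction with
  | hc r => intro v; simp [AlgHom.commutes, Algebra.smul_def, Module.algebraMap_end_apply]
  | hu => exact key _ _ (monomRep_uu k) (uu_mul_monom k)
  | hd => exact key _ _ (monomRep_dd k) (dd_mul_monom k)
  | hadd a b ha hb => intro v; rw [map_add, LinearMap.add_apply, map_add, ha, hb, add_mul]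
  | hmul a b ha hb => intro v; rw [map_mul, Module.End.mul_apply, ha, hb, mul_assoc]

/-- A monomial is recovered from its action on the vector of the monomial `1`, which gives linear
independence. -/
lemma monomRep_monom (x : ℕ × ℕ × ℕ) :
    monomRep k (monom k x) (Finsupp.single 0 1) = Finsupp.single x 1 := by
  obtain ⟨i, j, l⟩ := x
  have h3 : ∀ l, monomRep k (dd k ^ l) (Finsupp.single 0 1) = Finsupp.single (0, 0, l) 1 := by
    intro l
    induction l with
    | zero => simp; rfl
    | succ l ih =>
      rw [pow_succ', map_mul, Module.End.mul_apply, ih, monomRep_dd_single]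
      simp [shiftDown]
  have h2 : ∀ j, monomRep k ((dd k * uu k) ^ j) (Finsupp.single (0, 0, l) 1) =
      Finsupp.single (0, j, l) 1 := by
    intro j
    induction j with
    | zero => simp
    | succ j ih =>
      rw [pow_succ', map_mul, Module.End.mul_apply, ih, map_mul, Module.End.mul_apply,
        monomRep_uu_single, monomRep_dd_single]
      simp [shiftDown, shiftUp]
  have h1 : ∀ i, monomRep k (uu k ^ i) (Finsupp.single (0, j, l) 1) =
      Finsupp.single (i, j, l) 1 := by
    intro i
    induction i with
    | zero => simp
    | succ i ih =>
      rw [pow_succ', map_mul, Module.End.mul_apply, ih, monomRep_uu_single]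
      simp [shiftUp]
  rw [monom, map_mul, Module.End.mul_apply, h3, map_mul, Module.End.mul_apply, h2, h1]

/-- The basis of `D(0, 1)` formed by the monomials `u ^ i * (d * u) ^ j * d ^ l`. -/
def monomBasis : Module.Basis (ℕ × ℕ × ℕ) k (DD k) :=
  Module.Basis.ofRepr
    { toFun a := monomRep k a (Finsupp.single 0 1)
      map_add' a b := by rw [map_add, LinearMap.add_apply]
      map_smul' r a := by rw [map_smul, LinearMap.smul_apply]; rfl
      invFun := Finsupp.linearCombination k (monom k)
      left_inv a := by
        dsimp only
        rw [linearCombination_monomRep]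
        simp [monom]
      right_inv v := by
        dsimp only
        induction v using Finsupp.induction_linear with
        | zero => simp
        | add v w hv hw => rw [map_add, map_add, LinearMap.add_apply, hv, hw]
        | single x c =>
          rw [Finsupp.linearCombination_single, map_smul, LinearMap.smul_apply, monomRep_monom]
          simp }

@[simp] lemma monomBasis_apply (x : ℕ × ℕ × ℕ) : monomBasis k x = monom k x := by
  apply (monomBasis k).repr.injective
  rw [Module.Basis.repr_self]
  exact (monomRep_monom k x).symm

end Basis

/-! ### Direct sum decompositions from projections -/

section Internal

/-- A family of additive submonoids is an internal direct sum decomposition as soon as it has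
projections. -/
lemma isInternal_of_projections {ι M σ : Type*} [DecidableEq ι] [AddCommGroup M] [SetLike σ M]
    [AddSubmonoidClass σ M] (W : ι → σ) (π : ι → M →+ M)
    (hπ : ∀ i j x, x ∈ W j → π i x = if j = i then x else 0)
    (hs : ∀ x, ∃ s : Finset ι, (∀ i ∈ s, π i x ∈ W i) ∧ ∑ i ∈ s, π i x = x) :
    DirectSum.IsInternal W := by
  have hcoe : ∀ i (v : DirectSum ι fun i => W i),
      π i (DirectSum.coeAddMonoidHom W v) = (v i : M) := by
    intro i v
    induction v using DirectSum.induction_on with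
    | zero => simp
    | of j x =>
      rw [DirectSum.coeAddMonoidHom_of, hπ i j _ x.2, DirectSum.coe_of_apply]
      split_ifs <;> rfl
    | add v w hv hw => rw [map_add, map_add, hv, hw]; rfl
  constructor
  · intro v w h
    ext i
    rw [← hcoe, ← hcoe, h]
  · intro x
    obtain ⟨s, h1, h2⟩ := hs x
    refine ⟨∑ i ∈ s.attach, DirectSum.of (fun i => W i) i.1 ⟨π i.1 x, h1 i.1 i.2⟩, ?_⟩
    rw [map_sum]
    simp only [DirectSum.coeAddMonoidHom_of]
    rw [s.sum_attach (fun i => π i x), h2]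

end Internal

/-! ### Subspaces spanned by monomials -/

section MonomialSpans

variable (k : Type u) [Field k]

open DownUpAlgebra

/-- The span of the monomials with exponents in `s`. -/
def monomSpan (s : Set (ℕ × ℕ × ℕ)) : Submodule k (DD k) := Submodule.span k (monom k '' s)

variable {k}

lemma monom_mem_monomSpan {s : Set (ℕ × ℕ × ℕ)} {x : ℕ × ℕ × ℕ} (hx : x ∈ s) :
    monom k x ∈ monomSpan k s := Submodule.subset_span ⟨x, hx, rfl⟩

lemma mem_monomSpan_iff {s : Set (ℕ × ℕ × ℕ)} {a : DD k} :
    a ∈ monomSpan k s ↔ ∀ x, (monomBasis k).repr a x ≠ 0 → x ∈ s := by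
  have h : monom k = monomBasis k := funext fun x => (monomBasis_apply k x).symm
  rw [monomSpan, h, Module.Basis.mem_span_image]
  simp [Set.subset_def]

lemma sum_monom (a : DD k) :
    a = ∑ x ∈ ((monomBasis k).repr a).support, (monomBasis k).repr a x • monom k x := by
  conv_lhs => rw [← (monomBasis k).linearCombination_repr a]
  simp [Finsupp.linearCombination_apply, Finsupp.sum]

lemma mem_of_monom_mem {W : Submodule k (DD k)} {a : DD k}
    (h : ∀ x, (monomBasis k).repr a x ≠ 0 → monom k x ∈ W) : a ∈ W := by
  rw [sum_monom a]
  exact Submodule.sum_mem _ fun x hx => W.smul_mem _ (h x (Finsupp.mem_support_iff.1 hx))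

lemma monomSpan_le {s : Set (ℕ × ℕ × ℕ)} {W : Submodule k (DD k)} :
    monomSpan k s ≤ W ↔ ∀ x ∈ s, monom k x ∈ W := by
  rw [monomSpan, Submodule.span_le, Set.image_subset_iff]; rfl

lemma mem_monomSpan_univ (a : DD k) : a ∈ monomSpan k Set.univ :=
  mem_monomSpan_iff.2 fun _ _ => trivial

/-- Two linear maps which agree on monomials are equal. -/
lemma linearMap_ext_monom {M : Type*} [AddCommMonoid M] [Module k M] {f g : DD k →ₗ[k] M}
    (h : ∀ x, f (monom k x) = g (monom k x)) : f = g :=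
  (monomBasis k).ext fun x => by simpa using h x

lemma repr_monom (x y : ℕ × ℕ × ℕ) :
    (monomBasis k).repr (monom k x) y = if x = y then 1 else 0 := by
  rw [← monomBasis_apply, Module.Basis.repr_self, Finsupp.single_apply]

/-- The coefficients of the image of a linear map permuting monomials injectively. -/
lemma repr_map_monom {T : DD k →ₗ[k] DD k} {φ : ℕ × ℕ × ℕ → ℕ × ℕ × ℕ}
    (hφ : Function.Injective φ) (hT : ∀ x, T (monom k x) = monom k (φ x)) (a : DD k)
    (x : ℕ × ℕ × ℕ) : (monomBasis k).repr (T a) (φ x) = (monomBasis k).repr a x := by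
  have : (monomBasis k).repr.toLinearMap ∘ₗ T =
      Finsupp.lmapDomain k k φ ∘ₗ (monomBasis k).repr.toLinearMap := by
    refine linearMap_ext_monom fun x => ?_
    simp only [LinearMap.comp_apply, LinearEquiv.coe_coe, hT]
    rw [← monomBasis_apply, ← monomBasis_apply, Module.Basis.repr_self, Module.Basis.repr_self]
    simp [Finsupp.mapDomain_single]
  have h2 := DFunLike.congr_fun this a
  simp only [LinearMap.comp_apply, LinearEquiv.coe_coe, Finsupp.lmapDomain_apply] at h2
  rw [h2, Finsupp.mapDomain_apply hφ]

/-- Injectivity of `φ` rules out cancellation, so every monomial of `a` is itself sent into `s`.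
Preimages of monomial subspaces are thus found one monomial at a time. -/
lemma mem_of_map_monom_mem {T : DD k →ₗ[k] DD k} {φ : ℕ × ℕ × ℕ → ℕ × ℕ × ℕ}
    (hφ : Function.Injective φ) (hT : ∀ x, T (monom k x) = monom k (φ x))
    {s : Set (ℕ × ℕ × ℕ)} {W : Submodule k (DD k)} {a : DD k} (ha : T a ∈ monomSpan k s)
    (h : ∀ x, φ x ∈ s → monom k x ∈ W) : a ∈ W :=
  mem_of_monom_mem fun x hx =>
    h x (mem_monomSpan_iff.1 ha _ (by rwa [repr_map_monom hφ hT]))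

lemma injective_of_map_monom {T : DD k →ₗ[k] DD k} {φ : ℕ × ℕ × ℕ → ℕ × ℕ × ℕ}
    (hφ : Function.Injective φ) (hT : ∀ x, T (monom k x) = monom k (φ x)) :
    Function.Injective T := by
  rw [← LinearMap.ker_eq_bot, LinearMap.ker_eq_bot']
  intro a ha
  apply (monomBasis k).repr.injective
  ext x
  rw [← repr_map_monom hφ hT, ha, map_zero, Finsupp.zero_apply, Finsupp.zero_apply]

/-- The projection onto the span of the monomials `x` with `f x = i`. -/
def monomProj {ι : Type*} [DecidableEq ι] (f : ℕ × ℕ × ℕ → ι) (i : ι) : DD k →ₗ[k] DD k :=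
  (monomBasis k).constr k fun x => if f x = i then monom k x else 0

section Projections

variable {ι : Type*} [DecidableEq ι] (f : ℕ × ℕ × ℕ → ι)

lemma monomProj_monom (i : ι) (x : ℕ × ℕ × ℕ) :
    monomProj f i (monom k x) = if f x = i then monom k x else 0 := by
  rw [← monomBasis_apply, monomProj, Module.Basis.constr_basis, monomBasis_apply]

lemma monomProj_mem (i : ι) (a : DD k) : monomProj f i a ∈ monomSpan k {x | f x = i} := by
  have h : monomSpan k Set.univ ≤ (monomSpan k {x | f x = i}).comap (monomProj f i) := by
    rw [monomSpan_le]
    intro x _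
    rw [Submodule.mem_comap, monomProj_monom]
    split_ifs with h
    · exact monom_mem_monomSpan h
    · exact zero_mem _
  exact h (mem_monomSpan_univ a)

lemma monomProj_of_mem (i j : ι) {a : DD k} (ha : a ∈ monomSpan k {x | f x = j}) :
    monomProj f i a = if j = i then a else 0 := by
  have h : monomSpan k {x | f x = j} ≤
      LinearMap.eqLocus (monomProj f i) (if j = i then LinearMap.id else 0) := by
    rw [monomSpan_le]
    rintro x rfl
    rw [LinearMap.mem_eqLocus, monomProj_monom]
    split_ifs <;> rfl
  have := h ha
  rw [LinearMap.mem_eqLocus] at this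
  rw [this]
  split_ifs <;> rfl

lemma sum_monomProj (a : DD k) :
    ∑ i ∈ ((monomBasis k).repr a).support.image f, monomProj f i a = a := by
  conv_lhs =>
    enter [2, i]
    rw [sum_monom a, map_sum]
  rw [Finset.sum_comm]
  conv_rhs => rw [sum_monom a]
  refine Finset.sum_congr rfl fun x hx => ?_
  simp only [map_smul, monomProj_monom, smul_ite, smul_zero]
  rw [Finset.sum_ite_eq, if_pos (Finset.mem_image_of_mem f hx)]

lemma isInternal_monomSpan : DirectSum.IsInternal fun i => monomSpan k {x | f x = i} :=
  isInternal_of_projections _ (fun i => (monomProj f i).toAddMonoidHom)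
    (fun i _ _ hx => monomProj_of_mem f i _ hx)
    fun a => ⟨_, fun i _ => monomProj_mem f i a, sum_monomProj f a⟩

end Projections

/-! ### The `ℕ`-grading -/

/-- The degree of a monomial. -/
def monomDeg (x : ℕ × ℕ × ℕ) : ℕ := x.1 + 2 * x.2.1 + x.2.2

lemma monomDeg_shiftUp (x : ℕ × ℕ × ℕ) : monomDeg (shiftUp x) = monomDeg x + 1 := by
  simp only [monomDeg, shiftUp]; ring

lemma monomDeg_shiftDown (x : ℕ × ℕ × ℕ) : monomDeg (shiftDown x) = monomDeg x + 1 := by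
  simp only [monomDeg, shiftDown]; grind

lemma uu_mem_gradingDD : uu k ∈ gradingDD k 1 := by
  rw [gradingDD, grading, pow_one]; exact Submodule.subset_span (by simp)

lemma dd_mem_gradingDD : dd k ∈ gradingDD k 1 := by
  rw [gradingDD, grading, pow_one]; exact Submodule.subset_span (by simp)

lemma gradedMonoid_gradingDD : SetLike.GradedMonoid (gradingDD k) where
  one_mem := by rw [gradingDD, grading, pow_zero]; exact Submodule.one_le.1 le_rfl
  mul_mem := by
    intro i j a b ha hb
    rw [gradingDD, grading, pow_add]
    exact Submodule.mul_mem_mul ha hb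

lemma monom_mem_gradingDD (x : ℕ × ℕ × ℕ) : monom k x ∈ gradingDD k (monomDeg x) := by
  have := gradedMonoid_gradingDD (k := k)
  have h := SetLike.mul_mem_graded (SetLike.mul_mem_graded
    (SetLike.pow_mem_graded x.1 (uu_mem_gradingDD (k := k)))
    (SetLike.pow_mem_graded x.2.1 (SetLike.mul_mem_graded (dd_mem_gradingDD (k := k))
      uu_mem_gradingDD)))
    (SetLike.pow_mem_graded x.2.2 (dd_mem_gradingDD (k := k)))
  have e : monomDeg x = x.1 • 1 + x.2.1 • (1 + 1) + x.2.2 • 1 := by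
    simp only [monomDeg, smul_eq_mul]; ring
  rw [e]
  exact h

lemma gradingDD_eq (n : ℕ) : gradingDD k n = monomSpan k {x | monomDeg x = n} := by
  apply le_antisymm
  · induction n with
    | zero =>
      rw [gradingDD, grading, pow_zero, Submodule.one_le]
      have : (1 : DD k) = monom k 0 := by simp [monom]
      rw [this]
      exact monom_mem_monomSpan rfl
    | succ n ih =>
      have h : gradingDD k (n + 1) = Submodule.span k {uu k, dd k} * gradingDD k n := by
        rw [gradingDD, grading, pow_succ']; rfl
      rw [h, Submodule.mul_le]
      intro a ha b hb
      have hb' := ih hb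
      have key : ∀ a ∈ ({uu k, dd k} : Set (DD k)), monomSpan k {x | monomDeg x = n} ≤
          (monomSpan k {x | monomDeg x = n + 1}).comap (LinearMap.mulLeft k a) := by
        intro a ha
        rw [monomSpan_le]
        rintro x rfl
        obtain rfl | rfl := ha
        · rw [Submodule.mem_comap, LinearMap.mulLeft_apply, uu_mul_monom]
          exact monom_mem_monomSpan (monomDeg_shiftUp x)
        · rw [Submodule.mem_comap, LinearMap.mulLeft_apply, dd_mul_monom]
          exact monom_mem_monomSpan (monomDeg_shiftDown x)
      induction ha using Submodule.span_induction with
      | mem a ha => exact key a ha hb'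
      | zero => rw [zero_mul]; exact zero_mem _
      | add x y _ _ hx hy => rw [add_mul]; exact add_mem hx hy
      | smul r x _ hx => rw [smul_mul_assoc]; exact Submodule.smul_mem _ _ hx
  · rw [monomSpan_le]
    rintro x rfl
    exact monom_mem_gradingDD x

instance nontrivial_DD : Nontrivial (DD k) := by
  refine ⟨⟨monom k 0, 0, fun h => ?_⟩⟩
  have h1 := repr_monom (k := k) 0 0
  simp [h] at h1

lemma isConnectedGraded_gradingDD : IsConnectedGraded (gradingDD k) where
  gradedMonoid := gradedMonoid_gradingDD
  internal := by
    have h : gradingDD k = fun n => monomSpan k {x | monomDeg x = n} := funext gradingDD_eq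
    rw [h]
    exact isInternal_monomSpan monomDeg
  zero_eq := by rw [gradingDD, grading, pow_zero, Submodule.one_eq_span]
  nontrivial := nontrivial_DD

/-! ### The grading by the dihedral group -/

/-- The degree of a monomial in the dihedral group. -/
def monomGDeg (x : ℕ × ℕ × ℕ) : DihedralGroup 4 :=
  rho8 ^ x.1 * (refl8 * rho8) ^ x.2.1 * refl8 ^ x.2.2

lemma dihedralCoaction_uu :
    dihedralCoaction k (uu k) = uu k ⊗ₜ MonoidAlgebra.of k (DihedralGroup 4) rho8 := by
  simp [dihedralCoaction, up, dihedralCoactionFun]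

lemma dihedralCoaction_dd :
    dihedralCoaction k (dd k) = dd k ⊗ₜ MonoidAlgebra.of k (DihedralGroup 4) refl8 := by
  simp [dihedralCoaction, down, dihedralCoactionFun]

lemma dihedralCoaction_monom (x : ℕ × ℕ × ℕ) :
    dihedralCoaction k (monom k x) =
      monom k x ⊗ₜ MonoidAlgebra.of k (DihedralGroup 4) (monomGDeg x) := by
  rw [monom, monomGDeg]
  simp only [map_mul, map_pow, dihedralCoaction_uu, dihedralCoaction_dd,
    Algebra.TensorProduct.tmul_mul_tmul, Algebra.TensorProduct.tmul_pow]

lemma isCoaction_dihedralCoaction : IsCoaction (dihedralCoaction k) where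
  counit := by
    refine linearMap_ext_monom fun x => ?_
    simp [dihedralCoaction_monom]
  coassoc := by
    refine linearMap_ext_monom fun x => ?_
    simp [dihedralCoaction_monom]

lemma component_dihedralCoaction (g : DihedralGroup 4) :
    component (dihedralCoaction k) g = monomSpan k {x | monomGDeg x = g} := by
  apply le_antisymm
  · intro a ha
    -- Taking the coefficient at `g` in the second tensor factor turns the coaction into the
    -- monomial projection of degree `g`, which must then fix `a`.
    let c : MonoidAlgebra k (DihedralGroup 4) →ₗ[k] k :=
      Finsupp.lapply g ∘ₗ (MonoidAlgebra.coeffLinearEquiv k).toLinearMap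
    have hc : ∀ h, c (MonoidAlgebra.of k _ h) = if h = g then 1 else 0 := by
      intro h
      simp [c, Finsupp.single_apply]
    have h : (TensorProduct.rid k (DD k)).toLinearMap ∘ₗ c.lTensor (DD k) ∘ₗ
        (dihedralCoaction k).toLinearMap = monomProj monomGDeg g := by
      refine linearMap_ext_monom fun x => ?_
      rw [monomProj_monom]
      simp only [LinearMap.comp_apply, AlgHom.toLinearMap_apply, dihedralCoaction_monom,
        LinearMap.lTensor_tmul, LinearEquiv.coe_coe, TensorProduct.rid_tmul, hc]
      split_ifs <;> simp
    have ha' : dihedralCoaction k a = a ⊗ₜ MonoidAlgebra.of k _ g := ha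
    have h2 := DFunLike.congr_fun h a
    simp only [LinearMap.comp_apply, AlgHom.toLinearMap_apply, ha',
        LinearMap.lTensor_tmul, LinearEquiv.coe_coe, TensorProduct.rid_tmul, hc, if_true,
        one_smul] at h2
    rw [h2]
    exact monomProj_mem _ _ _
  · rw [monomSpan_le]
    rintro x rfl
    exact dihedralCoaction_monom x

lemma isInternal_component : DirectSum.IsInternal (component (dihedralCoaction k)) := by
  have h : component (dihedralCoaction k) = fun g => monomSpan k {x | monomGDeg x = g} :=
    funext component_dihedralCoaction
  rw [h]
  exact isInternal_monomSpan monomGDeg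

lemma mul_mem_component {A : Type u} [Ring A] [Algebra k A] {G : Type} [Group G]
    (δ : A →ₐ[k] A ⊗[k] MonoidAlgebra k G) {g h : G} {a b : A}
    (ha : a ∈ component δ g) (hb : b ∈ component δ h) : a * b ∈ component δ (g * h) := by
  have ha' : δ a = a ⊗ₜ MonoidAlgebra.of k _ g := ha
  have hb' : δ b = b ⊗ₜ MonoidAlgebra.of k _ h := hb
  change δ (a * b) = (a * b) ⊗ₜ MonoidAlgebra.of k _ (g * h)
  rw [map_mul, ha', hb', Algebra.TensorProduct.tmul_mul_tmul, map_mul]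

lemma gradingDD_eq_iSup (n : ℕ) :
    gradingDD k n = ⨆ g, gradingDD k n ⊓ component (dihedralCoaction k) g := by
  apply le_antisymm
  · rw [gradingDD_eq, monomSpan_le]
    rintro x hx
    refine Submodule.mem_iSup_of_mem (monomGDeg x) ⟨monom_mem_monomSpan hx, ?_⟩
    exact dihedralCoaction_monom x
  · exact iSup_le fun g => inf_le_left

lemma closure_rho8_refl8 : Subgroup.closure {rho8, refl8} = ⊤ := by
  rw [eq_top_iff]
  have h1 : rho8 ∈ Subgroup.closure {rho8, refl8} := Subgroup.subset_closure (by simp)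
  have h2 : refl8 ∈ Subgroup.closure {rho8, refl8} := Subgroup.subset_closure (by simp)
  rintro (i | i) -
  · have h : ∀ i : ZMod 4, DihedralGroup.r i = rho8 ^ i.val := by decide
    rw [h]
    exact pow_mem h1 _
  · have h : ∀ i : ZMod 4, DihedralGroup.sr i = refl8 * rho8 ^ i.val := by decide
    rw [h]
    exact mul_mem h2 (pow_mem h1 _)

end MonomialSpans

/-! ### Coextension of scalars and injective dimension -/

section Coextension

variable {R A : Type u} [Ring R] [Ring A] (f : R →+* A)

/-- Coextension is `Hom_R(A, -)`, which is left exact in any case; projectivity of `A` over `R` is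
needed only for surjectivity on the right. -/
lemma shortExact_coextendScalars
    (hf : Module.Projective R ((ModuleCat.restrictScalars.{u} f).obj (ModuleCat.of A A)))
    {S : ShortComplex (ModuleCat.{u} R)} (hS : S.ShortExact) :
    ∃ w : (ModuleCat.coextendScalars.{u, u, u} f).map S.f ≫
        (ModuleCat.coextendScalars.{u, u, u} f).map S.g = 0,
      (ShortComplex.mk _ _ w).ShortExact := by
  have hinj : Function.Injective S.f.hom := (ModuleCat.mono_iff_injective _).1 hS.mono_f
  have hsurj : Function.Surjective S.g.hom := (ModuleCat.epi_iff_surjective _).1 hS.epi_g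
  have hex : Function.Exact S.f.hom S.g.hom :=
    (ShortComplex.ShortExact.moduleCat_exact_iff_function_exact S).1 hS.exact
  have w : (ModuleCat.coextendScalars.{u, u, u} f).map S.f ≫
      (ModuleCat.coextendScalars.{u, u, u} f).map S.g = 0 := by
    ext φ : 2
    apply ModuleCat.CoextendScalars.ext
    ext s
    exact hex.apply_apply_eq_zero _
  refine ⟨w, { exact := ?_, mono_f := ?_, epi_g := ?_ }⟩
  · rw [ShortComplex.ShortExact.moduleCat_exact_iff_function_exact]
    intro φ
    constructor
    · intro hφ
      have h : ∀ s, ModuleCat.CoextendScalars.equiv f _ φ s ∈ LinearMap.range S.f.hom := fun s =>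
        (hex _).1 (DFunLike.congr_fun (congrArg (ModuleCat.CoextendScalars.equiv f _) hφ) s)
      refine ⟨(ModuleCat.CoextendScalars.equiv f _).symm
        ((LinearEquiv.ofInjective S.f.hom hinj).symm.toLinearMap ∘ₗ
          (ModuleCat.CoextendScalars.equiv f _ φ).codRestrict _ h), ?_⟩
      apply ModuleCat.CoextendScalars.ext
      refine LinearMap.ext fun s => ?_
      exact congrArg Subtype.val ((LinearEquiv.ofInjective S.f.hom hinj).apply_symm_apply
        ((ModuleCat.CoextendScalars.equiv f _ φ).codRestrict _ h s))
    · rintro ⟨ψ, rfl⟩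
      exact ConcreteCategory.congr_hom w ψ
  · refine (ModuleCat.mono_iff_injective _).2 fun φ ψ h => ?_
    apply ModuleCat.CoextendScalars.ext
    refine LinearMap.ext fun s => hinj ?_
    exact DFunLike.congr_fun (congrArg (ModuleCat.CoextendScalars.equiv f _) h) s
  · refine (ModuleCat.epi_iff_surjective _).2 fun φ => ?_
    obtain ⟨ψ, hψ⟩ := Module.projective_lifting_property S.g.hom
      (ModuleCat.CoextendScalars.equiv f _ φ) hsurj
    refine ⟨(ModuleCat.CoextendScalars.equiv f _).symm ψ, ?_⟩
    apply ModuleCat.CoextendScalars.ext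
    refine LinearMap.ext fun s => ?_
    exact DFunLike.congr_fun hψ s

/-- Coextension of scalars to a projective algebra does not increase the injective dimension. -/
lemma hasInjectiveDimensionLT_coextendScalars
    (hf : Module.Projective R ((ModuleCat.restrictScalars.{u} f).obj (ModuleCat.of A A)))
    (n : ℕ) (M : ModuleCat.{u} R) (hM : HasInjectiveDimensionLT M n) :
    HasInjectiveDimensionLT ((ModuleCat.coextendScalars.{u, u, u} f).obj M) n := by
  have : (ModuleCat.restrictScalars.{u} f).PreservesMonomorphisms := inferInstance
  have hinj : ∀ I : ModuleCat.{u} R, Injective I →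
      Injective ((ModuleCat.coextendScalars.{u, u, u} f).obj I) := fun I hI =>
    Injective.injective_of_adjoint (ModuleCat.restrictCoextendScalarsAdj.{u} f) I
  match n with
  | 0 =>
    have h0 := isZero_of_hasInjectiveDimensionLT_zero M
    have h1 : Subsingleton M := ModuleCat.isZero_iff_subsingleton.1 h0
    apply Limits.IsZero.hasInjectiveDimensionLT_zero
    rw [ModuleCat.isZero_iff_subsingleton]
    refine ⟨fun φ ψ => ?_⟩
    apply ModuleCat.CoextendScalars.ext
    exact LinearMap.ext fun s => h1.elim _ _
  | 1 =>
    rw [← injective_iff_hasInjectiveDimensionLT_one] at hM ⊢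
    exact hinj M hM
  | n + 2 =>
    -- Dimension shifting along an embedding into an injective. Coextension preserves injectives,
    -- being right adjoint to the exact restriction of scalars.
    obtain ⟨⟨J, hJ, ι, hι⟩⟩ := EnoughInjectives.presentation M
    have hS : (ShortComplex.mk ι (Limits.cokernel.π ι) (Limits.cokernel.condition ι)).ShortExact :=
      { exact := ShortComplex.exact_cokernel ι }
    have hQ := (hS.hasInjectiveDimensionLT_X₃_iff n hJ).2 hM
    obtain ⟨w, hw⟩ := shortExact_coextendScalars f hf hS
    exact (hw.hasInjectiveDimensionLT_X₃_iff n (hinj J hJ)).1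
      (hasInjectiveDimensionLT_coextendScalars hf (n + 1) _ hQ)

/-- The additive map underlying an element of a coextension of scalars. -/
def coextendApply {M : ModuleCat.{u} R} (x : (ModuleCat.coextendScalars.{u, u, u} f).obj M) :
    A →+ M :=
  (ModuleCat.CoextendScalars.equiv f M x).toAddMonoidHom

lemma coextendApply_mul {M : ModuleCat.{u} R}
    (x : (ModuleCat.coextendScalars.{u, u, u} f).obj M) (r : R) (a : A) :
    coextendApply f x (f r * a) = r • coextendApply f x a :=
  (ModuleCat.CoextendScalars.equiv f M x).map_smul r a

lemma coextendApply_injective {M : ModuleCat.{u} R}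
    {x y : (ModuleCat.coextendScalars.{u, u, u} f).obj M}
    (h : ∀ a, coextendApply f x a = coextendApply f y a) : x = y :=
  ModuleCat.CoextendScalars.ext (LinearMap.ext h)

/-- The element of a coextension of scalars given by an additive map. -/
def coextendMk {M : ModuleCat.{u} R} (φ : A →+ M) (h : ∀ r a, φ (f r * a) = r • φ a) :
    (ModuleCat.coextendScalars.{u, u, u} f).obj M :=
  (ModuleCat.CoextendScalars.equiv f M).symm { φ with map_smul' := h }

lemma projective_restrictScalars [Module R A] (hsmul : ∀ r (a : A), r • a = f r * a)
    [Module.Projective R A] :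
    Module.Projective R ((ModuleCat.restrictScalars.{u} f).obj (ModuleCat.of A A)) :=
  let e : A ≃ₗ[R] (ModuleCat.restrictScalars.{u} f).obj (ModuleCat.of A A) :=
    { toFun a := a, invFun a := a, map_add' _ _ := rfl, map_smul' r a := hsmul r a,
      left_inv _ := rfl, right_inv _ := rfl }
  Module.Projective.of_equiv e

/-- An algebra which is isomorphic to its own dual over a projective subring has at most the
injective dimension of the subring. -/
lemma hasInjectiveDimensionLT_of_frobenius [Module R A] (hsmul : ∀ r (a : A), r • a = f r * a)
    [Module.Projective R A] (t : A →ₗ[R] R)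
    (hinj : ∀ a, (∀ c, t (c * a) = 0) → a = 0)
    (hsurj : ∀ φ : A →ₗ[R] R, ∃ a, ∀ c, φ c = t (c * a))
    (n : ℕ) (hR : HasInjectiveDimensionLT (ModuleCat.of R R) n) :
    HasInjectiveDimensionLT (ModuleCat.of A A) n := by
  have := hasInjectiveDimensionLT_coextendScalars f (projective_restrictScalars f hsmul) n _ hR
  -- The pairing `(c, a) ↦ t (c * a)` identifies `A` with `Hom_R(A, R)` as left modules.
  let T : A →ₗ[A] (ModuleCat.coextendScalars.{u, u, u} f).obj (ModuleCat.of R R) :=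
    { toFun a := coextendMk f (t.toAddMonoidHom.comp (AddMonoidHom.mulRight a)) fun r c => by
        change t (f r * c * a) = r • t (c * a)
        rw [mul_assoc, ← hsmul, map_smul]
      map_add' a b := by
        refine coextendApply_injective f fun c => ?_
        change t (c * (a + b)) = t (c * a) + t (c * b)
        rw [mul_add, map_add]
      map_smul' b a := by
        refine coextendApply_injective f fun c => ?_
        change t (c * (b * a)) = t (c * b * a)
        rw [mul_assoc] }
  have hT : Function.Bijective T := by
    constructor
    · rw [← LinearMap.ker_eq_bot, LinearMap.ker_eq_bot']
      intro a ha
      exact hinj a fun c => DFunLike.congr_fun (congrArg (coextendApply f) ha) c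
    · intro φ
      obtain ⟨a, ha⟩ := hsurj
        { coextendApply f φ with
          map_smul' r c := by
            change coextendApply f φ (r • c) = r • coextendApply f φ c
            rw [hsmul, coextendApply_mul] }
      exact ⟨a, coextendApply_injective f fun c => (ha c).symm⟩
  exact hasInjectiveDimensionLT_of_iso (LinearEquiv.ofBijective T hT).toModuleIso.symm n

end Coextension

/-! ### Injective dimensions over polynomial rings -/

section Polynomial

open Polynomial

/-- The equation determines `φ (X ^ (n + 1))` from `φ (X ^ n)`, so it is solved by recursion from `φ
1 = 0` and extended linearly. It provides surjectivity in the coinduced sequence below. -/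
lemma exists_coeff_recursion {R : Type u} [CommRing R] {M : Type u} [AddCommGroup M] [Module R[X] M]
    (ψ : R[X] →+ M) (hψ : ∀ r s, ψ (C r * s) = (C r : R[X]) • ψ s) :
    ∃ φ : R[X] →+ M, (∀ r s, φ (C r * s) = (C r : R[X]) • φ s) ∧
      ∀ s, φ (X * s) = (X : R[X]) • φ s + ψ s := by
  let c : ℕ → M := fun n => Nat.rec 0 (fun n m => (X : R[X]) • m + ψ (X ^ n)) n
  have hc : ∀ n, c (n + 1) = (X : R[X]) • c n + ψ (X ^ n) := fun n => rfl
  let _ : Module R M := Module.compHom M (C : R →+* R[X])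
  have hsm : ∀ (r : R) (m : M), r • m = (C r : R[X]) • m := fun _ _ => rfl
  let φ : R[X] →ₗ[R] M := (Polynomial.basisMonomials R).constr R c
  have hφm : ∀ r s, φ (C r * s) = (C r : R[X]) • φ s := by
    intro r s
    rw [← Polynomial.smul_eq_C_mul, map_smul, hsm]
  have hφ : ∀ n, φ (X ^ n) = c n := by
    intro n
    rw [Polynomial.X_pow_eq_monomial]
    have := (Polynomial.basisMonomials R).constr_basis R c n
    rwa [Polynomial.coe_basisMonomials] at this
  refine ⟨φ.toAddMonoidHom, hφm, fun s => ?_⟩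
  change φ (X * s) = (X : R[X]) • φ s + ψ s
  induction s using Polynomial.induction_on' with
  | add p q hp hq => rw [mul_add, map_add, map_add, map_add, smul_add, hp, hq]; abel
  | monomial n r =>
    rw [← C_mul_X_pow_eq_monomial, mul_left_comm, hφm, hφm, hψ, ← pow_succ', hφ, hφ, hc, smul_add,
      ← mul_smul, ← mul_smul, mul_comm]

/-- Adjoining a variable raises the injective dimension of modules by at most one. -/
lemma hasInjectiveDimensionLT_polynomial {R : Type u} [CommRing R] (n : ℕ)
    (h : ∀ M : ModuleCat.{u} R, HasInjectiveDimensionLT M n) (M : ModuleCat.{u} R[X]) :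
    HasInjectiveDimensionLT M (n + 1) := by
  let f : R →+* R[X] := C
  let N := (ModuleCat.restrictScalars.{u} f).obj M
  let K := (ModuleCat.coextendScalars.{u, u, u} f).obj N
  have hK : HasInjectiveDimensionLT K n :=
    hasInjectiveDimensionLT_coextendScalars f
      (projective_restrictScalars f fun r a => Polynomial.smul_eq_C_mul r) n N (h N)
  let app (x : K) : R[X] →+ M := coextendApply f x
  have app_C_mul (x : K) (r : R) (s : R[X]) : app x (C r * s) = (C r : R[X]) • app x s :=
    coextendApply_mul f x r s
  let mk (φ : R[X] →+ M) (hφ : ∀ r s, φ (C r * s) = (C r : R[X]) • φ s) : K :=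
    coextendMk (M := N) f φ hφ
  have hext {x y : K} (hxy : ∀ s, app x s = app y s) : x = y := coextendApply_injective f hxy
  -- The sequence `0 → M → Hom_R(R[X], M) → Hom_R(R[X], M) → 0`, whose second map measures the
  -- failure to commute with `X`; its kernel consists of the `R[X]`-linear maps, that is, of `M`.
  let ι : M →ₗ[R[X]] K :=
    { toFun m := mk ((smulAddHom R[X] M).flip m) fun r s => mul_smul (C r) s m
      map_add' a b := hext fun s => smul_add s a b
      map_smul' b a := hext fun s => (mul_smul s b a).symm }
  let π : K →ₗ[R[X]] K :=
    { toFun x := mk ((app x).comp (AddMonoidHom.mulLeft X) -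
          (DistribSMul.toAddMonoidHom M (X : R[X])).comp (app x)) fun r s => by
        change app x (X * (C r * s)) - (X : R[X]) • app x (C r * s) =
          (C r : R[X]) • (app x (X * s) - (X : R[X]) • app x s)
        rw [mul_left_comm, app_C_mul, app_C_mul, smul_sub, ← mul_smul, ← mul_smul, mul_comm (C r) X]
      map_add' x y := hext fun s => by
        change (app x (X * s) + app y (X * s)) - (X : R[X]) • (app x s + app y s) =
          (app x (X * s) - (X : R[X]) • app x s) + (app y (X * s) - (X : R[X]) • app y s)
        rw [smul_add]; abel
      map_smul' b x := hext fun s => by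
        change app x (X * s * b) - (X : R[X]) • app x (s * b) =
          app x (X * (s * b)) - (X : R[X]) • app x (s * b)
        rw [mul_assoc] }
  have happι (m : M) (s : R[X]) : app (ι m) s = s • m := rfl
  have happπ (x : K) (s : R[X]) : app (π x) s = app x (X * s) - (X : R[X]) • app x s := rfl
  have hex : Function.Exact ι π := by
    intro x
    constructor
    · intro hx
      have hX : ∀ s, app x (X * s) = (X : R[X]) • app x s := fun s => by
        rw [← sub_eq_zero, ← happπ, hx]; rfl
      refine ⟨app x 1, hext fun s => ?_⟩
      rw [happι]
      induction s using Polynomial.induction_on with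
      | C r => rw [← app_C_mul, mul_one]
      | add p q hp hq => rw [add_smul, hp, hq, map_add]
      | monomial n r hr =>
        rw [pow_succ, ← mul_assoc, mul_comm, mul_smul, hr, hX]
    · rintro ⟨m, rfl⟩
      refine hext fun s => ?_
      rw [happπ, happι, happι, mul_smul, sub_self]; rfl
  have hS : (ShortComplex.mk (ModuleCat.ofHom ι) (ModuleCat.ofHom π)
      (ModuleCat.hom_ext (LinearMap.ext hex.apply_apply_eq_zero))).ShortExact :=
    { exact := (ShortComplex.ShortExact.moduleCat_exact_iff_function_exact _).2 hex
      mono_f := (ModuleCat.mono_iff_injective _).2 fun a b hab => by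
        have h1 : app (ι a) 1 = app (ι b) 1 := congrArg (fun x => app x 1) hab
        rwa [happι, happι, one_smul, one_smul] at h1
      epi_g := (ModuleCat.epi_iff_surjective _).2 fun y => by
        obtain ⟨φ, h1, h2⟩ := exists_coeff_recursion (app y) (app_C_mul y)
        refine ⟨mk φ h1, hext fun s => ?_⟩
        change φ (X * s) - (X : R[X]) • φ s = app y s
        rw [h2, add_sub_cancel_left] }
  exact hS.hasInjectiveDimensionLT_X₁ n hK (hasInjectiveDimensionLT_of_ge _ n _ (Nat.le_succ n))

lemma hasInjectiveDimensionLT_of_field {k : Type u} [Field k] (M : ModuleCat.{u} k) :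
    HasInjectiveDimensionLT M 1 := by
  rw [← injective_iff_hasInjectiveDimensionLT_one]
  have := Module.injective_of_isSemisimpleRing k M
  exact Module.injective_object_of_injective_module k M

end Polynomial

/-! ### Regular sequences and `Ext` -/

section RegularSequence

open CategoryTheory.Abelian RingTheory.Sequence

variable {k : Type u} [Field k] {A : Type u} [CommRing A] [Algebra k A]

/-- Scalars act on `Ext` equally through either argument, and on `N` the scalar `r` is zero. -/
lemma ext_comp_smul_id_eq_zero {N M : ModuleCat.{u} A} {r : A} (hr : ∀ x : N, r • x = 0) {n : ℕ}
    (e : Ext.{u} N M n) : e.comp (Ext.mk₀ (r • 𝟙 M)) (add_zero n) = 0 := by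
  have h : r • 𝟙 N = 0 := by
    ext x
    exact hr x
  rw [← Ext.smul_eq_comp_mk₀, ← e.mk₀_id_comp, ← Ext.smul_comp, ← Ext.mk₀_smul, h, Ext.mk₀_zero,
    Ext.zero_comp]

/-- Dividing out a regular sequence which annihilates `N` shifts `Ext(N, -)`. -/
lemma ext_of_isWeaklyRegular (N : ModuleCat.{u} A) (rs : List A) (hN : ∀ r ∈ rs, ∀ x : N, r • x = 0)
    (M : Type u) [AddCommGroup M] [Module A M] (hM : IsWeaklyRegular M rs) :
    (∀ i < rs.length, Subsingleton (Ext.{u} N (ModuleCat.of A M) i)) ∧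
    Nonempty (Ext.{u} N (ModuleCat.of A M) rs.length ≃ₗ[k]
      (N ⟶ ModuleCat.of A (M ⧸ (Ideal.ofList rs • ⊤ : Submodule A M)))) := by
  induction rs generalizing M with
  | nil =>
    refine ⟨fun i hi => absurd hi (Nat.not_lt_zero i), ⟨?_⟩⟩
    have h : (Ideal.ofList ([] : List A) • ⊤ : Submodule A M) = ⊥ := by simp
    let e : ModuleCat.of A M ≅ ModuleCat.of A (M ⧸ (Ideal.ofList ([] : List A) • ⊤ :
      Submodule A M)) := (Submodule.quotEquivOfEqBot _ h).symm.toModuleIso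
    exact Ext.linearEquiv₀.trans (Linear.homCongr k (Iso.refl N) e)
  | cons r rs ih =>
    obtain ⟨hr, hrs⟩ := (isWeaklyRegular_cons_iff M r rs).1 hM
    obtain ⟨ih1, ⟨ih2⟩⟩ := ih (fun r' h' => hN r' (List.mem_cons_of_mem _ h')) (QuotSMulTop r M) hrs
    have hS := IsSMulRegular.smulShortComplex_shortExact (M := ModuleCat.of A M) hr
    have hzero : ∀ {i : ℕ} (x : Ext.{u} N (ModuleCat.of A M) i),
        x.comp (Ext.mk₀ ((ModuleCat.of A M).smulShortComplex r).f) (add_zero i) = 0 := by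
      intro i x
      exact ext_comp_smul_id_eq_zero (hN r List.mem_cons_self) x
    -- Since `r` acts as zero on `Ext(N, M)`, the long exact sequence of `0 → M → M → M/rM → 0`
    -- makes every connecting map surjective. At the last index the preceding term vanishes, so
    -- there it is also injective.
    have hsurj : ∀ i, Function.Surjective (hS.extClass.postcompOfLinear k N (rfl : i + 1 = i + 1)) :=
      fun i x => Ext.covariant_sequence_exact₁ N hS x (hzero x) rfl
    have hvan : ∀ i < (r :: rs).length, Subsingleton (Ext.{u} N (ModuleCat.of A M) i) := by
      intro i hi
      match i with
      | 0 =>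
        refine ⟨fun x y => ?_⟩
        have hmono : Mono ((ModuleCat.of A M).smulShortComplex r).f := hS.mono_f
        exact Ext.postcomp_mk₀_injective_of_mono N ((ModuleCat.of A M).smulShortComplex r).f
          ((hzero x).trans (hzero y).symm)
      | i + 1 =>
        have : Subsingleton (Ext.{u} N ((ModuleCat.of A M).smulShortComplex r).X₃ i) :=
          ih1 i (by simpa using hi)
        exact (hsurj i).subsingleton
    refine ⟨hvan, ⟨?_⟩⟩
    have hinj : Function.Injective
        (hS.extClass.postcompOfLinear k N (rfl : rs.length + 1 = rs.length + 1)) := by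
      rw [← LinearMap.ker_eq_bot, LinearMap.ker_eq_bot']
      intro x hx
      obtain ⟨y, rfl⟩ := Ext.covariant_sequence_exact₃ N hS x rfl hx
      have : Subsingleton (Ext.{u} N ((ModuleCat.of A M).smulShortComplex r).X₂ rs.length) :=
        hvan rs.length (by simp)
      rw [Subsingleton.elim y 0, Ext.zero_comp]
    exact (LinearEquiv.ofBijective _ ⟨hinj, hsurj rs.length⟩).symm.trans
      (ih2.trans (Linear.homCongr k (Iso.refl N)
        (Submodule.quotOfListConsSMulTopEquivQuotSMulTopInner M r rs).symm.toModuleIso))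

/-- Reduces the Ext-condition to a socle computation: `Hom(N, M / (rs) M)` has to be a line. -/
lemma finrank_ext_eq_one (N : Type u) [AddCommGroup N] [Module A N] (rs : List A)
    (hN : ∀ r ∈ rs, ∀ x : N, r • x = 0)
    (M : Type u) [AddCommGroup M] [Module A M] (hM : IsWeaklyRegular M rs)
    (v : N →ₗ[A] M ⧸ (Ideal.ofList rs • ⊤ : Submodule A M)) (hv : v ≠ 0)
    (hspan : ∀ w : N →ₗ[A] M ⧸ (Ideal.ofList rs • ⊤ : Submodule A M),
      ∃ c : k, w = algebraMap k A c • v) :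
    Module.finrank k (Ext.{u} (ModuleCat.of A N) (ModuleCat.of A M) rs.length) = 1 := by
  obtain ⟨-, ⟨e⟩⟩ := ext_of_isWeaklyRegular (k := k) (ModuleCat.of A N) rs hN M hM
  have hv' : ModuleCat.ofHom v ≠ 0 := fun h => hv (congrArg ModuleCat.Hom.hom h)
  rw [finrank_eq_one_iff_of_nonzero' (e.symm (ModuleCat.ofHom v))
    (fun h => hv' (e.symm.map_eq_zero_iff.1 h))]
  intro w
  obtain ⟨c, hc⟩ := hspan (e w).hom
  refine ⟨c, ?_⟩
  rw [← e.symm.map_smul, e.symm_apply_eq]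
  refine ModuleCat.hom_ext ?_
  rw [hc]
  rfl

end RegularSequence

/-! ### Rings of infinite global dimension -/

section GlobalDimension

/-- The map `(a, b) ↦ a * x + b * p` onto the ideal generated by `x` and `p`. -/
def pairMap {A : Type u} [CommRing A] (x p : A) : (A × A) →ₗ[A] A :=
  (LinearMap.mulRight A x).coprod (LinearMap.mulRight A p)

variable {A : Type u} [CommRing A] {x y p q : A}

lemma pairMap_apply (a b : A) : pairMap x p (a, b) = a * x + b * p := rfl

/-- If `x * y = p * q`, the ideal `(x, q)` is a syzygy of the ideal `(x, p)`. -/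
lemma exists_syzygy_pairMap (hx : ∀ a, a * x = 0 → a = 0) (hxy : x * y = p * q)
    (hp : ∀ b c, b * p = c * x → ∃ s t, b = s * x + t * q) :
    Nonempty (LinearMap.ker (pairMap x p) ≃ₗ[A] LinearMap.range (pairMap x q)) := by
  -- As `x` is a nonzerodivisor, a syzygy is determined by its second coordinate, which ranges over
  -- the `b` with `b * p ∈ (x)`; these are the elements of `(x, q)`.
  let g : LinearMap.ker (pairMap x p) →ₗ[A] A :=
    LinearMap.snd A A A ∘ₗ (LinearMap.ker (pairMap x p)).subtype
  have hker : ∀ v : LinearMap.ker (pairMap x p), v.1.1 * x + v.1.2 * p = 0 := fun v => v.2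
  have hg : Function.Injective g := by
    rw [← LinearMap.ker_eq_bot, LinearMap.ker_eq_bot']
    intro v hv
    have h2 : v.1.2 = 0 := hv
    have h1 := hker v
    rw [h2, zero_mul, add_zero] at h1
    exact Subtype.ext (Prod.ext (hx _ h1) h2)
  have hrange : LinearMap.range g = LinearMap.range (pairMap x q) := by
    ext b
    constructor
    · rintro ⟨v, rfl⟩
      obtain ⟨s, t, h⟩ := hp v.1.2 (-v.1.1) (by linear_combination hker v)
      exact ⟨(s, t), h.symm⟩
    · rintro ⟨⟨s, t⟩, rfl⟩
      refine ⟨⟨(-(s * p + t * y), s * x + t * q), ?_⟩, rfl⟩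
      change -(s * p + t * y) * x + (s * x + t * q) * p = 0
      linear_combination -t * hxy
  exact ⟨(LinearEquiv.ofInjective g hg).trans (LinearEquiv.ofEq _ _ hrange)⟩

lemma hasProjectiveDimensionLT_pairMap (hx : ∀ a, a * x = 0 → a = 0) (hxy : x * y = p * q)
    (hp : ∀ b c, b * p = c * x → ∃ s t, b = s * x + t * q) (n : ℕ)
    (h : HasProjectiveDimensionLT (ModuleCat.of A (LinearMap.range (pairMap x p))) (n + 2)) :
    HasProjectiveDimensionLT (ModuleCat.of A (LinearMap.range (pairMap x q))) (n + 1) := by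
  obtain ⟨e⟩ := exists_syzygy_pairMap hx hxy hp
  have hS := LinearMap.shortExact_shortComplexKer (pairMap x p).surjective_rangeRestrict
  have hX : Projective (pairMap x p).rangeRestrict.shortComplexKer.X₂ :=
    ModuleCat.projective_of_categoryTheory_projective (ModuleCat.of A (A × A))
  have h1 := (hS.hasProjectiveDimensionLT_X₃_iff n hX).1 h
  have e' : LinearMap.ker (pairMap x p).rangeRestrict ≃ₗ[A] LinearMap.ker (pairMap x p) :=
    LinearEquiv.ofEq _ _ (LinearMap.ker_rangeRestrict _)
  exact hasProjectiveDimensionLT_of_iso (e'.trans e).toModuleIso (n + 1)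

/-- The syzygies of `(x, p)` are `2`-periodic, and no syzygy is projective, if `x * y = p * q` is
suitably regular with `x`, `y`, `p`, `q` in a proper ideal. -/
lemma not_hasFiniteGlobalDimension_of_periodic {F : Type*} [Field F] (ε : A →+* F)
    (hx : ∀ a, a * x = 0 → a = 0) (hxy : x * y = p * q)
    (hp : ∀ b c, b * p = c * x → ∃ s t, b = s * x + t * q)
    (hq : ∀ b c, b * q = c * x → ∃ s t, b = s * x + t * p)
    (hεx : ε x = 0) (hεy : ε y = 0) (hεp : ε p = 0) (hεq : ε q = 0) :
    ¬ HasFiniteGlobalDimension A := by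
  rintro ⟨n, hn⟩
  -- Each ideal is the syzygy of the other, so the bounds on both have to descend together.
  have key : ∀ n, HasProjectiveDimensionLT (ModuleCat.of A (LinearMap.range (pairMap x p))) (n + 1) →
      HasProjectiveDimensionLT (ModuleCat.of A (LinearMap.range (pairMap x q))) (n + 1) →
      HasProjectiveDimensionLT (ModuleCat.of A (LinearMap.range (pairMap x p))) 1 := by
    intro n
    induction n with
    | zero => exact fun h _ => h
    | succ n ih =>
      exact fun h1 h2 => ih (hasProjectiveDimensionLT_pairMap hx (hxy.trans (mul_comm p q)) hq n h2)
        (hasProjectiveDimensionLT_pairMap hx hxy hp n h1)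
  have h1 := key n (hn _) (hn _)
  rw [← projective_iff_hasProjectiveDimensionLT_one, ← IsProjective.iff_projective] at h1
  -- Projectivity splits `A² → (x, p)`. The lifts of the generators `x` and `p` will force `1` into
  -- the kernel of `ε`.
  obtain ⟨s, hs⟩ := Module.projective_lifting_property (pairMap x p).rangeRestrict LinearMap.id
    (pairMap x p).surjective_rangeRestrict
  let vx : LinearMap.range (pairMap x p) := ⟨x, (1, 0), by simp [pairMap_apply]⟩
  let vp : LinearMap.range (pairMap x p) := ⟨p, (0, 1), by simp [pairMap_apply]⟩
  have hvx : (s vx).1 * x + (s vx).2 * p = x := congrArg Subtype.val (DFunLike.congr_fun hs vx)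
  have hvp : (s vp).1 * x + (s vp).2 * p = p := congrArg Subtype.val (DFunLike.congr_fun hs vp)
  have hcomm : p • s vx = x • s vp := by
    rw [← map_smul, ← map_smul]
    exact congrArg s (Subtype.ext (mul_comm p x))
  have h2 : p * (s vx).2 = x * (s vp).2 := congrArg Prod.snd hcomm
  obtain ⟨c, e, hce⟩ := hp (s vx).2 (1 - (s vx).1) (by linear_combination hvx)
  obtain ⟨c', e', hce'⟩ := hp (1 - (s vp).2) (s vp).1 (by linear_combination -hvp)
  -- Substitute `(s vx).2 = c * x + e * q` in `p * (s vx).2 = x * (s vp).2`, replace `p * q` by `x *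
  -- y` and cancel `x`. Then `(s vp).2` and `1 - (s vp).2` both lie in the kernel of `ε`.
  have h3 : (s vp).2 = p * c + e * y := by
    rw [← sub_eq_zero]
    refine hx _ ?_
    rw [hce] at h2
    linear_combination -h2 - e * hxy
  have h4 := congrArg ε h3
  have h5 := congrArg ε hce'
  simp only [map_add, map_sub, map_mul, map_one, hεx, hεy, hεp, hεq, mul_zero, zero_mul,
    add_zero] at h4 h5
  rw [h4, sub_zero] at h5
  exact one_ne_zero h5

end GlobalDimension

/-! ### The hypersurface `x * y = z * t ^ 2` as a quadratic extension -/

section Hypersurface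

open Polynomial CategoryTheory.Abelian RingTheory.Sequence
open scoped QuadraticAlgebra

/-- Flatness of `R[X]` over `R` preserves the given sequence, and multiplication by `X` only shifts
coefficients, so `X` stays regular modulo the extended ideal. -/
lemma isWeaklyRegular_polynomial {R : Type u} [CommRing R] {rs : List R}
    (h : IsWeaklyRegular R rs) : IsWeaklyRegular R[X] (rs.map (C : R →+* R[X]) ++ [ X ]) := by
  rw [isWeaklyRegular_append_iff]
  refine ⟨IsWeaklyRegular.of_flat (S := R[X]) h, (isWeaklyRegular_singleton_iff _ _).2 ?_⟩
  have hI : (Ideal.ofList (rs.map (C : R →+* R[X])) • ⊤ : Submodule R[X] R[X]) =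
      (Ideal.ofList rs).map C := by
    rw [Ideal.map_ofList, smul_eq_mul, Ideal.mul_top]
  rw [hI, isSMulRegular_iff_right_eq_zero_of_smul]
  intro f hf
  obtain ⟨f, rfl⟩ := Submodule.Quotient.mk_surjective _ f
  rw [← Submodule.Quotient.mk_smul, Submodule.Quotient.mk_eq_zero, Ideal.mem_map_C_iff] at hf
  rw [Submodule.Quotient.mk_eq_zero, Ideal.mem_map_C_iff]
  intro n
  have := hf (n + 1)
  rwa [smul_eq_mul, coeff_X_mul] at this

lemma mem_ofList_polynomial {R : Type u} [CommRing R] {rs : List R} {f : R[X]} :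
    f ∈ Ideal.ofList (rs.map (C : R →+* R[X]) ++ [ X ]) ↔ f.coeff 0 ∈ Ideal.ofList rs := by
  rw [Ideal.ofList_append, ← Ideal.map_ofList, Ideal.ofList_singleton]
  constructor
  · intro hf
    obtain ⟨a, ha, b, hb, rfl⟩ := Submodule.mem_sup.1 hf
    obtain ⟨c, rfl⟩ := Ideal.mem_span_singleton.1 hb
    rw [coeff_add, coeff_X_mul_zero, add_zero]
    exact Ideal.mem_map_C_iff.1 ha 0
  · intro hf
    rw [← divX_mul_X_add f, add_comm]
    exact Submodule.add_mem_sup (Ideal.mem_map_of_mem _ hf)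
      (Ideal.mul_mem_left _ _ (Ideal.mem_span_singleton_self _))

variable {k : Type u} [Field k] {S : Type u} [CommRing S] {a b : S}

/-- The extension of an augmentation of `S` to a quadratic extension generated by an element of
trace and norm in the kernel. -/
def quadraticEval (ε : S →+* k) (ha : ε a = 0) : QuadraticAlgebra S a b →+* k where
  toFun x := ε x.re
  map_one' := by simp
  map_zero' := by simp
  map_add' := by simp
  map_mul' x y := by
    rw [QuadraticAlgebra.re_mul, map_add, map_mul, map_mul, map_mul, ha]
    simp

/-- The quadratic algebra is free on `1, ω`, so an ideal extended from `S` is described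
coordinatewise. -/
lemma mem_ofList_quadratic {ε : S →+* k} {rs : List S} (hε : ∀ s, s ∈ Ideal.ofList rs ↔ ε s = 0)
    {x : QuadraticAlgebra S a b} :
    x ∈ Ideal.ofList (rs.map (algebraMap S (QuadraticAlgebra S a b))) ↔
      ε x.re = 0 ∧ ε x.im = 0 := by
  rw [← Ideal.map_ofList]
  constructor
  · let J : Ideal (QuadraticAlgebra S a b) :=
      { carrier := {x | ε x.re = 0 ∧ ε x.im = 0}
        add_mem' := by
          rintro x y ⟨h1, h2⟩ ⟨h3, h4⟩
          exact ⟨by simp [h1, h3], by simp [h2, h4]⟩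
        zero_mem' := by simp
        smul_mem' := by
          rintro x y ⟨h1, h2⟩
          exact ⟨by simp [h1, h2], by simp [h1, h2]⟩ }
    have hJ : (Ideal.ofList rs).map (algebraMap S (QuadraticAlgebra S a b)) ≤ J := by
      rw [Ideal.map_le_iff_le_comap]
      intro s hs
      exact ⟨(hε s).1 hs, by simp⟩
    exact fun h => hJ h
  · rintro ⟨h1, h2⟩
    have h : x = algebraMap S (QuadraticAlgebra S a b) x.re +
        algebraMap S (QuadraticAlgebra S a b) x.im * QuadraticAlgebra.omega := by
      ext <;> simp
    rw [h]
    exact add_mem (Ideal.mem_map_of_mem _ ((hε _).2 h1))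
      (Ideal.mul_mem_right _ _ (Ideal.mem_map_of_mem _ ((hε _).2 h2)))

section Gorenstein

variable {A : Type u} [CommRing A]

/-- A quadratic extension of `S` has at most the injective dimension of `S`. -/
lemma hasInjectiveDimensionLT_quadratic (e : QuadraticAlgebra S a b ≃+* A) (n : ℕ)
    (hS : HasInjectiveDimensionLT (ModuleCat.of S S) n) :
    HasInjectiveDimensionLT (ModuleCat.of A A) n := by
  let f : S →+* A := e.toRingHom.comp (algebraMap S (QuadraticAlgebra S a b))
  let _ : Module S A := Module.compHom A f
  let e' : QuadraticAlgebra S a b ≃ₗ[S] A :=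
    { e with
      map_smul' r x := by
        change e (r • x) = f r * e x
        rw [Algebra.smul_def, map_mul]; rfl }
  have : Module.Projective S A := Module.Projective.of_equiv e'
  have he' : ∀ x y, e' (x * y) = e' x * e' y := map_mul e
  -- The Frobenius form is the coefficient of `ω`.
  refine hasInjectiveDimensionLT_of_frobenius f (fun r x => rfl)
    (QuadraticAlgebra.imₗ _ _ ∘ₗ e'.symm.toLinearMap) ?_ ?_ n hS
  · intro x hx
    obtain ⟨x, rfl⟩ := e'.surjective x
    have h : ∀ c, (c * x).im = 0 := by
      intro c
      have := hx (e' c)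
      rw [← he'] at this
      simpa using this
    have h1 := h 1
    have h2 := h QuadraticAlgebra.omega
    rw [one_mul] at h1
    simp [h1] at h2
    rw [show x = 0 from QuadraticAlgebra.ext h2 h1, map_zero]
  · intro φ
    let p := φ (e' 1)
    let q := φ (e' QuadraticAlgebra.omega)
    -- For `m = m₀ + m₁ ω` the form takes the value `m₁` on `1 * m` and `m₀ + b * m₁` on `ω * m`;
    -- equating these with `p` and `q` gives the witness.
    refine ⟨e' ⟨q - b * p, p⟩, fun c => ?_⟩
    obtain ⟨c, rfl⟩ := e'.surjective c
    have hc : c = c.re • 1 + c.im • QuadraticAlgebra.omega := by ext <;> simp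
    have h1 : φ (e' c) = c.re * p + c.im * q := by
      conv_lhs => rw [hc]
      simp only [map_add, map_smul, smul_eq_mul, p, q]
    rw [← he', h1]
    simp
    ring

variable [Algebra k S] [Algebra k A]

/-- A quadratic extension of a ring generated by a regular sequence satisfies the `Ext`-condition. -/
lemma extTrivialModule_quadratic (e : QuadraticAlgebra S a b ≃ₐ[k] A) {rs : List S}
    {ε : S →+* k} (hεk : ∀ c, ε (algebraMap k S c) = c) (ha : ε a = 0) (hb : ε b = 0)
    (hε : ∀ s, s ∈ Ideal.ofList rs ↔ ε s = 0) (hrs : RingTheory.Sequence.IsWeaklyRegular S rs)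
    (hS : HasInjectiveDimensionLT (ModuleCat.of S S) (rs.length + 1))
    (𝒜 : ℕ → Submodule k A) (h𝒜 : ∀ x, x ∈ augmentationIdeal 𝒜 ↔ ε (e.symm x).re = 0) :
    ExtTrivialModule 𝒜 rs.length := by
  let rs' := (rs.map (algebraMap S (QuadraticAlgebra S a b))).map e
  have hlen : rs'.length = rs.length := by simp [rs']
  have hreg : IsWeaklyRegular A rs' := by
    refine (AddEquiv.isWeaklyRegular_congr (M := QuadraticAlgebra S a b) (M₂ := A)
      (e := e.toRingEquiv.toAddEquiv) (as := rs.map (algebraMap S (QuadraticAlgebra S a b)))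
      (bs := rs') ?_).1 (IsWeaklyRegular.of_flat (S := QuadraticAlgebra S a b) hrs)
    rw [List.forall₂_map_right_iff, List.forall₂_same]
    exact fun r _ x => map_mul e r x
  have hmem : ∀ x, x ∈ Ideal.ofList rs' ↔ ε (e.symm x).re = 0 ∧ ε (e.symm x).im = 0 := by
    intro x
    have h : Ideal.ofList rs' =
        (Ideal.ofList (rs.map (algebraMap S (QuadraticAlgebra S a b)))).map e.toRingEquiv :=
      (Ideal.map_ofList (e.toRingEquiv : QuadraticAlgebra S a b →+* A) _).symm
    rw [← mem_ofList_quadratic hε, h, Ideal.mem_map_of_equiv]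
    constructor
    · rintro ⟨y, hy, rfl⟩
      change e.symm (e y) ∈ _
      rwa [e.symm_apply_apply]
    · exact fun hx => ⟨e.symm x, hx, e.apply_symm_apply x⟩
  have hann : ∀ r ∈ rs', ∀ x : A ⧸ augmentationIdeal 𝒜, r • x = 0 := by
    intro r hr x
    obtain ⟨x, rfl⟩ := Submodule.Quotient.mk_surjective _ x
    have hr' := (hmem r).1 (Ideal.subset_span hr)
    refine (Submodule.Quotient.mk_eq_zero _).2 ((h𝒜 _).2 ?_)
    change ε (e.symm (r * x)).re = 0
    rw [map_mul, QuadraticAlgebra.re_mul, map_add, map_mul, map_mul, map_mul, hr'.1, ha]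
    simp
  obtain ⟨h1, -⟩ := ext_of_isWeaklyRegular (k := k) (ModuleCat.of A (A ⧸ augmentationIdeal 𝒜)) rs'
    hann A hreg
  have hinj := hasInjectiveDimensionLT_quadratic e.toRingEquiv _ hS
  rw [← hlen]
  refine ⟨fun i hi => ?_, ?_⟩
  -- Below the length of the sequence, vanishing comes from regularity; above it, from the injective
  -- dimension.
  · rcases lt_or_gt_of_ne hi with h | h
    · exact h1 i h
    · exact HasInjectiveDimensionLT.subsingleton (ModuleCat.of A A) (rs.length + 1) i
        (by omega) _
  · have hmem' : ∀ x, x ∈ (Ideal.ofList rs' • ⊤ : Submodule A A) ↔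
        ε (e.symm x).re = 0 ∧ ε (e.symm x).im = 0 := by
      intro x
      rw [smul_eq_mul, Ideal.mul_top, hmem]
    -- Since `a` and `b` die under `ε`, the quotient by the regular sequence is `k[ω]/(ω²)`. Its
    -- socle is spanned by `ω`, the image of `1` under `v`.
    let v : (A ⧸ augmentationIdeal 𝒜) →ₗ[A] A ⧸ (Ideal.ofList rs' • ⊤ : Submodule A A) :=
      Submodule.liftQ (augmentationIdeal 𝒜)
        (LinearMap.toSpanSingleton A _ (Submodule.Quotient.mk (e QuadraticAlgebra.omega))) (by
          intro x hx
          rw [h𝒜] at hx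
          rw [LinearMap.mem_ker, LinearMap.toSpanSingleton_apply, ← Submodule.Quotient.mk_smul,
            Submodule.Quotient.mk_eq_zero, hmem']
          simp [hx, ha, hb])
    have hv1 : ∀ x : A, v (Submodule.Quotient.mk x) =
      x • (Submodule.Quotient.mk (e QuadraticAlgebra.omega) :
        A ⧸ (Ideal.ofList rs' • ⊤ : Submodule A A)) := fun _ => rfl
    refine finrank_ext_eq_one (A ⧸ augmentationIdeal 𝒜) rs' hann A hreg v ?_ ?_
    · intro hv
      have h := hv1 1
      rw [hv, LinearMap.zero_apply, one_smul, eq_comm, Submodule.Quotient.mk_eq_zero, hmem'] at h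
      simp at h
    · intro w
      -- The image `m` of `1` is killed by `ω`, so its coefficient at `1` vanishes under `ε` and `w`
      -- is the multiple of `v` by the other coefficient.
      obtain ⟨m, hm⟩ := Submodule.Quotient.mk_surjective _ (w (Submodule.Quotient.mk (1 : A)))
      refine ⟨ε (e.symm m).im, ?_⟩
      have hω : e QuadraticAlgebra.omega • (Submodule.Quotient.mk (1 : A) :
          A ⧸ augmentationIdeal 𝒜) = 0 := by
        rw [← Submodule.Quotient.mk_smul, Submodule.Quotient.mk_eq_zero, h𝒜]
        simp
      have h2 : (Submodule.Quotient.mk (e QuadraticAlgebra.omega * m) :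
          A ⧸ (Ideal.ofList rs' • ⊤ : Submodule A A)) = 0 := by
        rw [← smul_eq_mul, Submodule.Quotient.mk_smul, hm, ← map_smul]
        exact (congrArg w hω).trans (map_zero w)
      rw [Submodule.Quotient.mk_eq_zero, hmem'] at h2
      have h3 : ε (e.symm m).re = 0 := by
        have := h2.2
        simpa [hb] using this
      refine LinearMap.ext fun x => ?_
      obtain ⟨x, rfl⟩ := Submodule.Quotient.mk_surjective _ x
      have h4 : (Submodule.Quotient.mk x : A ⧸ augmentationIdeal 𝒜) =
        x • Submodule.Quotient.mk (1 : A) := by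
        rw [← Submodule.Quotient.mk_smul, smul_eq_mul, mul_one]
      have h5 : w (Submodule.Quotient.mk x) = x • Submodule.Quotient.mk m := by
        rw [hm, ← map_smul]
        exact congrArg w h4
      refine h5.trans ?_
      rw [LinearMap.smul_apply, hv1, smul_comm]
      congr 1
      rw [← Submodule.Quotient.mk_smul, Submodule.Quotient.eq, hmem']
      have h6 : (algebraMap k (QuadraticAlgebra S a b) (ε (e.symm m).im)).re =
        algebraMap k S (ε (e.symm m).im) := rfl
      have h7 : (algebraMap k (QuadraticAlgebra S a b) (ε (e.symm m).im)).im = 0 := rfl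
      simp [h3, h6, h7, hεk]

end Gorenstein

/-- A quadratic extension by a root of `X ^ 2 - b * X + p * q`, with `b`, `p`, `q` in the kernel of an
augmentation, has infinite global dimension. -/
lemma not_hasFiniteGlobalDimension_quadratic [IsDomain S] {p q : S} (hp : p ≠ 0) (hq : q ≠ 0)
    {A : Type u} [CommRing A] (e : QuadraticAlgebra S (-(p * q)) b ≃+* A) (ε : S →+* k)
    (hb : ε b = 0) (hεp : ε p = 0) (hεq : ε q = 0) : ¬ HasFiniteGlobalDimension A := by
  -- Comparing coefficients at `1` gives `v.re = -c.im * q`. The product is kept as `r` so that the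
  -- two orders of its factors can be used over one and the same quadratic algebra.
  have key : ∀ {r p q : S} (hr : r = p * q) (hp : p ≠ 0) (v c : QuadraticAlgebra S (-r) b),
      v * algebraMap S (QuadraticAlgebra S (-r) b) p = c * QuadraticAlgebra.omega →
      ∃ s t : QuadraticAlgebra S (-r) b,
        v = s * QuadraticAlgebra.omega + t * algebraMap S (QuadraticAlgebra S (-r) b) q := by
    intro r p q hr hp v c h
    have h1 := congrArg QuadraticAlgebra.re h
    simp at h1
    have h2 : v.re = -(c.im * q) := mul_left_cancel₀ hp (by linear_combination h1 - c.im * hr)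
    refine ⟨algebraMap S (QuadraticAlgebra S (-r) b) v.im,
      algebraMap S (QuadraticAlgebra S (-r) b) (-c.im), ?_⟩
    ext <;> simp [h2]
  have key' : ∀ {r p q : S} (hr : r = p * q) (hp : p ≠ 0) (e : QuadraticAlgebra S (-r) b ≃+* A)
      (v c : A), v * e (algebraMap S _ p) = c * e QuadraticAlgebra.omega →
      ∃ s t, v = s * e QuadraticAlgebra.omega + t * e (algebraMap S _ q) := by
    intro r p q hr hp e v c h
    obtain ⟨v, rfl⟩ := e.surjective v
    obtain ⟨c, rfl⟩ := e.surjective c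
    rw [← map_mul, ← map_mul] at h
    obtain ⟨s, t, hst⟩ := key hr hp v c (e.injective h)
    exact ⟨e s, e t, by rw [hst, map_add, map_mul, map_mul]⟩
  have hε0 : ε (-(p * q)) = 0 := by simp [hεp]
  refine not_hasFiniteGlobalDimension_of_periodic
    (y := e (algebraMap S _ b - QuadraticAlgebra.omega))
    ((quadraticEval ε hε0).comp e.symm.toRingHom) ?_ ?_ (key' rfl hp e)
    (key' (mul_comm p q) hq e) ?_ ?_ ?_ ?_
  · intro v hv
    obtain ⟨v, rfl⟩ := e.surjective v
    rw [← map_mul, e.map_eq_zero_iff] at hv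
    have h1 := congrArg QuadraticAlgebra.re hv
    have h2 := congrArg QuadraticAlgebra.im hv
    simp [hp, hq] at h1
    simp [h1] at h2
    rw [show v = 0 from QuadraticAlgebra.ext h2 h1, map_zero]
  · rw [← map_mul, ← map_mul]
    congr 1
    ext <;> simp
  all_goals simp [quadraticEval, hb, hεp, hεq]

end Hypersurface

/-! ### Polynomial rings: injective dimension and the sequence of variables -/

section PolynomialRing

open RingTheory.Sequence

variable (k : Type u) [Field k]

/-- The one-variable step concerns `R[X]`, so the bound is obtained for an iterated polynomial ring
isomorphic to the multivariate one. -/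
lemma exists_ringEquiv_hasInjectiveDimensionLT (n : ℕ) :
    ∃ (S : Type u) (_ : CommRing S), Nonempty (MvPolynomial (Fin n) k ≃+* S) ∧
      ∀ M : ModuleCat.{u} S, HasInjectiveDimensionLT M (n + 1) := by
  induction n with
  | zero =>
    exact ⟨k, inferInstance, ⟨MvPolynomial.isEmptyRingEquiv k (Fin 0)⟩,
      hasInjectiveDimensionLT_of_field⟩
  | succ n ih =>
    obtain ⟨S, _, ⟨e⟩, h⟩ := ih
    exact ⟨Polynomial S, inferInstance,
      ⟨(MvPolynomial.finSuccEquiv k n).toRingEquiv.trans (Polynomial.mapEquiv e)⟩,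
      hasInjectiveDimensionLT_polynomial _ h⟩

/-- A ring isomorphism is a Frobenius extension of rank one, its inverse being the form; this
transports the bound. -/
lemma hasInjectiveDimensionLT_mvPolynomial (n : ℕ) :
    HasInjectiveDimensionLT
      (ModuleCat.of (MvPolynomial (Fin n) k) (MvPolynomial (Fin n) k)) (n + 1) := by
  obtain ⟨S, _, ⟨e⟩, h⟩ := exists_ringEquiv_hasInjectiveDimensionLT k n
  let f : S →+* MvPolynomial (Fin n) k := e.symm.toRingHom
  let _ : Module S (MvPolynomial (Fin n) k) := Module.compHom _ f
  let e' : S ≃ₗ[S] MvPolynomial (Fin n) k :=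
    { e.symm with
      map_smul' r x := map_mul e.symm r x }
  have : Module.Projective S (MvPolynomial (Fin n) k) := Module.Projective.of_equiv e'
  have he' : ∀ x y, e' (x * y) = e' x * e' y := map_mul e.symm
  have he1 : e' 1 = 1 := map_one e.symm
  refine hasInjectiveDimensionLT_of_frobenius f (fun r x => rfl) e'.symm.toLinearMap ?_ ?_ _ (h _)
  · intro a ha
    have := ha 1
    rw [one_mul] at this
    exact e'.symm.map_eq_zero_iff.1 this
  · intro φ
    refine ⟨e' (φ 1), fun c => ?_⟩
    obtain ⟨c, rfl⟩ := e'.surjective c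
    rw [← he']
    change φ (e' c) = e'.symm (e' _)
    rw [e'.symm_apply_apply, ← smul_eq_mul, ← map_smul, ← he1, ← map_smul, smul_eq_mul, mul_one]

lemma isWeaklyRegular_map_ringEquiv {R R' : Type u} [CommRing R] [CommRing R'] (e : R ≃+* R')
    {rs : List R} (h : IsWeaklyRegular R rs) : IsWeaklyRegular R' (rs.map e) := by
  refine (AddEquiv.isWeaklyRegular_congr (e := e.toAddEquiv) ?_).1 h
  rw [List.forall₂_map_right_iff, List.forall₂_same]
  exact fun r _ x => map_mul e r x

lemma mem_ofList_map_ringEquiv {R R' : Type u} [CommRing R] [CommRing R'] (e : R ≃+* R')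
    {rs : List R} {x : R} : e x ∈ Ideal.ofList (rs.map e) ↔ x ∈ Ideal.ofList rs := by
  have h : Ideal.ofList (rs.map e) = (Ideal.ofList rs).map e :=
    (Ideal.map_ofList (e : R →+* R') _).symm
  rw [h, Ideal.mem_map_of_equiv]
  constructor
  · rintro ⟨y, hy, hxy⟩
    rwa [← e.injective hxy]
  · exact fun hp => ⟨x, hp, rfl⟩

/-- The sequence is built by adjoining one variable at a time, and the description of its ideal is
carried through the induction. -/
lemma exists_isWeaklyRegular_mvPolynomial (n : ℕ) :
    ∃ rs : List (MvPolynomial (Fin n) k), rs.length = n ∧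
      IsWeaklyRegular (MvPolynomial (Fin n) k) rs ∧
      ∀ p, p ∈ Ideal.ofList rs ↔ MvPolynomial.constantCoeff p = 0 := by
  induction n with
  | zero =>
    refine ⟨[], rfl, IsWeaklyRegular.nil _ _, fun p => ?_⟩
    rw [Ideal.ofList_nil, Ideal.mem_bot]
    refine ⟨fun h => by rw [h, map_zero], fun h => ?_⟩
    have h0 : MvPolynomial.isEmptyRingEquiv k (Fin 0) p = 0 :=
      h
    exact (MvPolynomial.isEmptyRingEquiv k (Fin 0)).map_eq_zero_iff.1 h0
  | succ n ih =>
    obtain ⟨rs, h1, h2, h3⟩ := ih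
    let rs' : List (Polynomial (MvPolynomial (Fin n) k)) := rs.map Polynomial.C ++ [Polynomial.X]
    have hlen : rs'.length = n + 1 := by simp [rs', h1]
    let e := (MvPolynomial.finSuccEquiv k n).toRingEquiv.symm
    refine ⟨rs'.map e, (List.length_map _).trans hlen,
      isWeaklyRegular_map_ringEquiv e (isWeaklyRegular_polynomial h2), fun p => ?_⟩
    have h6 : e (MvPolynomial.finSuccEquiv k n p) = p :=
      (MvPolynomial.finSuccEquiv k n).symm_apply_apply p
    have h7 := mem_ofList_map_ringEquiv e (rs := rs') (x := MvPolynomial.finSuccEquiv k n p)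
    rw [h6] at h7
    rw [h7, mem_ofList_polynomial, h3, MvPolynomial.constantCoeff_eq,
      MvPolynomial.constantCoeff_eq, MvPolynomial.finSuccEquiv_coeff_coeff]
    simp

end PolynomialRing

/-! ### The two presentations of the hypersurface and its homological properties -/

section Hypersurface

open MvPolynomial

variable (k : Type u) [Field k]

/-- The hypersurface `x * y = z * t ^ 2`, as a quadratic extension of `k[w, z, t]`
with `w = x + y`. -/
abbrev Hypersurface : Type u :=
  QuadraticAlgebra (MvPolynomial (Fin 3) k) (-(X 1 * X 2 ^ 2)) (X 0)

/-- The augmentation of the hypersurface ring. -/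
def hypersurfaceEval : Hypersurface k →+* k :=
  quadraticEval constantCoeff (by simp)

/-- The hypersurface `x * y = z * t ^ 2`, as a quotient of `k[x, y, z, t]`. -/
abbrev HypersurfaceQuot : Type u :=
  MvPolynomial (Fin 4) k ⧸ (Ideal.span {X 0 * X 1 - X 2 * X 3 ^ 2} : Ideal (MvPolynomial (Fin 4) k))

/-- The images of `x`, `y`, `z`, `t` in the quadratic extension. -/
def hypersurfaceVars : Fin 4 → Hypersurface k :=
  ![⟨0, 1⟩, ⟨X 0, -1⟩, ⟨X 1, 0⟩, ⟨X 2, 0⟩]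

/-- The map from the quotient of the polynomial ring to the quadratic extension. -/
def hypersurfaceQuotTo : HypersurfaceQuot k →ₐ[k] Hypersurface k :=
  Ideal.Quotient.liftₐ _ (aeval (hypersurfaceVars k)) (by
    intro a ha
    obtain ⟨c, rfl⟩ := Ideal.mem_span_singleton'.1 ha
    rw [map_mul]
    convert mul_zero _
    simp only [map_sub, map_mul, map_pow, aeval_X, hypersurfaceVars]
    refine QuadraticAlgebra.ext ?_ ?_ <;> simp [pow_two])

lemma hypersurfaceQuotTo_mk (p : MvPolynomial (Fin 4) k) :
    hypersurfaceQuotTo k (Ideal.Quotient.mk _ p) = aeval (hypersurfaceVars k) p := rfl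

lemma bijective_hypersurfaceQuotTo : Function.Bijective (hypersurfaceQuotTo k) := by
  -- The inverse sends `w` to `x + y` and `ω` to `x`. It is multiplicative because `x² = (x + y) x -
  -- z t²` in the quotient.
  let f : MvPolynomial (Fin 3) k →ₐ[k] HypersurfaceQuot k :=
    aeval ![Ideal.Quotient.mk _ (X 0 + X 1), Ideal.Quotient.mk _ (X 2), Ideal.Quotient.mk _ (X 3)]
  let g : Hypersurface k → HypersurfaceQuot k := fun x =>
    f x.re + f x.im * Ideal.Quotient.mk _ (X 0)
  have hrel : (Ideal.Quotient.mk _ (X 0 * X 1) : HypersurfaceQuot k) =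
      Ideal.Quotient.mk _ (X 2 * X 3 ^ 2) := by
    rw [Ideal.Quotient.eq]
    exact Ideal.mem_span_singleton_self _
  have hfg : ∀ s, hypersurfaceQuotTo k (f s) = algebraMap _ (Hypersurface k) s := by
    have h : (hypersurfaceQuotTo k).comp f = IsScalarTower.toAlgHom k _ (Hypersurface k) := by
      ext i : 1
      fin_cases i <;> refine QuadraticAlgebra.ext ?_ ?_ <;>
        simp [f, hypersurfaceQuotTo_mk, hypersurfaceVars]
    exact fun s => DFunLike.congr_fun h s
  have h1 : ∀ x, hypersurfaceQuotTo k (g x) = x := by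
    intro x
    simp only [g, map_add, map_mul, hfg, hypersurfaceQuotTo_mk, aeval_X]
    refine QuadraticAlgebra.ext ?_ ?_ <;> simp [hypersurfaceVars]
  have hg1 : g 1 = 1 := by
    change f 1 + f 0 * _ = 1
    rw [map_one, map_zero, zero_mul, add_zero]
  have hgmul : ∀ x y, g (x * y) = g x * g y := by
    intro x y
    have hX0 : f (X 0) = Ideal.Quotient.mk _ (X 0) + Ideal.Quotient.mk _ (X 1) := by simp [f]
    have hX1 : f (X 1) = Ideal.Quotient.mk _ (X 2) := by simp [f]
    have hX2 : f (X 2) = Ideal.Quotient.mk _ (X 3) := by simp [f]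
    simp only [map_mul, map_pow] at hrel
    simp only [g, QuadraticAlgebra.re_mul, QuadraticAlgebra.im_mul, map_add, map_mul, map_neg,
      map_pow, hX0, hX1, hX2]
    linear_combination (f x.im * f y.im) * hrel
  have hgadd : ∀ x y, g (x + y) = g x + g y := by
    intro x y
    simp only [g, QuadraticAlgebra.re_add, QuadraticAlgebra.im_add, map_add]
    ring
  let g' : Hypersurface k →ₐ[k] HypersurfaceQuot k :=
    { toFun := g
      map_one' := hg1
      map_mul' := hgmul
      map_zero' := by simp [g]
      map_add' := hgadd
      commutes' := fun c => by
        change f (algebraMap k _ c) + f 0 * _ = _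
        rw [map_zero, zero_mul, add_zero, f.commutes] }
  have h2 : g'.comp (hypersurfaceQuotTo k) = AlgHom.id k _ := by
    refine Ideal.Quotient.algHom_ext _ ?_
    ext i : 1
    fin_cases i <;> simp [g', g, f, hypersurfaceQuotTo_mk, hypersurfaceVars]
    ring
  exact ⟨fun x y h => by
    rw [← AlgHom.id_apply (R := k) x, ← AlgHom.id_apply (R := k) y, ← h2, AlgHom.comp_apply, h]
    rfl, fun x => ⟨g x, h1 x⟩⟩

/-- The two descriptions of the hypersurface `x * y = z * t ^ 2` agree. -/
def hypersurfaceEquiv : HypersurfaceQuot k ≃ₐ[k] Hypersurface k :=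
  AlgEquiv.ofBijective (hypersurfaceQuotTo k) (bijective_hypersurfaceQuotTo k)

lemma hypersurfaceEval_hypersurfaceEquiv (p : MvPolynomial (Fin 4) k) :
    hypersurfaceEval k (hypersurfaceEquiv k (Ideal.Quotient.mk _ p)) = constantCoeff p := by
  have h : (hypersurfaceEval k).comp (aeval (R := k) (hypersurfaceVars k)).toRingHom =
      constantCoeff := by
    ext i
    · simp [hypersurfaceEval, quadraticEval]
      exact constantCoeff_C _ i
    · fin_cases i <;> simp [hypersurfaceEval, quadraticEval, hypersurfaceVars]
  exact RingHom.congr_fun h p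

variable {k}

/-- The hypersurface `x * y = z * t ^ 2` is Gorenstein but not regular. -/
lemma homological_of_hypersurface_of_commRing {A : Type u} [CommRing A] [Algebra k A]
    (e : Hypersurface k ≃ₐ[k] A) (𝒜 : ℕ → Submodule k A)
    (h𝒜 : ∀ x, x ∈ augmentationIdeal 𝒜 ↔ hypersurfaceEval k (e.symm x) = 0) :
    injectiveDimension (ModuleCat.of A A) = 3 ∧ ExtTrivialModule 𝒜 3 ∧
      ¬ HasFiniteGlobalDimension A := by
  obtain ⟨rs, h1, h2, h3⟩ := exists_isWeaklyRegular_mvPolynomial k 3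
  have hS := hasInjectiveDimensionLT_mvPolynomial k 3
  have hExt : ExtTrivialModule 𝒜 3 := by
    have h := extTrivialModule_quadratic e (rs := rs) (ε := constantCoeff) (fun c => by simp)
      (by simp) (by simp) h3 h2 (by rw [h1]; exact hS) 𝒜 h𝒜
    rwa [h1] at h
  refine ⟨le_antisymm ?_ ?_, hExt, ?_⟩
  · have := hasInjectiveDimensionLT_quadratic e.toRingEquiv _ hS
    exact (injectiveDimension_le_iff _ 3).2 this
  -- The nonzero `Ext³` is the lower bound.
  · refine (injectiveDimension_ge_iff _ 3).2 fun h => ?_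
    have := HasInjectiveDimensionLT.subsingleton (ModuleCat.of A A) 3 3 le_rfl (trivialModule 𝒜)
    have h4 := hExt.finrank_eq_one
    rw [Module.finrank_zero_of_subsingleton] at h4
    exact zero_ne_one h4
  -- The factorisation used is `p = z`, `q = t²`.
  · exact not_hasFiniteGlobalDimension_quadratic (X_ne_zero 1) (pow_ne_zero 2 (X_ne_zero 2))
      e.toRingEquiv (constantCoeff (σ := Fin 3) (R := k)) (by simp) (by simp) (by simp)

/-- The fixed subring and its opposite carry only a `Ring` structure. Commutativity comes through
`e`, and the commutative structure chosen extends the given one. -/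
lemma homological_of_hypersurface {A : Type u} [Ring A] [Algebra k A]
    (e : Hypersurface k ≃ₐ[k] A) (𝒜 : ℕ → Submodule k A)
    (h𝒜 : ∀ x, x ∈ augmentationIdeal 𝒜 ↔ hypersurfaceEval k (e.symm x) = 0) :
    injectiveDimension (ModuleCat.of A A) = 3 ∧ ExtTrivialModule 𝒜 3 ∧
      ¬ HasFiniteGlobalDimension A := by
  have hcomm : ∀ x y : A, x * y = y * x := by
    intro x y
    obtain ⟨x, rfl⟩ := e.surjective x
    obtain ⟨y, rfl⟩ := e.surjective y
    rw [← map_mul, ← map_mul, mul_comm x y]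
  obtain ⟨i, hi⟩ : ∃ i : CommRing A, i.toRing = ‹Ring A› :=
    ⟨{ ‹Ring A› with mul_comm := hcomm }, rfl⟩
  subst hi
  exact homological_of_hypersurface_of_commRing e 𝒜 h𝒜

end Hypersurface

/-! ### The fixed subring: generators, relation and commutativity -/

section FixedSubring

variable (k : Type u) [Field k]

/-- The augmentation of `D(0, 1)`. -/
def evalDD : DD k →ₐ[k] k :=
  RingQuot.liftAlgHom k ⟨FreeAlgebra.lift k fun _ => 0, by rintro x y (_ | _) <;> simp⟩

@[simp] lemma evalDD_uu : evalDD k (uu k) = 0 := by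
  simp [evalDD, DownUpAlgebra.up]

@[simp] lemma evalDD_dd : evalDD k (dd k) = 0 := by
  simp [evalDD, DownUpAlgebra.down]

variable {k}

lemma evalDD_of_mem {n : ℕ} (hn : 0 < n) {a : DD k} (ha : a ∈ gradingDD k n) :
    evalDD k a = 0 := by
  rw [gradingDD_eq] at ha
  have h : monomSpan k {x | monomDeg x = n} ≤ LinearMap.ker (evalDD k).toLinearMap := by
    rw [monomSpan_le]
    rintro ⟨i, j, l⟩ rfl
    simp only [monomDeg] at hn
    rw [LinearMap.mem_ker, AlgHom.toLinearMap_apply, monom]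
    simp only [map_mul, map_pow, evalDD_uu, evalDD_dd]
    rcases Nat.eq_zero_or_pos i with rfl | hi
    · rcases Nat.eq_zero_or_pos j with rfl | hj
      · rw [zero_pow (by omega : l ≠ 0), mul_zero]
      · rw [mul_zero, zero_pow hj.ne', mul_zero, zero_mul]
    · rw [zero_pow hi.ne', zero_mul, zero_mul]
  exact h ha

variable (k)

lemma dd_sq_central (a : DD k) : Commute (dd k ^ 2) a := by
  have hu : Commute (dd k ^ 2) (uu k) := by rw [pow_two]; exact dd_sq_comm k
  have hd : Commute (dd k ^ 2) (dd k) := (Commute.refl _).pow_left 2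
  induction a using DD_induction with
  | hc r => exact (Algebra.commutes r _).symm
  | hu => exact hu
  | hd => exact hd
  | hadd a b ha hb => exact ha.add_right hb
  | hmul a b ha hb => exact ha.mul_right hb

lemma uu_sq_central (a : DD k) : Commute (uu k ^ 2) a := by
  have hd : Commute (uu k ^ 2) (dd k) := by rw [pow_two]; exact uu_sq_comm k
  have hu : Commute (uu k ^ 2) (uu k) := (Commute.refl _).pow_left 2
  induction a using DD_induction with
  | hc r => exact (Algebra.commutes r _).symm
  | hu => exact hu
  | hd => exact hd
  | hadd a b ha hb => exact ha.add_right hb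
  | hmul a b ha hb => exact ha.mul_right hb

lemma uu_pow_four_central (a : DD k) : Commute (uu k ^ 4) a := by
  rw [show uu k ^ 4 = (uu k ^ 2) ^ 2 by rw [← pow_mul]]
  exact (uu_sq_central k a).pow_left 2

lemma monom_mul_dd_sq (i j l : ℕ) : monom k (i, j, l) * dd k ^ 2 = monom k (i, j, l + 2) := by
  rw [monom, monom, pow_add (dd k), mul_assoc _ (dd k ^ l)]

lemma monom_mul_uu_pow_four (i j l : ℕ) :
    monom k (i, j, l) * uu k ^ 4 = monom k (i + 4, j, l) := by
  rw [← (uu_pow_four_central k _).eq, monom, monom, add_comm, pow_add (uu k)]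
  simp only [mul_assoc]

lemma monom_mul_du_sq (i j l : ℕ) :
    monom k (i, j, 2 * l) * (dd k * uu k) ^ 2 = monom k (i, j + 2, 2 * l) := by
  rw [monom, monom, pow_mul, mul_assoc, ((dd_sq_central k _).pow_left l).eq, pow_add]
  simp only [mul_assoc]

/-- Moving `(ud)²` leftwards past an odd power of `d` turns it into `(du)²`. So `(du)²` raises the
middle exponent when the last one is even, and `(ud)²` when it is odd. -/
lemma monom_mul_ud_sq (i j l : ℕ) :
    monom k (i, j, 2 * l + 1) * (uu k * dd k) ^ 2 = monom k (i, j + 2, 2 * l + 1) := by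
  have h : dd k * (uu k * dd k) ^ 2 = (dd k * uu k) ^ 2 * dd k := by simp only [pow_two, mul_assoc]
  rw [monom, monom, pow_succ, pow_mul]
  calc _ = uu k ^ i * (dd k * uu k) ^ j * (dd k ^ 2) ^ l * (dd k * (uu k * dd k) ^ 2) := by
        simp only [mul_assoc]
    _ = uu k ^ i * (dd k * uu k) ^ j * ((dd k ^ 2) ^ l * (dd k * uu k) ^ 2) * dd k := by
        rw [h]; simp only [mul_assoc]
    _ = _ := by rw [((dd_sq_central k _).pow_left l).eq, pow_add (dd k * uu k)]; simp only [mul_assoc]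

/-- The hypersurface relation, obtained by pulling out the central squares one by one. The opposite
product has the same value, so the two generators commute. -/
lemma du_sq_mul_ud_sq :
    (dd k * uu k) ^ 2 * (uu k * dd k) ^ 2 = uu k ^ 4 * (dd k ^ 2) ^ 2 := by
  have hu := fun a => (uu_sq_central k a).eq
  have hd := fun a => (dd_sq_central k a).eq
  calc _ = dd k * uu k * dd k * uu k ^ 2 * (dd k * uu k * dd k) := by simp only [pow_two, mul_assoc]
    _ = uu k ^ 2 * (dd k * uu k * dd k ^ 2 * (uu k * dd k)) := by
        rw [← hu]; simp only [pow_two, mul_assoc]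
    _ = uu k ^ 2 * (dd k ^ 2 * (dd k * uu k ^ 2 * dd k)) := by
        rw [← hd]; simp only [pow_two, mul_assoc]
    _ = uu k ^ 2 * (dd k ^ 2 * (uu k ^ 2 * dd k ^ 2)) := by
        rw [← hu]; simp only [pow_two, mul_assoc]
    _ = uu k ^ 2 * (uu k ^ 2 * dd k ^ 2 * dd k ^ 2) := by rw [hd]
    _ = _ := by rw [pow_two (dd k ^ 2), show 4 = 2 + 2 from rfl, pow_add]; simp only [mul_assoc]

lemma ud_sq_mul_du_sq :
    (uu k * dd k) ^ 2 * (dd k * uu k) ^ 2 = uu k ^ 4 * (dd k ^ 2) ^ 2 := by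
  have hu := fun a => (uu_sq_central k a).eq
  have hd := fun a => (dd_sq_central k a).eq
  calc _ = uu k * dd k * uu k * dd k ^ 2 * (uu k * dd k * uu k) := by simp only [pow_two, mul_assoc]
    _ = dd k ^ 2 * (uu k * dd k * uu k ^ 2 * (dd k * uu k)) := by
        rw [← hd]; simp only [pow_two, mul_assoc]
    _ = dd k ^ 2 * (uu k ^ 2 * (uu k * dd k ^ 2 * uu k)) := by
        rw [← hu]; simp only [pow_two, mul_assoc]
    _ = dd k ^ 2 * (uu k ^ 2 * (dd k ^ 2 * uu k ^ 2)) := by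
        rw [← hd]; simp only [pow_two, mul_assoc]
    _ = uu k ^ 2 * (uu k ^ 2 * dd k ^ 2) * dd k ^ 2 := by rw [hd, hd (uu k ^ 2)]
    _ = _ := by rw [pow_two (dd k ^ 2), show 4 = 2 + 2 from rfl, pow_add]; simp only [mul_assoc]

variable {k}

/-- The steps 4, 2, 2 are the orders of `ρ`, `rρ` and `r`, so the group degree is constant along
them and sixteen reduced monomials remain. -/
lemma monom_induction {p : ℕ × ℕ × ℕ → Prop}
    (h0 : ∀ r < 4, ∀ s < 2, ∀ t < 2, p (r, s, t))
    (hu : ∀ i j l, p (i, j, l) → p (i + 4, j, l)) (hj : ∀ i j l, p (i, j, l) → p (i, j + 2, l))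
    (hd : ∀ i j l, p (i, j, l) → p (i, j, l + 2)) (x : ℕ × ℕ × ℕ) : p x := by
  obtain ⟨i, j, l⟩ := x
  have h1 : ∀ a b c, p (i % 4 + 4 * a, j % 2 + 2 * b, l % 2 + 2 * c) := by
    intro a b c
    induction a with
    | succ a ih => exact hu _ _ _ ih
    | zero =>
      induction b with
      | succ b ih => exact hj _ _ _ ih
      | zero =>
        induction c with
        | succ c ih => exact hd _ _ _ ih
        | zero =>
          exact h0 _ (Nat.mod_lt _ (by norm_num)) _ (Nat.mod_lt _ (by norm_num)) _
            (Nat.mod_lt _ (by norm_num))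
  have h2 := h1 (i / 4) (j / 2) (l / 2)
  rwa [Nat.mod_add_div, Nat.mod_add_div, Nat.mod_add_div] at h2

lemma monomGDeg_mod (i j l : ℕ) : monomGDeg (i, j, l) = monomGDeg (i % 4, j % 2, l % 2) := by
  simp only [monomGDeg]
  rw [pow_eq_pow_mod i (show rho8 ^ 4 = 1 by decide),
    pow_eq_pow_mod j (show (refl8 * rho8) ^ 2 = 1 by decide),
    pow_eq_pow_mod l (show refl8 ^ 2 = 1 by decide)]

lemma monom_mem_component (x : ℕ × ℕ × ℕ) :
    monom k x ∈ component (dihedralCoaction k) (monomGDeg x) := dihedralCoaction_monom x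

lemma mem_fixedDD_iff {a : DD k} :
    a ∈ fixedDD k ↔ a ∈ component (dihedralCoaction k) 1 := by
  change _ = _ ↔ _ = _
  simp [MonoidAlgebra.one_def]

lemma monom_mem_fixedDD {x : ℕ × ℕ × ℕ} (hx : monomGDeg x = 1) : monom k x ∈ fixedDD k := by
  rw [mem_fixedDD_iff, ← hx]
  exact monom_mem_component x

lemma uu_pow_four_mem : uu k ^ 4 ∈ fixedDD k := by
  have := monom_mem_fixedDD (k := k) (x := (4, 0, 0)) (by decide)
  simpa [monom] using this

lemma dd_sq_mem : dd k ^ 2 ∈ fixedDD k := by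
  have := monom_mem_fixedDD (k := k) (x := (0, 0, 2)) (by decide)
  simpa [monom] using this

lemma du_sq_mem : (dd k * uu k) ^ 2 ∈ fixedDD k := by
  have := monom_mem_fixedDD (k := k) (x := (0, 2, 0)) (by decide)
  simpa [monom] using this

lemma monom_one_one_one : monom k (1, 1, 1) = (uu k * dd k) ^ 2 := by
  simp only [monom, pow_one, pow_two, mul_assoc]

lemma ud_sq_mem : (uu k * dd k) ^ 2 ∈ fixedDD k := by
  rw [← monom_one_one_one]
  exact monom_mem_fixedDD (by decide)

/-- Every monomial arises from a reduced one of the same group degree by right multiplication by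
generators of the fixed subring. -/
lemma monom_mem_of_reduced {p : DD k → Prop} {g : DihedralGroup 4}
    (hp : ∀ a, p a → ∀ b ∈ ({(dd k * uu k) ^ 2, (uu k * dd k) ^ 2, dd k ^ 2, uu k ^ 4} : Set (DD k)),
      p (a * b))
    (h0 : ∀ r < 4, ∀ s < 2, ∀ t < 2, monomGDeg (r, s, t) = g → p (monom k (r, s, t)))
    (x : ℕ × ℕ × ℕ) (hx : monomGDeg x = g) : p (monom k x) := by
  induction x using monom_induction with
  | h0 r hr s hs t ht => exact h0 r hr s hs t ht hx
  | hu i j l ih =>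
    rw [← monom_mul_uu_pow_four]
    refine hp _ (ih ?_) _ (by simp)
    rw [monomGDeg_mod] at hx ⊢
    rwa [Nat.add_mod_right] at hx
  | hj i j l ih =>
    have h1 := ih (by
      rw [monomGDeg_mod] at hx ⊢
      rwa [Nat.add_mod_right] at hx)
    obtain ⟨l, rfl | rfl⟩ := Nat.even_or_odd' l
    · rw [← monom_mul_du_sq]
      exact hp _ h1 _ (by simp)
    · rw [← monom_mul_ud_sq]
      exact hp _ h1 _ (by simp)
  | hd i j l ih =>
    rw [← monom_mul_dd_sq]
    refine hp _ (ih ?_) _ (by simp)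
    rw [monomGDeg_mod] at hx ⊢
    rwa [Nat.add_mod_right] at hx

lemma subset_fixedDD :
    ({(dd k * uu k) ^ 2, (uu k * dd k) ^ 2, dd k ^ 2, uu k ^ 4} : Set (DD k)) ⊆ fixedDD k := by
  rintro a (rfl | rfl | rfl | rfl)
  exacts [du_sq_mem, ud_sq_mem, dd_sq_mem, uu_pow_four_mem]

lemma fixedDD_eq_adjoin : fixedDD k =
    Algebra.adjoin k {(dd k * uu k) ^ 2, (uu k * dd k) ^ 2, dd k ^ 2, uu k ^ 4} := by
  apply le_antisymm
  · intro a ha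
    rw [mem_fixedDD_iff, component_dihedralCoaction] at ha
    have h : monomSpan k {x | monomGDeg x = 1} ≤ Subalgebra.toSubmodule (Algebra.adjoin k
        {(dd k * uu k) ^ 2, (uu k * dd k) ^ 2, dd k ^ 2, uu k ^ 4}) := by
      rw [monomSpan_le]
      intro x hx
      refine monom_mem_of_reduced (p := fun a => a ∈ Algebra.adjoin k
        {(dd k * uu k) ^ 2, (uu k * dd k) ^ 2, dd k ^ 2, uu k ^ 4})
        (fun a ha b hb => mul_mem ha (Algebra.subset_adjoin hb)) ?_ x hx
      have hdec : ∀ (r : Fin 4) (s t : Fin 2), monomGDeg (r, s, t) = 1 →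
          (r.1, s.1, t.1) = (0, 0, 0) ∨ (r.1, s.1, t.1) = (1, 1, 1) := by decide
      intro r hr s hs t ht hg
      obtain h | h := hdec ⟨r, hr⟩ ⟨s, hs⟩ ⟨t, ht⟩ hg
      · rw [h]
        simp [monom]
      · rw [h, monom_one_one_one]
        exact Algebra.subset_adjoin (by simp)
    exact h ha
  · exact Algebra.adjoin_le subset_fixedDD

lemma commute_of_mem_fixedDD {a b : DD k} (ha : a ∈ fixedDD k) (hb : b ∈ fixedDD k) :
    a * b = b * a := by
  rw [fixedDD_eq_adjoin] at ha hb
  have key : ∀ a ∈ ({(dd k * uu k) ^ 2, (uu k * dd k) ^ 2, dd k ^ 2, uu k ^ 4} : Set (DD k)),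
      ∀ b ∈ ({(dd k * uu k) ^ 2, (uu k * dd k) ^ 2, dd k ^ 2, uu k ^ 4} : Set (DD k)),
      Commute a b := by
    have hxy : Commute ((dd k * uu k) ^ 2) ((uu k * dd k) ^ 2) :=
      (du_sq_mul_ud_sq k).trans (ud_sq_mul_du_sq k).symm
    rintro a (rfl | rfl | rfl | rfl) b (rfl | rfl | rfl | rfl)
    all_goals first
      | exact Commute.refl _
      | exact hxy
      | exact hxy.symm
      | exact dd_sq_central k _
      | exact uu_pow_four_central k _
      | exact (dd_sq_central k _).symm
      | exact (uu_pow_four_central k _).symm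
  refine (Algebra.commute_of_mem_adjoin_of_forall_mem_commute hb fun b hb => ?_).eq
  exact (Algebra.commute_of_mem_adjoin_of_forall_mem_commute ha fun a ha => key b hb a ha).symm

/-! ### The components as modules over the fixed subring -/

lemma mem_compDD_iff {g : DihedralGroup 4} {a : DD k} :
    a ∈ compDD k g ↔ a ∈ component (dihedralCoaction k) g := Iff.rfl

lemma monom_mem_compDD {g : DihedralGroup 4} {x : ℕ × ℕ × ℕ} (hx : monomGDeg x = g) :
    monom k x ∈ compDD k g := by
  rw [mem_compDD_iff, ← hx]
  exact monom_mem_component x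

lemma mul_mem_of_mem_fixedDD {W : Submodule (fixedDD k).op (DD k)} {a b : DD k} (ha : a ∈ W)
    (hb : b ∈ fixedDD k) : a * b ∈ W := W.smul_mem ⟨MulOpposite.op b, hb⟩ ha

lemma compDD_eq_span {g : DihedralGroup 4} {s : Set (DD k)} (hs : s ⊆ compDD k g)
    (h : ∀ x, x.1 < 4 → x.2.1 < 2 → x.2.2 < 2 → monomGDeg x = g →
      monom k x ∈ Submodule.span (fixedDD k).op s) :
    compDD k g = Submodule.span (fixedDD k).op s := by
  refine le_antisymm (fun a ha => ?_) (Submodule.span_le.2 hs)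
  have h1 : monomSpan k {x | monomGDeg x = g} ≤
      (Submodule.span (fixedDD k).op s).restrictScalars k := by
    rw [monomSpan_le]
    exact monom_mem_of_reduced (p := fun a => a ∈ Submodule.span (fixedDD k).op s)
      (fun a ha b hb => mul_mem_of_mem_fixedDD ha (subset_fixedDD hb))
      fun r hr s hs t ht => h (r, s, t) hr hs ht
  rw [mem_compDD_iff, component_dihedralCoaction] at ha
  exact h1 ha

lemma coe_compDD_one : (compDD k 1 : Set (DD k)) = fixedDD k := by
  ext a
  exact (mem_compDD_iff.trans mem_fixedDD_iff.symm)

lemma monom_succ_one_one (i : ℕ) : monom k (i + 1, 1, 1) = uu k ^ i * (uu k * dd k) ^ 2 := by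
  simp only [monom, pow_succ, pow_zero, one_mul, mul_assoc]

/-- The second reduced monomial is `u ^ i * (ud)²`, already in `u ^ i B`. For `ρ³` this fails, since
exponent `4` is no longer reduced and `dud` takes its place. -/
lemma compDD_eq_span_singleton {g : DihedralGroup 4} (i : ℕ) (hg : monomGDeg (i, 0, 0) = g)
    (h : ∀ (r : Fin 4) (s t : Fin 2), monomGDeg (r, s, t) = g →
      (r.1, s.1, t.1) = (i, 0, 0) ∨ (r.1, s.1, t.1) = (i + 1, 1, 1)) :
    compDD k g = Submodule.span (fixedDD k).op {uu k ^ i} := by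
  have h0 : monom k (i, 0, 0) = uu k ^ i := by simp [monom]
  refine compDD_eq_span ?_ ?_
  · rw [Set.singleton_subset_iff, ← h0]
    exact monom_mem_compDD hg
  · rintro ⟨r, s, t⟩ hr hs ht hx
    obtain h | h := h ⟨r, hr⟩ ⟨s, hs⟩ ⟨t, ht⟩ hx <;> rw [h]
    · rw [h0]
      exact Submodule.subset_span rfl
    · rw [monom_succ_one_one]
      exact mul_mem_of_mem_fixedDD (Submodule.subset_span rfl) ud_sq_mem

lemma compDD_eq_span_pair {g : DihedralGroup 4} {a b : DD k} (x y : ℕ × ℕ × ℕ) (hx : monom k x = a)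
    (hy : monom k y = b) (hxg : monomGDeg x = g) (hyg : monomGDeg y = g)
    (h : ∀ (r : Fin 4) (s t : Fin 2), monomGDeg (r, s, t) = g →
      (r.1, s.1, t.1) = x ∨ (r.1, s.1, t.1) = y) :
    compDD k g = Submodule.span (fixedDD k).op {a, b} := by
  subst hx hy
  refine compDD_eq_span ?_ ?_
  · rintro _ (rfl | rfl)
    exacts [monom_mem_compDD hxg, monom_mem_compDD hyg]
  · rintro ⟨r, s, t⟩ hr hs ht hz
    obtain h | h := h ⟨r, hr⟩ ⟨s, hs⟩ ⟨t, ht⟩ hz <;> rw [h]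
    · exact Submodule.subset_span (Or.inl rfl)
    · exact Submodule.subset_span (Or.inr rfl)

lemma compDD_one : compDD k 1 = Submodule.span (fixedDD k).op {1} := by
  rw [← pow_zero (uu k)]
  exact compDD_eq_span_singleton 0 (by decide) (by decide)

lemma compDD_rho : compDD k rho8 = Submodule.span (fixedDD k).op {uu k} := by
  rw [← pow_one (uu k)]
  exact compDD_eq_span_singleton 1 (by decide) (by decide)

lemma compDD_rho_sq : compDD k (rho8 ^ 2) = Submodule.span (fixedDD k).op {uu k ^ 2} :=
  compDD_eq_span_singleton 2 (by decide) (by decide)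

lemma compDD_rho_cube : compDD k (rho8 ^ 3) =
    Submodule.span (fixedDD k).op {uu k ^ 3, dd k * uu k * dd k} :=
  compDD_eq_span_pair (3, 0, 0) (0, 1, 1) (by simp [monom]) (by simp [monom]) (by decide)
    (by decide) (by decide)

lemma compDD_refl : compDD k refl8 =
    Submodule.span (fixedDD k).op {dd k, uu k * dd k * uu k} :=
  compDD_eq_span_pair (0, 0, 1) (1, 1, 0) (by simp [monom]) (by simp [monom, mul_assoc])
    (by decide) (by decide) (by decide)

lemma compDD_rho_refl : compDD k (rho8 * refl8) =
    Submodule.span (fixedDD k).op {uu k * dd k, uu k ^ 2 * (dd k * uu k)} :=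
  compDD_eq_span_pair (1, 0, 1) (2, 1, 0) (by simp [monom]) (by simp [monom])
    (by decide) (by decide) (by decide)

lemma compDD_rho_sq_refl : compDD k (rho8 ^ 2 * refl8) =
    Submodule.span (fixedDD k).op {uu k ^ 2 * dd k, uu k ^ 3 * (dd k * uu k)} :=
  compDD_eq_span_pair (2, 0, 1) (3, 1, 0) (by simp [monom]) (by simp [monom])
    (by decide) (by decide) (by decide)

lemma compDD_rho_cube_refl : compDD k (rho8 ^ 3 * refl8) =
    Submodule.span (fixedDD k).op {uu k ^ 3 * dd k, dd k * uu k} :=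
  compDD_eq_span_pair (3, 0, 1) (0, 1, 0) (by simp [monom]) (by simp [monom])
    (by decide) (by decide) (by decide)

lemma map_leftMul_compDD_refl (i : ℕ) :
    (compDD k refl8).map (leftMul (fixedDD k) (uu k ^ i)) =
      Submodule.span (fixedDD k).op {uu k ^ i * dd k, uu k ^ (i + 1) * (dd k * uu k)} := by
  rw [compDD_refl, Submodule.map_span, Set.image_pair]
  congr 2
  change {uu k ^ i * (uu k * dd k * uu k)} = _
  rw [pow_succ]
  simp only [mul_assoc]

lemma uu_pow_mul_monom (s : ℕ) (x : ℕ × ℕ × ℕ) :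
    uu k ^ s * monom k x = monom k (x.1 + s, x.2.1, x.2.2) := by
  rw [monom, monom, add_comm, pow_add]
  simp only [mul_assoc]

/-- The isomorphism is left multiplication by `u ^ s`. It is injective on monomials and adds `s` to
their degree, so homogeneity can be read off in both directions. -/
lemma shiftIso_compDD {g : DihedralGroup 4} (s : ℕ)
    (h : compDD k g = Submodule.span (fixedDD k).op {uu k ^ s}) :
    ShiftIso k s (compDD k 1) (compDD k g) := by
  have hφ : Function.Injective fun x : ℕ × ℕ × ℕ => (x.1 + s, x.2.1, x.2.2) := by
    rintro ⟨i, j, l⟩ ⟨i', j', l'⟩ h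
    simpa using h
  have hT : ∀ x : ℕ × ℕ × ℕ, LinearMap.mulLeft k (uu k ^ s) (monom k x) =
      monom k (x.1 + s, x.2.1, x.2.2) := uu_pow_mul_monom s
  let f : compDD k 1 →ₗ[(fixedDD k).op] compDD k g :=
    (leftMul (fixedDD k) (uu k ^ s)).restrict (by
      intro b hb
      rw [h]
      exact mul_mem_of_mem_fixedDD (Submodule.subset_span rfl) (mem_fixedDD_iff.2 hb))
  have hf : ∀ x, (f x : DD k) = uu k ^ s * x := fun _ => rfl
  refine ⟨LinearEquiv.ofBijective f ⟨?_, ?_⟩, ?_⟩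
  · intro x y hxy
    exact Subtype.ext (injective_of_map_monom hφ hT (congrArg Subtype.val hxy))
  · rintro ⟨y, hy⟩
    rw [h] at hy
    obtain ⟨⟨⟨b⟩, hb⟩, rfl⟩ := Submodule.mem_span_singleton.1 hy
    exact ⟨⟨b, mem_fixedDD_iff.1 hb⟩, rfl⟩
  · intro n x
    change _ ↔ uu k ^ s * (x : DD k) ∈ _
    constructor
    · intro hx
      have := gradedMonoid_gradingDD (k := k)
      have h1 := SetLike.mul_mem_graded (SetLike.pow_mem_graded s (uu_mem_gradingDD (k := k))) hx
      rwa [smul_eq_mul, mul_one, add_comm] at h1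
    · intro hx
      rw [gradingDD_eq] at hx ⊢
      refine mem_of_map_monom_mem (T := LinearMap.mulLeft k (uu k ^ s)) hφ hT hx fun y hy => ?_
      refine monom_mem_monomSpan ?_
      simp only [monomDeg, Set.mem_ofPred_eq] at hy ⊢
      omega

end FixedSubring

/-! ### Augmentation ideals as kernels -/

section Augmentation

variable {k : Type u} [Field k] {A : Type u} [Ring A] [Algebra k A]

/-- The augmentation ideal is the kernel of the augmentation. -/
lemma mem_augmentationIdeal_iff {𝒜 : ℕ → Submodule k A} (h : ⨆ n, 𝒜 n = ⊤)
    (h0 : 𝒜 0 ≤ Submodule.span k {1}) (ε : A →+* k) (hεk : ∀ c, ε (algebraMap k A c) = c)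
    (hε : ∀ n, 0 < n → ∀ a ∈ 𝒜 n, ε a = 0) (x : A) :
    x ∈ augmentationIdeal 𝒜 ↔ ε x = 0 := by
  have hle : ∀ y ∈ augmentationIdeal 𝒜, ε y = 0 := by
    have : augmentationIdeal 𝒜 ≤ RingHom.ker ε := by
      rw [augmentationIdeal, Ideal.span_le]
      rintro a ⟨n, hn, ha⟩
      exact hε n hn a ha
    exact this
  refine ⟨hle x, fun hx => ?_⟩
  have hx' : x ∈ ⨆ n, 𝒜 n := by rw [h]; trivial
  -- Modulo the augmentation ideal every element is a scalar, and `ε` detects that scalar.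
  have key : ∃ c, x - algebraMap k A c ∈ augmentationIdeal 𝒜 := by
    clear hx
    induction hx' using Submodule.iSup_induction' with
    | mem n y hy =>
      rcases Nat.eq_zero_or_pos n with rfl | hn
      · obtain ⟨c, rfl⟩ := Submodule.mem_span_singleton.1 (h0 hy)
        exact ⟨c, by rw [Algebra.algebraMap_eq_smul_one, sub_self]; exact zero_mem _⟩
      · exact ⟨0, by rw [map_zero, sub_zero]; exact Ideal.subset_span ⟨n, hn, hy⟩⟩
    | zero => exact ⟨0, by simp⟩
    | add y z _ _ hy hz =>
      obtain ⟨c, hc⟩ := hy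
      obtain ⟨d, hd⟩ := hz
      refine ⟨c + d, ?_⟩
      rw [map_add, add_sub_add_comm]
      exact add_mem hc hd
  obtain ⟨c, hc⟩ := key
  have h1 := hle _ hc
  rw [map_sub, hx, hεk, zero_sub, neg_eq_zero] at h1
  rwa [h1, map_zero, sub_zero] at hc

lemma IsConnectedGraded.iSup_eq_top {𝒜 : ℕ → Submodule k A} (h : IsConnectedGraded 𝒜) :
    ⨆ n, 𝒜 n = ⊤ := h.internal.submodule_iSup_eq_top

lemma iSup_oppositeGrading {𝒜 : ℕ → Submodule k A} (h : ⨆ n, 𝒜 n = ⊤) :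
    ⨆ n, oppositeGrading 𝒜 n = ⊤ := by
  simp only [oppositeGrading]
  rw [← Submodule.map_iSup, h, Submodule.map_top, LinearEquiv.range]

end Augmentation

/-! ### The presentation of the fixed subring -/

section Presentation

open MvPolynomial

variable {k : Type u} [Field k]

lemma exists_hypersurfaceQuot_algHom {A : Type u} [Ring A] [Algebra k A]
    (hcomm : ∀ x y : A, x * y = y * x) (v : Fin 4 → A) (hv : v 0 * v 1 = v 2 * v 3 ^ 2) :
    ∃ f : HypersurfaceQuot k →ₐ[k] A, ∀ i, f (Ideal.Quotient.mk _ (X i)) = v i := by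
  obtain ⟨i, hi⟩ : ∃ i : CommRing A, i.toRing = ‹Ring A› :=
    ⟨{ ‹Ring A› with mul_comm := hcomm }, rfl⟩
  subst hi
  refine ⟨Ideal.Quotient.liftₐ _ (aeval v) ?_, fun i => aeval_X v i⟩
  intro a ha
  obtain ⟨c, rfl⟩ := Ideal.mem_span_singleton'.1 ha
  rw [map_mul, map_sub, map_mul, map_mul, map_pow, aeval_X, aeval_X, aeval_X, aeval_X, hv, sub_self,
    mul_zero]

/-- The residue class of a variable in the coordinate ring of the hypersurface. -/
abbrev quotX (k : Type u) [Field k] (i : Fin 4) : HypersurfaceQuot k := Ideal.Quotient.mk _ (X i)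

lemma quotX_rel : quotX k 0 * quotX k 1 = quotX k 2 * quotX k 3 ^ 2 := by
  rw [quotX, quotX, quotX, quotX, ← map_mul, ← map_pow, ← map_mul, Ideal.Quotient.eq]
  exact Ideal.mem_span_singleton_self _

/-- The relation removes `x` or `y` from every monomial, so these normal forms span. Their
independence is seen only after mapping to `D`. -/
lemma hypersurfaceQuot_induction {W : Submodule k (HypersurfaceQuot k)}
    (h0 : ∀ a b c, quotX k 2 ^ a * quotX k 0 ^ b * quotX k 3 ^ c ∈ W)
    (h1 : ∀ a b c, quotX k 2 ^ a * quotX k 1 ^ (b + 1) * quotX k 3 ^ c ∈ W) (q : HypersurfaceQuot k) :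
    q ∈ W := by
  obtain ⟨p, rfl⟩ := Ideal.Quotient.mk_surjective q
  induction p using MvPolynomial.induction_on' with
  | add p q hp hq => rw [map_add]; exact add_mem hp hq
  | monomial m c =>
    have h : (Ideal.Quotient.mk _ (monomial m c) : HypersurfaceQuot k) =
        c • (quotX k 0 ^ m 0 * quotX k 1 ^ m 1 * quotX k 2 ^ m 2 * quotX k 3 ^ m 3) := by
      have hm : monomial m c = c • (X 0 ^ m 0 * X 1 ^ m 1 * X 2 ^ m 2 * X 3 ^ m 3) := by
        rw [monomial_eq, Finsupp.prod_fintype _ _ (fun i => pow_zero _), Fin.prod_univ_four,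
          smul_eq_C_mul]
      rw [hm]
      change Ideal.Quotient.mkₐ k _ _ = _
      rw [map_smul]
      simp only [map_mul, map_pow]
      rfl
    rw [h]
    refine W.smul_mem _ ?_
    rcases lt_or_ge (m 0) (m 1) with hm | hm
    -- Trade `m 0` factors `x y` for `z t²`; the positive exponent `b + 1` left on `y` keeps the two
    -- normal forms disjoint.
    · obtain ⟨b, hb⟩ : ∃ b, m 1 = m 0 + (b + 1) := ⟨m 1 - m 0 - 1, by omega⟩
      have := h1 (m 2 + m 0) b (m 3 + 2 * m 0)
      convert this using 1
      rw [hb, pow_add, pow_add, pow_add _ (m 3), pow_mul, ← mul_assoc, ← mul_pow, quotX_rel, mul_pow]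
      ring
    · obtain ⟨b, hb⟩ : ∃ b, m 0 = b + m 1 := ⟨m 0 - m 1, by omega⟩
      have := h0 (m 2 + m 1) b (m 3 + 2 * m 1)
      convert this using 1
      rw [hb, pow_add, pow_add, pow_add _ (m 3), pow_mul, mul_assoc (_ ^ b), ← mul_pow, quotX_rel,
        mul_pow]
      ring

/-- The linear map from `D(0, 1)` to the hypersurface which inverts the presentation. -/
def toHypersurfaceQuot (k : Type u) [Field k] : DD k →ₗ[k] HypersurfaceQuot k :=
  (monomBasis k).constr k fun x =>
    if x.2.2 % 2 = 0 then quotX k 2 ^ (x.1 / 4) * quotX k 0 ^ (x.2.1 / 2) * quotX k 3 ^ (x.2.2 / 2)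
    else quotX k 2 ^ (x.1 / 4) * quotX k 1 ^ (x.2.1 / 2 + 1) * quotX k 3 ^ (x.2.2 / 2)

lemma toHypersurfaceQuot_monom (x : ℕ × ℕ × ℕ) : toHypersurfaceQuot k (monom k x) =
    if x.2.2 % 2 = 0 then quotX k 2 ^ (x.1 / 4) * quotX k 0 ^ (x.2.1 / 2) * quotX k 3 ^ (x.2.2 / 2)
    else quotX k 2 ^ (x.1 / 4) * quotX k 1 ^ (x.2.1 / 2 + 1) * quotX k 3 ^ (x.2.2 / 2) := by
  rw [← monomBasis_apply, toHypersurfaceQuot, Module.Basis.constr_basis]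

lemma monom_even (a b c : ℕ) :
    (uu k ^ 4) ^ a * ((dd k * uu k) ^ 2) ^ b * (dd k ^ 2) ^ c = monom k (4 * a, 2 * b, 2 * c) := by
  simp only [monom, pow_mul]

lemma monom_odd (a b c : ℕ) :
    (uu k ^ 4) ^ a * ((uu k * dd k) ^ 2) ^ (b + 1) * (dd k ^ 2) ^ c =
      monom k (4 * a + 1, 2 * b + 1, 2 * c + 1) := by
  have h : ∀ b, monom k (1, 2 * b + 1, 1) = ((uu k * dd k) ^ 2) ^ (b + 1) := by
    intro b
    induction b with
    | zero => rw [zero_add, pow_one]; exact monom_one_one_one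
    | succ b ih => rw [pow_succ, ← ih]; exact (monom_mul_ud_sq k 1 (2 * b + 1) 0).symm
  rw [← h, monom, monom]
  simp only [pow_add, pow_mul, pow_one]
  rw [mul_assoc _ _ ((dd k ^ 2) ^ c), mul_assoc _ _ ((dd k ^ 2) ^ c),
    ((dd_sq_central k (dd k)).pow_left c).eq]
  simp only [mul_assoc]

/-- Injectivity comes from the linear left inverse `toHypersurfaceQuot`, checked on normal forms:
powers of `x` give monomials with even last exponent, positive powers of `y` those with odd.
Surjectivity is generation. -/
lemma exists_hypersurfaceQuot_algEquiv :
    ∃ e : HypersurfaceQuot k ≃ₐ[k] fixedDD k,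
      (e (quotX k 0) : DD k) = (dd k * uu k) ^ 2 ∧ (e (quotX k 1) : DD k) = (uu k * dd k) ^ 2 ∧
      (e (quotX k 2) : DD k) = uu k ^ 4 ∧ (e (quotX k 3) : DD k) = dd k ^ 2 := by
  let v : Fin 4 → fixedDD k := ![⟨_, du_sq_mem⟩, ⟨_, ud_sq_mem⟩, ⟨_, uu_pow_four_mem⟩, ⟨_, dd_sq_mem⟩]
  obtain ⟨f, hf⟩ := exists_hypersurfaceQuot_algHom (k := k)
    (fun x y : fixedDD k => Subtype.ext (commute_of_mem_fixedDD x.2 y.2)) v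
    (Subtype.ext (du_sq_mul_ud_sq k))
  let f' : HypersurfaceQuot k →ₐ[k] DD k := (fixedDD k).val.comp f
  have hf' : ∀ i, f' (quotX k i) = v i := fun i => congrArg Subtype.val (hf i)
  have h0 : f' (quotX k 0) = (dd k * uu k) ^ 2 := hf' 0
  have h1 : f' (quotX k 1) = (uu k * dd k) ^ 2 := hf' 1
  have h2 : f' (quotX k 2) = uu k ^ 4 := hf' 2
  have h3 : f' (quotX k 3) = dd k ^ 2 := hf' 3
  have hleft : ∀ q, toHypersurfaceQuot k (f' q) = q := by
    refine hypersurfaceQuot_induction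
      (W := LinearMap.eqLocus (toHypersurfaceQuot k ∘ₗ f'.toLinearMap) LinearMap.id) ?_ ?_
    · intro a b c
      change toHypersurfaceQuot k (f' _) = _
      simp only [map_mul, map_pow, h0, h2, h3, monom_even, toHypersurfaceQuot_monom]
      simp
    · intro a b c
      change toHypersurfaceQuot k (f' _) = _
      simp only [map_mul, map_pow, h1, h2, h3, monom_odd, toHypersurfaceQuot_monom]
      rw [if_neg (by omega), show (4 * a + 1) / 4 = a by omega, show (2 * b + 1) / 2 = b by omega,
        show (2 * c + 1) / 2 = c by omega]
      rfl
  refine ⟨AlgEquiv.ofBijective f ⟨fun p q hpq => ?_, fun b => ?_⟩, h0, h1, h2, h3⟩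
  · rw [← hleft p, ← hleft q]
    exact congrArg _ (congrArg Subtype.val hpq)
  · have hle : fixedDD k ≤ f'.range := by
      conv_lhs => rw [fixedDD_eq_adjoin]
      rw [Algebra.adjoin_le_iff]
      rintro a (rfl | rfl | rfl | rfl)
      exacts [⟨_, h0⟩, ⟨_, h1⟩, ⟨_, h3⟩, ⟨_, h2⟩]
    obtain ⟨q, hq⟩ := hle b.2
    exact ⟨q, Subtype.ext hq⟩

/-! ### The grading of the fixed subring -/

lemma monomProj_mem_monomSpan {ι : Type*} [DecidableEq ι] (f : ℕ × ℕ × ℕ → ι) (i : ι)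
    {s : Set (ℕ × ℕ × ℕ)} {a : DD k} (ha : a ∈ monomSpan k s) : monomProj f i a ∈ monomSpan k s := by
  have h : monomSpan k s ≤ (monomSpan k s).comap (monomProj f i) := by
    rw [monomSpan_le]
    intro x hx
    rw [Submodule.mem_comap, monomProj_monom]
    split_ifs
    · exact monom_mem_monomSpan hx
    · exact zero_mem _
  exact h ha

lemma monomProj_mem_fixedDD (n : ℕ) {a : DD k} (ha : a ∈ fixedDD k) :
    monomProj monomDeg n a ∈ fixedDD k := by
  rw [mem_fixedDD_iff, component_dihedralCoaction] at ha ⊢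
  exact monomProj_mem_monomSpan _ _ ha

/-- The projection of the fixed subring onto its component of degree `n`. -/
def fixedProj (k : Type u) [Field k] (n : ℕ) : fixedDD k →+ fixedDD k where
  toFun a := ⟨monomProj monomDeg n a, monomProj_mem_fixedDD n a.2⟩
  map_zero' := Subtype.ext (map_zero _)
  map_add' _ _ := Subtype.ext (map_add _ _ _)

lemma isInternal_gradingFixedDD :
    DirectSum.IsInternal (M := fixedDD k) (gradingFixedDD k) := by
  refine isInternal_of_projections (M := fixedDD k) (σ := Submodule k (fixedDD k))
    (gradingFixedDD k) (fixedProj k) ?_ ?_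
  · rintro i j ⟨a, ha⟩ hx
    have hx' : a ∈ monomSpan k {x | monomDeg x = j} := by rw [← gradingDD_eq]; exact hx
    refine Subtype.ext ((monomProj_of_mem monomDeg i j hx').trans ?_)
    split_ifs <;> rfl
  · rintro ⟨a, ha⟩
    refine ⟨((monomBasis k).repr a).support.image monomDeg, fun i _ => ?_, ?_⟩
    · change monomProj monomDeg i a ∈ gradingDD k i
      rw [gradingDD_eq]
      exact monomProj_mem _ _ _
    · refine Subtype.ext (Eq.trans ?_ (sum_monomProj monomDeg a))
      exact map_sum (fixedDD k).val _ _

lemma isConnectedGraded_gradingFixedDD : IsConnectedGraded (A := fixedDD k) (gradingFixedDD k) where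
  gradedMonoid :=
    { one_mem := gradedMonoid_gradingDD.one_mem
      mul_mem := fun _ _ _ _ ha hb => gradedMonoid_gradingDD.mul_mem ha hb }
  internal := isInternal_gradingFixedDD
  zero_eq := by
    apply le_antisymm
    · rintro ⟨a, ha⟩ h
      have h' : a ∈ gradingDD k 0 := h
      rw [isConnectedGraded_gradingDD.zero_eq] at h'
      obtain ⟨c, rfl⟩ := Submodule.mem_span_singleton.1 h'
      exact Submodule.mem_span_singleton.2 ⟨c, rfl⟩
    · rw [Submodule.span_singleton_le_iff_mem]
      exact gradedMonoid_gradingDD.one_mem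
  nontrivial := ⟨0, 1, fun h => zero_ne_one (congrArg Subtype.val h)⟩

lemma isCompleteIntersection_gradingFixedDD :
    IsCompleteIntersection (A := fixedDD k) (gradingFixedDD k) := by
  obtain ⟨e, h0, h1, h2, h3⟩ := exists_hypersurfaceQuot_algEquiv (k := k)
  have hne : (X 0 * X 1 - X 2 * X 3 ^ 2 : MvPolynomial (Fin 4) k) ≠ 0 := by
    intro h
    have := congrArg (eval ![1, 1, 0, 0]) h
    simp at this
  -- The weights are the degrees of `(du)²`, `(ud)²`, `u⁴` and `d²`; the relation is homogeneous of
  -- degree 8.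
  refine ⟨4, ![4, 4, 4, 2], [X 0 * X 1 - X 2 * X 3 ^ 2], ?_, ?_, ⟨?_, ?_⟩,
    (Ideal.quotientEquivAlgOfEq k (Ideal.ofList_singleton _)).trans e, ?_⟩
  · intro i
    fin_cases i <;> simp
  · intro f hf
    obtain rfl := List.mem_singleton.1 hf
    have hX := isWeightedHomogeneous_X k (![4, 4, 4, 2] : Fin 4 → ℕ)
    exact ⟨8, ((hX 0).mul (hX 1)).sub ((hX 2).mul ((hX 3).pow 2))⟩
  · rw [RingTheory.Sequence.isWeaklyRegular_singleton_iff]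
    exact (IsRegular.of_ne_zero hne).left.isSMulRegular
  · rw [Ideal.ofList_singleton, smul_eq_mul, Ideal.mul_top]
    intro h
    have h1 : (1 : MvPolynomial (Fin 4) k) ∈ Ideal.span {X 0 * X 1 - X 2 * X 3 ^ 2} := by
      rw [← h]; trivial
    obtain ⟨c, hc⟩ := Ideal.mem_span_singleton'.1 h1
    have := congrArg (eval fun _ => 0) hc
    simp at this
  · have h : ∀ (i : Fin 4) (x : ℕ × ℕ × ℕ) (n : ℕ), (e (quotX k i) : DD k) = monom k x →
        monomDeg x = n → e (quotX k i) ∈ gradingFixedDD k n := by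
      rintro i x n hx rfl
      change (e (quotX k i) : DD k) ∈ gradingDD k _
      rw [hx]
      exact monom_mem_gradingDD x
    intro i
    fin_cases i
    · exact h 0 (0, 2, 0) 4 (by rw [h0]; simp [monom]) rfl
    · exact h 1 (1, 1, 1) 4 (by rw [h1, monom_one_one_one]) rfl
    · exact h 2 (4, 0, 0) 4 (by rw [h2]; simp [monom]) rfl
    · exact h 3 (0, 0, 2) 2 (by rw [h3]; simp [monom]) rfl

lemma exists_hypersurface_algEquiv : ∃ e : Hypersurface k ≃ₐ[k] fixedDD k,
    ∀ x : fixedDD k, hypersurfaceEval k (e.symm x) = evalDD k x := by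
  obtain ⟨e, h0, h1, h2, h3⟩ := exists_hypersurfaceQuot_algEquiv (k := k)
  refine ⟨(hypersurfaceEquiv k).symm.trans e, fun x => ?_⟩
  obtain ⟨x, rfl⟩ := e.surjective x
  obtain ⟨p, rfl⟩ := Ideal.Quotient.mk_surjective x
  change hypersurfaceEval k (hypersurfaceEquiv k (e.symm (e _))) = _
  rw [e.symm_apply_apply, hypersurfaceEval_hypersurfaceEquiv]
  have h : (evalDD k).comp ((fixedDD k).val.comp (e.toAlgHom.comp (Ideal.Quotient.mkₐ k _))) =
      aeval fun _ => 0 := by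
    ext i
    rw [aeval_X]
    change evalDD k (e (quotX k i)) = 0
    fin_cases i
    · exact (congrArg _ h0).trans (by simp)
    · exact (congrArg _ h1).trans (by simp)
    · exact (congrArg _ h2).trans (by simp)
    · exact (congrArg _ h3).trans (by simp)
  have h4 := DFunLike.congr_fun h p
  rw [aeval_zero'] at h4
  exact h4.symm

lemma evalDD_algebraMap (c : k) : evalDD k (algebraMap k (DD k) c) = c := (evalDD k).commutes c

lemma homological_fixedDD :
    IsASGorenstein (A := fixedDD k) (gradingFixedDD k) 3 ∧
      ¬ HasFiniteGlobalDimension (fixedDD k) := by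
  obtain ⟨e, he⟩ := exists_hypersurface_algEquiv (k := k)
  have hconn := isConnectedGraded_gradingFixedDD (k := k)
  have hcomm : ∀ x y : fixedDD k, x * y = y * x := fun x y =>
    Subtype.ext (commute_of_mem_fixedDD x.2 y.2)
  have hε : ∀ n, 0 < n → ∀ a ∈ gradingFixedDD k n, evalDD k (a : DD k) = 0 :=
    fun n hn a ha => evalDD_of_mem hn ha
  have h1 := homological_of_hypersurface (A := fixedDD k) e (gradingFixedDD k) (fun x => by
    rw [mem_augmentationIdeal_iff hconn.iSup_eq_top hconn.zero_eq.le
      ((evalDD k).comp (fixedDD k).val).toRingHom (fun c => evalDD_algebraMap c) hε, he]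
    rfl)
  -- By commutativity the opposite algebra is the same hypersurface, so the right-hand conditions
  -- follow from the left-hand argument.
  let e' : fixedDD k ≃ₐ[k] (fixedDD k)ᵐᵒᵖ :=
    AlgEquiv.ofLinearEquiv (MulOpposite.opLinearEquiv k) rfl fun x y =>
      congrArg MulOpposite.op (hcomm x y)
  have h2 := homological_of_hypersurface (A := (fixedDD k)ᵐᵒᵖ) (e.trans e')
    (oppositeGrading (gradingFixedDD k)) (fun x => by
    rw [mem_augmentationIdeal_iff (iSup_oppositeGrading hconn.iSup_eq_top) ?_
      (((evalDD k).comp (fixedDD k).val).comp e'.symm.toAlgHom).toRingHom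
      (fun c => evalDD_algebraMap c) ?_]
    · exact Eq.congr_left (he (e'.symm x)).symm
    · rintro _ ⟨a, ha, rfl⟩
      obtain ⟨c, rfl⟩ := Submodule.mem_span_singleton.1 (hconn.zero_eq.le ha)
      exact Submodule.mem_span_singleton.2 ⟨c, rfl⟩
    · rintro n hn _ ⟨a, ha, rfl⟩
      exact hε n hn a ha)
  exact ⟨⟨hconn, h1.1, h2.1, h1.2.1, h2.2.1⟩, h1.2.2⟩

end Presentation

/-! ### Syzygies over `D(0, 1)` -/

section Syzygies

variable (k : Type u) [Field k]

/-- The anti-automorphism of `D(0, 1)` exchanging `u` and `d`, as a map to the opposite algebra. -/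
def flipDDAux : DD k →ₐ[k] (DD k)ᵐᵒᵖ :=
  RingQuot.liftAlgHom k
    ⟨FreeAlgebra.lift k ![MulOpposite.op (dd k), MulOpposite.op (uu k)], by
      rintro x y (_ | _)
      · simp [← MulOpposite.op_mul, ← mul_assoc, dd_rel]
      · simp [← MulOpposite.op_mul, ← mul_assoc, uu_rel]⟩

/-- The anti-automorphism of `D(0, 1)` exchanging `u` and `d`. -/
def flipDD : DD k →+ DD k :=
  MulOpposite.opAddEquiv.symm.toAddMonoidHom.comp (flipDDAux k : DD k →+ (DD k)ᵐᵒᵖ)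

lemma flipDD_mul (a b : DD k) : flipDD k (a * b) = flipDD k b * flipDD k a := by
  change MulOpposite.unop (flipDDAux k (a * b)) = _
  rw [map_mul, MulOpposite.unop_mul]
  rfl

lemma flipDD_uu : flipDD k (uu k) = dd k := by
  change MulOpposite.unop (flipDDAux k (uu k)) = _
  simp [flipDDAux, DownUpAlgebra.up]

lemma flipDD_dd : flipDD k (dd k) = uu k := by
  change MulOpposite.unop (flipDDAux k (dd k)) = _
  simp [flipDDAux, DownUpAlgebra.down]

lemma flipDD_algebraMap (c : k) : flipDD k (algebraMap k _ c) = algebraMap k _ c := by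
  change MulOpposite.unop (flipDDAux k (algebraMap k _ c)) = _
  rw [AlgHom.commutes]
  rfl

lemma flipDD_flipDD (a : DD k) : flipDD k (flipDD k a) = a := by
  induction a using DD_induction with
  | hc r => rw [flipDD_algebraMap, flipDD_algebraMap]
  | hu => rw [flipDD_uu, flipDD_dd]
  | hd => rw [flipDD_dd, flipDD_uu]
  | hadd a b ha hb => rw [map_add, map_add, ha, hb]
  | hmul a b ha hb => rw [flipDD_mul, flipDD_mul, ha, hb]

variable {k}

lemma uu_mul_injective {a b : DD k} (h : uu k * a = uu k * b) : a = b :=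
  injective_of_map_monom (T := LinearMap.mulLeft k (uu k)) shiftUp_injective (uu_mul_monom k) h

/-- The right ideal generated by `u` is spanned by monomials. -/
lemma uu_mul_mem (a : DD k) : uu k * a ∈ monomSpan k {x | 0 < x.1} := by
  have h : monomSpan k Set.univ ≤ (monomSpan k {x | 0 < x.1}).comap (LinearMap.mulLeft k (uu k)) := by
    rw [monomSpan_le]
    intro x _
    rw [Submodule.mem_comap, LinearMap.mulLeft_apply, uu_mul_monom]
    exact monom_mem_monomSpan (Nat.succ_pos _)
  exact h (mem_monomSpan_univ a)

/-- `uD` is spanned by the monomials with positive first exponent, and `du` sends a monomial with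
first exponent `0` to another such. -/
lemma exists_of_du_mul_eq {c b : DD k} (h : dd k * uu k * c = uu k * b) : ∃ a, c = uu k * a := by
  have h1 : c ∈ LinearMap.range (LinearMap.mulLeft k (uu k)) := by
    refine mem_of_map_monom_mem (T := LinearMap.mulLeft k (dd k * uu k))
      (shiftDown_injective.comp shiftUp_injective) (s := {x | 0 < x.1}) ?_ ?_ ?_
    · intro x
      rw [LinearMap.mulLeft_apply, mul_assoc, uu_mul_monom, dd_mul_monom]
      rfl
    · rw [LinearMap.mulLeft_apply, h]
      exact uu_mul_mem b
    · rintro ⟨i, j, l⟩ hx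
      have hi : 0 < i := by
        by_contra h0
        obtain rfl : i = 0 := by omega
        simp [shiftUp, shiftDown] at hx
      obtain ⟨i, rfl⟩ : ∃ n, i = n + 1 := ⟨i - 1, by omega⟩
      exact ⟨monom k (i, j, l), uu_mul_monom k _⟩
  obtain ⟨a, ha⟩ := h1
  exact ⟨a, ha.symm⟩

/-- The monomials sent into `uD` by `d` have first exponent at least `2`, hence lie in `u²D`, or
have first exponent `0` and a factor `du`, hence lie in `duD`. -/
lemma exists_of_dd_mul_eq {e b : DD k} (h : dd k * e = uu k * b) :
    ∃ c₁ c₂, e = dd k * uu k * c₁ + uu k ^ 2 * c₂ := by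
  have h1 : e ∈ LinearMap.range (LinearMap.mulLeft k (dd k * uu k)) ⊔
      LinearMap.range (LinearMap.mulLeft k (uu k ^ 2)) := by
    refine mem_of_map_monom_mem (T := LinearMap.mulLeft k (dd k)) shiftDown_injective
      (s := {x | 0 < x.1}) (dd_mul_monom k) ?_ ?_
    · rw [LinearMap.mulLeft_apply, h]
      exact uu_mul_mem b
    · rintro ⟨i, j, l⟩ hx
      rcases lt_or_ge i 2 with hi | hi
      · have hij : i = 0 ∧ 0 < j := by
          by_contra h0
          simp only [shiftDown, Set.mem_ofPred_eq] at hx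
          grind
        obtain ⟨rfl, hj⟩ := hij
        obtain ⟨j, rfl⟩ : ∃ n, j = n + 1 := ⟨j - 1, by omega⟩
        refine Submodule.mem_sup_left ⟨monom k (0, j, l), ?_⟩
        rw [LinearMap.mulLeft_apply, mul_assoc, uu_mul_monom, dd_mul_monom]
        simp [shiftUp, shiftDown]
      · obtain ⟨i, rfl⟩ : ∃ n, i = n + 2 := ⟨i - 2, by omega⟩
        exact Submodule.mem_sup_right ⟨monom k (i, j, l), uu_pow_mul_monom 2 _⟩
  obtain ⟨_, ⟨c₁, rfl⟩, _, ⟨c₂, rfl⟩, h2⟩ := Submodule.mem_sup.1 h1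
  exact ⟨c₁, c₂, h2.symm⟩

lemma evalDD_eq_repr (a : DD k) : evalDD k a = (monomBasis k).repr a 0 := by
  have h : (evalDD k).toLinearMap = Finsupp.lapply 0 ∘ₗ (monomBasis k).repr.toLinearMap := by
    refine linearMap_ext_monom fun ⟨i, j, l⟩ => ?_
    change evalDD k (monom k (i, j, l)) = (monomBasis k).repr (monom k (i, j, l)) 0
    rw [repr_monom, monom]
    simp only [map_mul, map_pow, evalDD_uu, evalDD_dd, mul_zero]
    rcases Nat.eq_zero_or_pos i with rfl | hi
    · rcases Nat.eq_zero_or_pos j with rfl | hj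
      · rcases Nat.eq_zero_or_pos l with rfl | hl
        · simp
        · rw [zero_pow hl.ne', mul_zero, if_neg (by simp [hl.ne'])]
      · rw [zero_pow hj.ne', mul_zero, zero_mul, if_neg (by simp [hj.ne'])]
    · rw [zero_pow hi.ne', zero_mul, zero_mul, if_neg (by simp [hi.ne'])]
  exact DFunLike.congr_fun h a

lemma exists_of_evalDD_eq_zero {a : DD k} (ha : evalDD k a = 0) :
    ∃ e₁ e₂, a = dd k * e₁ + uu k * e₂ := by
  have h1 : a ∈ LinearMap.range (LinearMap.mulLeft k (dd k)) ⊔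
      LinearMap.range (LinearMap.mulLeft k (uu k)) := by
    refine mem_of_monom_mem fun ⟨i, j, l⟩ hx => ?_
    rcases Nat.eq_zero_or_pos i with rfl | hi
    · refine Submodule.mem_sup_left ?_
      rcases Nat.eq_zero_or_pos j with rfl | hj
      · rcases Nat.eq_zero_or_pos l with rfl | hl
        · exact absurd ((evalDD_eq_repr a).symm.trans ha) hx
        · obtain ⟨l, rfl⟩ : ∃ n, l = n + 1 := ⟨l - 1, by omega⟩
          refine ⟨monom k (0, 0, l), ?_⟩
          rw [LinearMap.mulLeft_apply, dd_mul_monom]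
          simp [shiftDown]
      · obtain ⟨j, rfl⟩ : ∃ n, j = n + 1 := ⟨j - 1, by omega⟩
        refine ⟨monom k (1, j, l), ?_⟩
        rw [LinearMap.mulLeft_apply, dd_mul_monom]
        simp [shiftDown]
    · obtain ⟨i, rfl⟩ : ∃ n, i = n + 1 := ⟨i - 1, by omega⟩
      exact Submodule.mem_sup_right ⟨monom k (i, j, l), uu_mul_monom k _⟩
  obtain ⟨_, ⟨e₁, rfl⟩, _, ⟨e₂, rfl⟩, h2⟩ := Submodule.mem_sup.1 h1
  exact ⟨e₁, e₂, h2.symm⟩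

lemma DD_mul_neg (a b : DD k) : a * -b = -(a * b) := mul_neg a b

lemma DD_neg_mul (a b : DD k) : -a * b = -(a * b) := neg_mul a b

lemma dd_sq_mul_uu (a : DD k) : dd k * (dd k * (uu k * a)) = uu k * (dd k * (dd k * a)) := by
  rw [← mul_assoc, ← mul_assoc, ← dd_rel]
  simp only [mul_assoc]

lemma dd_mul_uu_sq (a : DD k) : dd k * (uu k * (uu k * a)) = uu k * (uu k * (dd k * a)) := by
  rw [← mul_assoc, ← mul_assoc, ← uu_rel]
  simp only [mul_assoc]

/-! Exactness of `D → D² → D² → D`, `c ↦ (u c, d c)`,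
`(c₁, c₂) ↦ (u² c₂ - d u c₁, u d c₂ - d² c₁)`, `(e₁, e₂) ↦ d e₁ - u e₂`. -/

lemma exact_left_one {c₁ c₂ : DD k} (h : uu k * (uu k * c₂) = dd k * (uu k * c₁)) :
    ∃ c, c₁ = uu k * c ∧ c₂ = dd k * c := by
  obtain ⟨c, rfl⟩ := exists_of_du_mul_eq (c := c₁) (b := uu k * c₂) (by rw [h, mul_assoc])
  refine ⟨c, rfl, ?_⟩
  rw [dd_mul_uu_sq] at h
  exact uu_mul_injective (uu_mul_injective h)

lemma exact_left_two {e₁ e₂ : DD k} (h : dd k * e₁ = uu k * e₂) :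
    ∃ c₁ c₂, e₁ = uu k * (uu k * c₂) - dd k * (uu k * c₁) ∧
      e₂ = uu k * (dd k * c₂) - dd k * (dd k * c₁) := by
  obtain ⟨c₁, c₂, rfl⟩ := exists_of_dd_mul_eq h
  refine ⟨-c₁, c₂, ?_, ?_⟩
  · simp only [pow_two, DD_mul_neg, mul_assoc]
    abel
  -- The second coordinate is forced by the first, since `u` is left cancellable.
  · apply uu_mul_injective
    rw [← h]
    simp only [pow_two, mul_add, mul_assoc, mul_sub, DD_mul_neg, dd_sq_mul_uu, dd_mul_uu_sq]
    abel

/-! Exactness of `D → D² → D² → D`, `s ↦ (s d, - s u)`,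
`(p, q) ↦ (- p d u - q d², p u² + q u d)`, `(a, b) ↦ a u + b d`. -/

lemma mul_dd_injective {a b : DD k} (h : a * dd k = b * dd k) : a = b := by
  have h1 := congrArg (flipDD k) h
  rw [flipDD_mul, flipDD_mul, flipDD_dd] at h1
  rw [← flipDD_flipDD k a, uu_mul_injective h1, flipDD_flipDD]

/-- The mirror image of `exact_left_one` under the anti-automorphism exchanging `u` and `d`, up to a
sign; the next lemma likewise mirrors `exact_left_two`. -/
lemma exact_right_two {p q : DD k} (h : p * (dd k * uu k) + q * (dd k * dd k) = 0) :
    ∃ s, p = s * dd k ∧ q = -(s * uu k) := by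
  have h1 := congrArg (flipDD k) h
  simp only [map_add, flipDD_mul, flipDD_uu, flipDD_dd, map_zero] at h1
  obtain ⟨c, h2, h3⟩ := exact_left_one (c₁ := flipDD k p) (c₂ := -flipDD k q) (by
    rw [DD_mul_neg, DD_mul_neg, ← mul_assoc, ← mul_assoc]
    exact (eq_neg_of_add_eq_zero_left h1).symm)
  refine ⟨flipDD k c, ?_, ?_⟩
  · rw [← flipDD_flipDD k p, h2, flipDD_mul, flipDD_uu]
  · rw [← flipDD_flipDD k q, ← neg_neg (flipDD k q), h3, map_neg, flipDD_mul, flipDD_dd]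

lemma exact_right_one {a b : DD k} (h : a * uu k + b * dd k = 0) :
    ∃ p q, a = -(p * (dd k * uu k)) - q * (dd k * dd k) ∧
      b = p * (uu k * uu k) + q * (uu k * dd k) := by
  have h1 := congrArg (flipDD k) h
  simp only [map_add, flipDD_mul, flipDD_uu, flipDD_dd, map_zero] at h1
  obtain ⟨c₁, c₂, h2, h3⟩ := exact_left_two (e₁ := flipDD k a) (e₂ := -flipDD k b) (by
    rw [DD_mul_neg]
    exact eq_neg_of_add_eq_zero_left h1)
  refine ⟨flipDD k c₁, -flipDD k c₂, ?_, ?_⟩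
  · rw [← flipDD_flipDD k a, h2, map_sub]
    simp only [flipDD_mul, flipDD_uu, flipDD_dd, mul_assoc, DD_neg_mul]
    abel
  · rw [← flipDD_flipDD k b, ← neg_neg (flipDD k b), h3, map_neg, map_sub]
    simp only [flipDD_mul, flipDD_uu, flipDD_dd, mul_assoc, DD_neg_mul]
    abel

lemma exists_right_of_evalDD_eq_zero {a : DD k} (ha : evalDD k a = 0) :
    ∃ x y, a = x * uu k + y * dd k := by
  have hflip : ∀ a, evalDD k (flipDD k a) = evalDD k a := by
    intro a
    induction a using DD_induction with
    | hc r => rw [flipDD_algebraMap]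
    | hu => rw [flipDD_uu, evalDD_uu, evalDD_dd]
    | hd => rw [flipDD_dd, evalDD_uu, evalDD_dd]
    | hadd a b ha hb => rw [map_add, map_add, map_add, ha, hb]
    | hmul a b ha hb => rw [flipDD_mul, map_mul, map_mul, ha, hb, mul_comm]
  obtain ⟨e₁, e₂, h⟩ := exists_of_evalDD_eq_zero ((hflip a).trans ha)
  refine ⟨flipDD k e₁, flipDD k e₂, ?_⟩
  rw [← flipDD_flipDD k a, h, map_add, flipDD_mul, flipDD_mul, flipDD_uu, flipDD_dd]

lemma mem_augmentationIdeal_gradingDD {a : DD k} :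
    a ∈ augmentationIdeal (gradingDD k) ↔ evalDD k a = 0 :=
  mem_augmentationIdeal_iff isConnectedGraded_gradingDD.iSup_eq_top
    isConnectedGraded_gradingDD.zero_eq.le (evalDD k).toRingHom evalDD_algebraMap
    (fun _ hn _ h => evalDD_of_mem hn h) a

lemma evalDD_of_mem_component {g : DihedralGroup 4} (hg : g ≠ 1) {a : DD k}
    (ha : a ∈ component (dihedralCoaction k) g) : evalDD k a = 0 := by
  rw [component_dihedralCoaction, mem_monomSpan_iff] at ha
  by_contra h
  rw [evalDD_eq_repr] at h
  exact hg (ha 0 h).symm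

end Syzygies

/-! ### Projective resolutions from exact sequences -/

section LinearResolution

variable {A : Type u} [Ring A] {N : ModuleCat.{u} A} {M : ℕ → Type u} [∀ n, AddCommGroup (M n)]
  [∀ n, Module A (M n)]

/-- The chain complex of modules with given differentials. -/
def complexOfLinear (d : ∀ n, M (n + 1) →ₗ[A] M n) (hd : ∀ n, Function.Exact (d (n + 1)) (d n)) :
    ChainComplex (ModuleCat.{u} A) ℕ :=
  ChainComplex.of (fun n => ModuleCat.of A (M n)) (fun n => ModuleCat.ofHom (d n)) fun n => by
    ext x
    exact (hd n).apply_apply_eq_zero x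

lemma complexOfLinear_d (d : ∀ n, M (n + 1) →ₗ[A] M n)
    (hd : ∀ n, Function.Exact (d (n + 1)) (d n)) (n : ℕ) :
    (complexOfLinear d hd).d (n + 1) n = ModuleCat.ofHom (d n) :=
  ChainComplex.of_d (V := ModuleCat.{u} A) (fun n => ModuleCat.of A (M n))
    (fun n => ModuleCat.ofHom (d n)) n

lemma complexOfLinear_d_comp (d : ∀ n, M (n + 1) →ₗ[A] M n)
    (hd : ∀ n, Function.Exact (d (n + 1)) (d n)) (π : M 0 →ₗ[A] N) (h0 : Function.Exact (d 0) π) :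
    (complexOfLinear d hd).d 1 0 ≫ ModuleCat.ofHom π = 0 := by
  rw [complexOfLinear_d]
  ext x
  exact h0.apply_apply_eq_zero x

/-- The projective resolution attached to an exact sequence of projective modules. -/
def resolutionOfLinear [∀ n, Module.Projective A (M n)] (d : ∀ n, M (n + 1) →ₗ[A] M n)
    (hd : ∀ n, Function.Exact (d (n + 1)) (d n)) (π : M 0 →ₗ[A] N) (h0 : Function.Exact (d 0) π)
    (hπ : Function.Surjective π) : ProjectiveResolution N where
  complex := complexOfLinear d hd
  projective n := ModuleCat.projective_of_categoryTheory_projective (ModuleCat.of A (M n))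
  π := (ChainComplex.toSingle₀Equiv _ _).symm
    ⟨ModuleCat.ofHom π, complexOfLinear_d_comp d hd π h0⟩
  quasiIso := ⟨fun n => by
    cases n with
    | zero =>
      rw [ChainComplex.quasiIsoAt₀_iff, ShortComplex.quasiIso_iff_of_zeros']
      · have hepi : Epi (ModuleCat.ofHom π) := (ModuleCat.epi_iff_surjective _).2 hπ
        have hex : (ShortComplex.mk (ModuleCat.ofHom (d 0)) (ModuleCat.ofHom π) (by
            ext x
            exact h0.apply_apply_eq_zero x)).Exact :=
          (ShortComplex.ShortExact.moduleCat_exact_iff_function_exact _).2 h0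
        refine (ShortComplex.exact_and_epi_g_iff_of_iso ?_).2 ⟨hex, hepi⟩
        exact ShortComplex.isoMk (Iso.refl _) (Iso.refl _) (Iso.refl _)
          ((Category.id_comp _).trans ((complexOfLinear_d d hd 0).symm.trans
            (Category.comp_id _).symm))
          ((Category.id_comp _).trans ((ChainComplex.toSingle₀Equiv_symm_apply_f_zero
            (C := complexOfLinear d hd) (ModuleCat.ofHom π)
            (complexOfLinear_d_comp d hd π h0)).symm.trans (Category.comp_id _).symm))
      all_goals rfl
    | succ n =>
      rw [quasiIsoAt_iff_exactAt']
      · rw [HomologicalComplex.exactAt_iff' _ (n + 1 + 1) (n + 1) n (by simp) (by simp)]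
        refine (ShortComplex.ShortExact.moduleCat_exact_iff_function_exact _).2 ?_
        change Function.Exact ((complexOfLinear d hd).d _ _) ((complexOfLinear d hd).d _ _)
        rw [complexOfLinear_d, complexOfLinear_d]
        exact hd n
      · exact ChainComplex.exactAt_succ_single_obj _ _⟩

end LinearResolution

/-! ### Comparison of graded resolutions -/

section GradedComparison

lemma exists_projections_of_isInternal {ι M : Type*} [DecidableEq ι] [AddCommGroup M]
    (W : ι → AddSubgroup M) (h : DirectSum.IsInternal W) :
    ∃ q : ι → M →+ M, (∀ i x, q i x ∈ W i) ∧ (∀ i x, x ∈ W i → q i x = x) ∧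
      ∀ i j x, x ∈ W j → j ≠ i → q i x = 0 := by
  let e := AddEquiv.ofBijective (DirectSum.coeAddMonoidHom W) h
  have he : ∀ j (x : W j), e.symm x = DirectSum.of (fun i => W i) j x := by
    intro j x
    rw [e.symm_apply_eq]
    exact (DirectSum.coeAddMonoidHom_of W j x).symm
  refine ⟨fun i => (W i).subtype.comp ((DFinsupp.evalAddMonoidHom i).comp e.symm.toAddMonoidHom),
    fun i x => Subtype.prop _, fun i x hx => ?_, fun i j x hx hij => ?_⟩
  · have h1 := he i ⟨x, hx⟩
    change ((e.symm x : DirectSum ι fun i => W i) i : M) = x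
    rw [h1, DirectSum.of_eq_same]
  · have h1 := he j ⟨x, hx⟩
    change ((e.symm x : DirectSum ι fun i => W i) i : M) = 0
    rw [h1, DirectSum.of_eq_of_ne _ _ _ hij.symm]
    rfl

lemma isInternal_induction {ι M : Type*} [DecidableEq ι] [AddCommGroup M]
    {W : ι → AddSubgroup M} (h : DirectSum.IsInternal W) {p : M → Prop} (h0 : p 0)
    (hadd : ∀ x y, p x → p y → p (x + y)) (hW : ∀ i, ∀ x ∈ W i, p x) (x : M) : p x := by
  obtain ⟨v, rfl⟩ := h.2 x
  induction v using DirectSum.induction_on with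
  | zero => rwa [map_zero]
  | of i x =>
    rw [DirectSum.coeAddMonoidHom_of]
    exact hW i _ x.2
  | add v w hv hw => rw [map_add]; exact hadd _ _ hv hw

variable {k : Type u} [Field k] {A : Type u} [Ring A] [Algebra k A] {G : Type} [Group G]
  {𝒜 : ℕ → Submodule k A} {𝒢 : G → Submodule k A}

namespace GradedResolution

/-- The augmentation of a graded resolution. -/
def aug (P : GradedResolution 𝒜 𝒢) : P.res.complex.X 0 →ₗ[A] A ⧸ augmentationIdeal 𝒜 :=
  (P.res.π.f 0 ≫ (HomologicalComplex.singleObjXSelf (ComplexShape.down ℕ) 0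
    (trivialModule 𝒜)).hom).hom

/-- The differential of a graded resolution. -/
def diff (P : GradedResolution 𝒜 𝒢) (n : ℕ) : P.res.complex.X (n + 1) →ₗ[A] P.res.complex.X n :=
  (P.res.complex.d (n + 1) n).hom

lemma aug_surjective (P : GradedResolution 𝒜 𝒢) : Function.Surjective P.aug := by
  have h : Epi (P.res.π.f 0 ≫ (HomologicalComplex.singleObjXSelf (ComplexShape.down ℕ) 0
    (trivialModule 𝒜)).hom) := inferInstance
  exact (ModuleCat.epi_iff_surjective _).1 h

lemma diff_exact (P : GradedResolution 𝒜 𝒢) (n : ℕ) :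
    Function.Exact (P.diff (n + 1)) (P.diff n) :=
  (ShortComplex.ShortExact.moduleCat_exact_iff_function_exact _).1 (P.res.exact_succ n)

lemma diff_aug_exact (P : GradedResolution 𝒜 𝒢) : Function.Exact (P.diff 0) P.aug := by
  have h1 := (ShortComplex.ShortExact.moduleCat_exact_iff_function_exact _).1 P.res.exact₀
  intro x
  refine Iff.trans ?_ (h1 x)
  change (HomologicalComplex.singleObjXSelf (ComplexShape.down ℕ) 0
    (trivialModule 𝒜)).hom.hom ((P.res.π.f 0).hom x) = 0 ↔ _
  exact map_eq_zero_iff _ ((ModuleCat.mono_iff_injective _).1 inferInstance)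

end GradedResolution

/-- Homogeneous lifting of a map out of a graded free module. -/
lemma exists_homogeneous_lift {ι F Y Z : Type*} [Fintype ι] [AddCommGroup F] [Module A F]
    [AddCommGroup Y] [Module A Y] [AddCommGroup Z] [Module A Z] (b : Module.Basis ι A F) (γ : ι → G)
    {WF : G → AddSubgroup F} {WY : G → AddSubgroup Y}
    (hcoord : ∀ h x, x ∈ WF h → ∀ i, b.repr x i ∈ 𝒢 (h * (γ i)⁻¹))
    (hsmul : ∀ (g h : G) (a : A) (y : Y), a ∈ 𝒢 g → y ∈ WY h → a • y ∈ WY (g * h))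
    (p : Y →ₗ[A] Z) (φ : F →ₗ[A] Z) (hlift : ∀ i, ∃ y ∈ WY (γ i), p y = φ (b i)) :
    ∃ f : F →ₗ[A] Y, (∀ h x, x ∈ WF h → f x ∈ WY h) ∧ ∀ x, p (f x) = φ x := by
  choose y hy hpy using hlift
  refine ⟨b.constr ℕ y, fun h x hx => ?_, fun x => ?_⟩
  · rw [Module.Basis.constr_apply_fintype]
    refine AddSubgroup.sum_mem _ fun i _ => ?_
    have := hsmul _ _ _ _ (hcoord h x hx i) (hy i)
    rwa [inv_mul_cancel_right] at this
  · have : p ∘ₗ b.constr ℕ y = φ := b.ext fun i => by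
      rw [LinearMap.comp_apply, Module.Basis.constr_basis, hpy]
    exact LinearMap.congr_fun this x

/-- The identity lifts to a homogeneous map from a graded free resolution to any graded
resolution. -/
lemma exists_graded_comparison (h𝒢 : ∀ g ≠ 1, ∀ a ∈ 𝒢 g, a ∈ augmentationIdeal 𝒜)
    (R P : GradedResolution 𝒜 𝒢) {ι : ℕ → Type} [∀ n, Fintype (ι n)]
    (b : ∀ n, Module.Basis (ι n) A (R.res.complex.X n)) (γ : ∀ n, ι n → G)
    (hb : ∀ n i, b n i ∈ R.piece n (γ n i))
    (hcoord : ∀ n h x, x ∈ R.piece n h → ∀ i, (b n).repr x i ∈ 𝒢 (h * (γ n i)⁻¹)) :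
    ∃ φ : ProjectiveResolution.Hom R.res P.res (𝟙 _),
      ∀ n h x, x ∈ R.piece n h → (φ.hom.f n).hom x ∈ P.piece n h := by
  classical
  have hint : ∀ n, DirectSum.IsInternal (P.piece n) := fun n => by
    convert P.internal n
  -- Any lift can be made homogeneous by projecting it onto the required piece, since these
  -- projections commute with the differentials and, in degree `1`, with the augmentation.
  choose q hq hq1 hq0 using fun n => exists_projections_of_isInternal (P.piece n) (hint n)
  have haug : ∀ (Q : GradedResolution 𝒜 𝒢) h x, x ∈ Q.piece 0 h → h ≠ 1 → Q.aug x = 0 := by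
    intro Q h x hx hh
    obtain ⟨a, ha, hxa⟩ := Q.augmentation_mem h x hx
    exact hxa.trans ((Submodule.Quotient.mk_eq_zero _).2 (h𝒢 h hh a ha))
  have hqaug : ∀ x, P.aug (q 0 1 x) = P.aug x := by
    refine isInternal_induction (hint 0) (by simp) ?_ ?_
    · intro x y hx hy
      rw [map_add, map_add, map_add, hx, hy]
    · intro h x hx
      by_cases hh : h = 1
      · subst hh
        rw [hq1 0 1 x hx]
      · rw [hq0 0 1 h x hx hh, map_zero, haug P h x hx hh]
  have hqd : ∀ n g x, P.diff n (q (n + 1) g x) = q n g (P.diff n x) := by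
    intro n g
    refine isInternal_induction (hint (n + 1)) (by simp) ?_ ?_
    · intro x y hx hy
      simp only [map_add, hx, hy]
    · intro h x hx
      by_cases hh : h = g
      · subst hh
        rw [hq1 _ _ x hx]
        exact (hq1 _ _ _ (P.d_mem n h x hx)).symm
      · rw [hq0 _ _ _ x hx hh, map_zero]
        exact (hq0 _ _ _ _ (P.d_mem n h x hx) hh).symm
  obtain ⟨f0, hf0, hf0'⟩ := exists_homogeneous_lift (b 0) (γ 0) (hcoord 0) (P.smul_mem 0) P.aug R.aug
    (by
      intro i
      by_cases hi : γ 0 i = 1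
      · obtain ⟨y, hy⟩ := P.aug_surjective (R.aug (b 0 i))
        exact ⟨q 0 1 y, by rw [hi]; exact hq 0 1 y, (hqaug y).trans hy⟩
      · exact ⟨0, zero_mem _, by rw [map_zero, haug R _ _ (hb 0 i) hi]⟩)
  -- The recursion carries homogeneity together with the lifting property that makes the next step
  -- possible.
  let T : ℕ → Type u := fun n =>
    { f : R.res.complex.X n →ₗ[A] P.res.complex.X n //
      (∀ h x, x ∈ R.piece n h → f x ∈ P.piece n h) ∧
      ∀ x : R.res.complex.X (n + 1), ∃ y, P.diff n y = f (R.diff n x) }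
  have hstep : ∀ n (f : T n), ∃ f' : T (n + 1), ∀ x, P.diff n (f'.1 x) = f.1 (R.diff n x) := by
    intro n f
    obtain ⟨f', h1, h2⟩ := exists_homogeneous_lift (b (n + 1)) (γ (n + 1)) (hcoord (n + 1))
      (P.smul_mem (n + 1)) (P.diff n) (f.1 ∘ₗ R.diff n) (by
        intro i
        obtain ⟨y, hy⟩ := f.2.2 (b (n + 1) i)
        refine ⟨q (n + 1) (γ (n + 1) i) y, hq _ _ y, ?_⟩
        rw [hqd, hy]
        exact hq1 _ _ _ (f.2.1 _ _ (R.d_mem n _ _ (hb (n + 1) i))))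
    refine ⟨⟨f', h1, fun x => (P.diff_exact n _).1 ?_⟩, h2⟩
    rw [h2, LinearMap.comp_apply, (R.diff_exact n).apply_apply_eq_zero, map_zero]
  choose next hnext using hstep
  let F : ∀ n, T n := fun n => Nat.rec ⟨f0, hf0, fun x => (P.diff_aug_exact _).1 (by
    rw [hf0', R.diff_aug_exact.apply_apply_eq_zero])⟩ next n
  refine ⟨⟨{ f := fun n => ModuleCat.ofHom (F n).1, comm' := ?_ }, ?_⟩, fun n => (F n).2.1⟩
  · rintro _ n rfl
    ext x
    exact hnext n (F n) x
  · rw [(ChainComplex.single₀ _).map_id, HomologicalComplex.id_f, Category.comp_id,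
      ← cancel_mono (HomologicalComplex.singleObjXSelf (ComplexShape.down ℕ) 0
        (trivialModule 𝒜)).hom]
    ext x
    exact hf0' x

end GradedComparison

/-! ### The graded free resolution of the trivial module -/

section Resolution

variable (k : Type u) [Field k]

/-- The ranks of the resolution of the trivial module of `D(0, 1)`. -/
def resRank : ℕ → ℕ
  | 0 => 1
  | 1 => 2
  | 2 => 2
  | 3 => 1
  | _ + 4 => 0

/-- The matrices of the resolution of the trivial module of `D(0, 1)`. -/
def resMatrix : ∀ n, Matrix (Fin (resRank (n + 1))) (Fin (resRank n)) (DD k)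
  | 0 => fun i _ => (![uu k, dd k] : Fin 2 → DD k) i
  | 1 => (![![-(dd k * uu k), uu k * uu k], ![-(dd k * dd k), uu k * dd k]] : Fin 2 → Fin 2 → DD k)
  | 2 => fun _ j => (![dd k, -uu k] : Fin 2 → DD k) j
  | _ + 3 => fun i _ => Fin.elim0 i

/-- The differentials of the resolution of the trivial module of `D(0, 1)`. -/
def resDiff (n : ℕ) : (Fin (resRank (n + 1)) → DD k) →ₗ[DD k] (Fin (resRank n) → DD k) :=
  (resMatrix k n).vecMulLinear

/-- The degrees of the generators of the resolution of the trivial module of `D(0, 1)`. -/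
def resDeg : ∀ n, Fin (resRank n) → DihedralGroup 4
  | 0 => fun _ => 1
  | 1 => (![rho8, refl8] : Fin 2 → DihedralGroup 4)
  | 2 => (![rho8 ^ 2 * refl8, rho8] : Fin 2 → DihedralGroup 4)
  | 3 => fun _ => rho8 ^ 2
  | _ + 4 => fun i => Fin.elim0 i

variable {k}

lemma resDiff_zero_apply (x : Fin 2 → DD k) :
    resDiff k 0 x = fun _ => x 0 * uu k + x 1 * dd k := by
  funext j
  change ∑ i : Fin 2, x i * (![uu k, dd k] : Fin 2 → DD k) i = _
  rw [Fin.sum_univ_two]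
  rfl

lemma resDiff_one_apply (x : Fin 2 → DD k) :
    resDiff k 1 x = (![x 0 * -(dd k * uu k) + x 1 * -(dd k * dd k),
      x 0 * (uu k * uu k) + x 1 * (uu k * dd k)] : Fin 2 → DD k) := by
  funext j
  change ∑ i : Fin 2, x i * (![![-(dd k * uu k), uu k * uu k], ![-(dd k * dd k), uu k * dd k]] :
    Fin 2 → Fin 2 → DD k) i j = _
  rw [Fin.sum_univ_two]
  revert j
  change ∀ j : Fin 2, _
  intro j
  fin_cases j <;> rfl

lemma resDiff_two_apply (x : Fin 1 → DD k) :
    resDiff k 2 x = (![x 0 * dd k, x 0 * -uu k] : Fin 2 → DD k) := by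
  funext j
  change ∑ i : Fin 1, x i * (![dd k, -uu k] : Fin 2 → DD k) j = _
  rw [Fin.sum_univ_one]
  revert j
  change ∀ j : Fin 2, _
  intro j
  fin_cases j <;> rfl

lemma resDiff_exact : ∀ n, Function.Exact (resDiff k (n + 1)) (resDiff k n)
  | 0 => by
    change ∀ x : Fin 2 → DD k, _ ↔ ∃ y : Fin 2 → DD k, _
    intro x
    constructor
    · intro hx
      rw [resDiff_zero_apply] at hx
      obtain ⟨p, q, h0, h1⟩ := exact_right_one (congrFun hx (0 : Fin 1))
      refine ⟨![p, q], (resDiff_one_apply _).trans ?_⟩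
      funext j
      fin_cases j
      · change p * -(dd k * uu k) + q * -(dd k * dd k) = x 0
        rw [DD_mul_neg, DD_mul_neg, h0]
        abel
      · exact h1.symm
    · rintro ⟨y, rfl⟩
      rw [resDiff_one_apply, resDiff_zero_apply]
      funext j
      change (y 0 * -(dd k * uu k) + y 1 * -(dd k * dd k)) * uu k +
        (y 0 * (uu k * uu k) + y 1 * (uu k * dd k)) * dd k = 0
      have h1 := uu_rel k
      have h2 := dd_rel k
      simp only [add_mul, DD_mul_neg, DD_neg_mul, mul_assoc] at h1 h2 ⊢
      rw [h1, h2]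
      abel
  | 1 => by
    change ∀ x : Fin 2 → DD k, _ ↔ ∃ y : Fin 1 → DD k, _
    intro x
    constructor
    · intro hx
      rw [resDiff_one_apply] at hx
      have h : x 0 * -(dd k * uu k) + x 1 * -(dd k * dd k) = 0 := congrFun hx (0 : Fin 2)
      obtain ⟨s, h0, h1⟩ := exact_right_two (p := x 0) (q := x 1) (by
        rw [DD_mul_neg, DD_mul_neg, ← neg_add] at h
        exact neg_eq_zero.1 h)
      refine ⟨fun _ => s, (resDiff_two_apply _).trans ?_⟩
      funext j
      fin_cases j
      · exact h0.symm
      · exact (DD_mul_neg _ _).trans h1.symm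
    · rintro ⟨y, rfl⟩
      rw [resDiff_two_apply, resDiff_one_apply]
      have h1 := uu_rel k
      have h2 := dd_rel k
      simp only [mul_assoc] at h1 h2
      have h3 : y 0 * dd k * -(dd k * uu k) + y 0 * -uu k * -(dd k * dd k) = 0 := by
        simp only [DD_mul_neg, DD_neg_mul, mul_assoc, h2]
        abel
      have h4 : y 0 * dd k * (uu k * uu k) + y 0 * -uu k * (uu k * dd k) = 0 := by
        simp only [DD_mul_neg, DD_neg_mul, mul_assoc, h1]
        abel
      funext j
      revert j
      change ∀ j : Fin 2, _
      intro j
      fin_cases j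
      exacts [h3, h4]
  | 2 => by
    change ∀ x : Fin 1 → DD k, _ ↔ ∃ y : Fin 0 → DD k, _
    intro x
    constructor
    · intro hx
      rw [resDiff_two_apply] at hx
      have h0 : x 0 * dd k = 0 := congrFun hx (0 : Fin 2)
      have h1 : x 0 = 0 := mul_dd_injective (h0.trans (zero_mul _).symm)
      refine ⟨0, (map_zero _).trans ?_⟩
      funext (j : Fin 1)
      rw [Subsingleton.elim j 0]
      exact h1.symm
    · rintro ⟨y, rfl⟩
      rw [Subsingleton.elim y 0]
      exact (congrArg _ (map_zero _)).trans (map_zero _)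
  | n + 3 => by
    change ∀ x : Fin 0 → DD k, _ ↔ ∃ y : Fin 0 → DD k, _
    intro x
    rw [Subsingleton.elim x 0]
    exact ⟨fun _ => ⟨0, map_zero _⟩, fun _ => map_zero _⟩

/-- The augmentation of the resolution of the trivial module of `D(0, 1)`. -/
def resAug (k : Type u) [Field k] :
    (Fin (resRank 0) → DD k) →ₗ[DD k] trivialModule (gradingDD k) :=
  (augmentationIdeal (gradingDD k)).mkQ ∘ₗ LinearMap.proj (0 : Fin 1)

lemma resAug_exact : Function.Exact (resDiff k 0) (resAug k) := by
  change ∀ x : Fin 1 → DD k, _ ↔ ∃ y : Fin 2 → DD k, _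
  intro x
  have h : resAug k x = 0 ↔ evalDD k (x 0) = 0 := by
    rw [← mem_augmentationIdeal_gradingDD]
    exact Submodule.Quotient.mk_eq_zero _
  rw [h]
  constructor
  · intro hx
    obtain ⟨a, b, hab⟩ := exists_right_of_evalDD_eq_zero hx
    refine ⟨![a, b], (resDiff_zero_apply _).trans ?_⟩
    funext (j : Fin 1)
    rw [Subsingleton.elim j 0]
    exact hab.symm
  · rintro ⟨y, rfl⟩
    rw [resDiff_zero_apply]
    simp

lemma resAug_surjective : Function.Surjective (resAug k) := by
  intro x
  obtain ⟨a, rfl⟩ := Submodule.Quotient.mk_surjective _ x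
  exact ⟨fun _ => a, rfl⟩

/-- The minimal free resolution of the trivial module of `D(0, 1)`. -/
def resolutionDD (k : Type u) [Field k] : ProjectiveResolution (trivialModule (gradingDD k)) :=
  resolutionOfLinear (N := trivialModule (gradingDD k)) (M := fun n => Fin (resRank n) → DD k)
    (resDiff k) resDiff_exact (resAug k) resAug_exact resAug_surjective

lemma resolutionDD_d (k : Type u) [Field k] (n : ℕ) :
    (resolutionDD k).complex.d (n + 1) n = ModuleCat.ofHom (resDiff k n) :=
  complexOfLinear_d (M := fun n => Fin (resRank n) → DD k) (resDiff k) resDiff_exact n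

/-- The homogeneous pieces of a free module on homogeneous generators. -/
def freePiece {n : ℕ} (γ : Fin n → DihedralGroup 4) (h : DihedralGroup 4) :
    AddSubgroup (Fin n → DD k) where
  carrier := {v | ∀ i, v i ∈ component (dihedralCoaction k) (h * (γ i)⁻¹)}
  zero_mem' _ := zero_mem _
  add_mem' hv hw i := add_mem (hv i) (hw i)
  neg_mem' hv i := neg_mem (hv i)

lemma sum_monomProj_univ {ι : Type*} [DecidableEq ι] [Fintype ι] (f : ℕ × ℕ × ℕ → ι) (a : DD k) :
    ∑ i, monomProj f i a = a := by
  have h : ∑ i, monomProj (k := k) f i = LinearMap.id := by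
    refine linearMap_ext_monom fun x => ?_
    simp [monomProj_monom]
  simpa using LinearMap.congr_fun h a

/-- The projection onto a homogeneous piece of a free module. -/
def freeProj (k : Type u) [Field k] {n : ℕ} (γ : Fin n → DihedralGroup 4) (h : DihedralGroup 4) :
    (Fin n → DD k) →+ (Fin n → DD k) where
  toFun v i := monomProj monomGDeg (h * (γ i)⁻¹) (v i)
  map_zero' := funext fun _ => map_zero _
  map_add' _ _ := funext fun _ => map_add _ _ _

lemma isInternal_freePiece {n : ℕ} (γ : Fin n → DihedralGroup 4) :
    DirectSum.IsInternal (freePiece (k := k) γ) := by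
  refine isInternal_of_projections (M := Fin n → DD k) (σ := AddSubgroup (Fin n → DD k))
    (freePiece γ) (freeProj k γ) ?_ fun v => ⟨Finset.univ, fun h _ i => ?_, ?_⟩
  · intro g h v hv
    have hvi : ∀ i, v i ∈ monomSpan k {x | monomGDeg x = h * (γ i)⁻¹} := fun i => by
      rw [← component_dihedralCoaction]
      exact hv i
    by_cases hgh : h = g
    · subst hgh
      rw [if_pos rfl]
      funext i
      change monomProj monomGDeg (h * (γ i)⁻¹) (v i) = v i
      rw [monomProj_of_mem _ _ _ (hvi i), if_pos rfl]
    · rw [if_neg hgh]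
      funext i
      have hne : h * (γ i)⁻¹ ≠ g * (γ i)⁻¹ := (mul_left_injective _).ne hgh
      change monomProj monomGDeg (g * (γ i)⁻¹) (v i) = 0
      rw [monomProj_of_mem _ _ _ (hvi i), if_neg hne]
  · rw [component_dihedralCoaction]
    exact monomProj_mem _ _ _
  · funext i
    rw [Finset.sum_apply]
    -- In coordinate `i` the degrees are translated by `(γ i)⁻¹`, which merely permutes the
    -- summands.
    exact (Equiv.sum_comp (Equiv.mulRight (γ i)⁻¹) fun h => monomProj monomGDeg h (v i)).trans
      (sum_monomProj_univ _ _)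

/-- This makes the differentials homogeneous. The middle degrees `ρ²r` and `ρ` are those of the
relations `u²d = du²` and `ud² = d²u`; multiplying by `d` and by `u` leads to `ρ²` in both cases. -/
lemma resMatrix_mem : ∀ (n : ℕ) (i : Fin (resRank (n + 1))) (j : Fin (resRank n)),
    resMatrix k n i j ∈ component (dihedralCoaction k) (resDeg (n + 1) i * (resDeg n j)⁻¹) := by
  have hu : uu k ∈ component (dihedralCoaction k) rho8 := dihedralCoaction_uu
  have hd : dd k ∈ component (dihedralCoaction k) refl8 := dihedralCoaction_dd
  have key : ∀ {a : DD k} {g h : DihedralGroup 4}, a ∈ component (dihedralCoaction k) g → g = h →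
      a ∈ component (dihedralCoaction k) h := fun ha h => h ▸ ha
  intro n
  match n with
  | 0 =>
    change ∀ (i : Fin 2) (j : Fin 1), _
    intro i j
    fin_cases i
    exacts [key hu (by revert j; decide), key hd (by revert j; decide)]
  | 1 =>
    change ∀ (i : Fin 2) (j : Fin 2), _
    intro i j
    fin_cases i <;> fin_cases j
    · exact key (neg_mem (mul_mem_component _ hd hu)) (by decide)
    · exact key (mul_mem_component _ hu hu) (by decide)
    · exact key (neg_mem (mul_mem_component _ hd hd)) (by decide)
    · exact key (mul_mem_component _ hu hd) (by decide)
  | 2 =>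
    change ∀ (i : Fin 1) (j : Fin 2), _
    intro i j
    fin_cases j
    exacts [key hd (by revert i; decide), key (neg_mem hu) (by revert i; decide)]
  | n + 3 => exact fun i => Fin.elim0 i

lemma resDiff_mem (n : ℕ) (h : DihedralGroup 4) {x : Fin (resRank (n + 1)) → DD k}
    (hx : x ∈ freePiece (resDeg (n + 1)) h) : resDiff k n x ∈ freePiece (resDeg n) h := by
  intro j
  change ∑ i, x i * resMatrix k n i j ∈ _
  refine Submodule.sum_mem _ fun i _ => ?_
  have := mul_mem_component _ (hx i) (resMatrix_mem n i j)
  rwa [mul_assoc, inv_mul_cancel_left] at this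

end Resolution

section LinearResolution

variable {A : Type u} [Ring A] {N : ModuleCat.{u} A} {M : ℕ → Type u} [∀ n, AddCommGroup (M n)]
  [∀ n, Module A (M n)] [∀ n, Module.Projective A (M n)]

lemma resolutionOfLinear_π_f_zero (d : ∀ n, M (n + 1) →ₗ[A] M n)
    (hd : ∀ n, Function.Exact (d (n + 1)) (d n)) (π : M 0 →ₗ[A] N) (h0 : Function.Exact (d 0) π)
    (hπ : Function.Surjective π) :
    (resolutionOfLinear d hd π h0 hπ).π.f 0 = ModuleCat.ofHom π :=
  ChainComplex.toSingle₀Equiv_symm_apply_f_zero (C := complexOfLinear d hd) (ModuleCat.ofHom π)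
    (complexOfLinear_d_comp d hd π h0)

end LinearResolution

/-! ### Ext of the trivial module and the homological codeterminant -/

section Codeterminant

open CategoryTheory.Abelian

variable (k : Type u) [Field k]

lemma isInternal_of_decidableEq {ι M σ : Type*} {i₁ i₂ : DecidableEq ι} [AddCommMonoid M]
    [SetLike σ M] [AddSubmonoidClass σ M] {W : ι → σ}
    (h : @DirectSum.IsInternal ι M σ i₁ _ _ _ W) : @DirectSum.IsInternal ι M σ i₂ _ _ _ W := by
  rwa [Subsingleton.elim i₂ i₁]

lemma one_mem_component : (1 : DD k) ∈ component (dihedralCoaction k) 1 :=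
  mem_fixedDD_iff.1 (one_mem _)

/-- The minimal free resolution of the trivial module of `D(0, 1)`, with its dihedral grading. -/
def gradedResolutionDD : GradedResolution (gradingDD k) (component (dihedralCoaction k)) where
  res := resolutionDD k
  piece n := freePiece (resDeg n)
  internal n := isInternal_of_decidableEq (isInternal_freePiece (k := k) (resDeg n))
  smul_mem n g h a x ha hx i := by
    have h1 := mul_mem_component _ ha (hx i)
    rwa [← mul_assoc] at h1
  d_mem n h x hx := by
    rw [resolutionDD_d]
    exact resDiff_mem n h hx
  augmentation_mem h x hx := by
    have h0 := congrArg (fun f => f.hom x) (resolutionOfLinear_π_f_zero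
      (N := trivialModule (gradingDD k)) (M := fun n => Fin (resRank n) → DD k)
      (resDiff k) resDiff_exact (resAug k) resAug_exact resAug_surjective)
    refine ⟨x (0 : Fin 1), ?_, h0.symm⟩
    have h1 := hx (0 : Fin 1)
    have h2 : resDeg 0 (0 : Fin 1) = 1 := rfl
    rwa [h2, inv_one, mul_one] at h1

variable {k}

/-- The map from a term of the resolution to the algebra with given values on the generators. -/
def resHom {n : ℕ} (c : Fin (resRank n) → DD k) :
    (resolutionDD k).complex.X n ⟶ ModuleCat.of (DD k) (DD k) :=
  ModuleCat.ofHom (Fintype.linearCombination (DD k) c :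
    (Fin (resRank n) → DD k) →ₗ[DD k] DD k)

lemma resHom_apply {n : ℕ} (c x : Fin (resRank n) → DD k) : (resHom c).hom x = ∑ i, x i * c i := rfl

lemma resHom_single {n : ℕ} (c : Fin (resRank n) → DD k) (i : Fin (resRank n)) :
    (resHom c).hom (Pi.single i 1 : Fin (resRank n) → DD k) = c i := by
  rw [resHom_apply]
  simp [Pi.single_apply]

lemma eq_resHom {n : ℕ} (f : (resolutionDD k).complex.X n ⟶ ModuleCat.of (DD k) (DD k)) :
    f = resHom fun i => f.hom (Pi.single i 1 : Fin (resRank n) → DD k) := by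
  refine ModuleCat.hom_ext ?_
  have h : ∀ f g : (Fin (resRank n) → DD k) →ₗ[DD k] DD k,
      (∀ i, f (Pi.single i 1) = g (Pi.single i 1)) → f = g := fun f g hfg =>
    (Pi.basisFun (DD k) _).ext fun i => by simpa using hfg i
  exact h _ _ fun i => (resHom_single
    (fun i => f.hom (Pi.single i 1 : Fin (resRank n) → DD k)) i).symm

lemma resHom_injective {n : ℕ} {c c' : Fin (resRank n) → DD k} (h : resHom c = resHom c') :
    c = c' := by
  funext i
  rw [← resHom_single c, h, resHom_single]

/-- Dualising replaces rows times the matrix by the matrix times columns, so the left-hand exactness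
lemmas now apply. -/
lemma d_comp_resHom (n : ℕ) (c : Fin (resRank n) → DD k) :
    (resolutionDD k).complex.d (n + 1) n ≫ resHom c = resHom (Matrix.mulVec (resMatrix k n) c) := by
  rw [resolutionDD_d]
  refine ModuleCat.hom_ext (LinearMap.ext fun x => ?_)
  change ∑ j, (∑ i, x i * resMatrix k n i j) * c j = ∑ i, x i * ∑ j, resMatrix k n i j * c j
  simp only [Finset.sum_mul, Finset.mul_sum, mul_assoc]
  exact Finset.sum_comm

lemma resHom_zero {n : ℕ} : (resHom 0 : (resolutionDD k).complex.X n ⟶ _) = 0 := by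
  refine ModuleCat.hom_ext (LinearMap.ext fun x => ?_)
  change ∑ i, x i * 0 = 0
  simp

lemma subsingleton_ext_of_exact (n : ℕ)
    (h : ∀ c, Matrix.mulVec (resMatrix k n) c = 0 →
      (n = 0 ∧ c = 0) ∨ ∃ m b, ∃ e : m + 1 = n, c = e ▸ Matrix.mulVec (resMatrix k m) b) :
    Subsingleton (Ext.{u} (trivialModule (gradingDD k)) (ModuleCat.of (DD k) (DD k)) n) := by
  refine subsingleton_of_forall_eq 0 fun x => ?_
  obtain ⟨f, hf, rfl⟩ := (resolutionDD k).extMk_surjective x (n + 1) rfl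
  obtain ⟨c, rfl⟩ : ∃ c, f = resHom c := ⟨_, eq_resHom f⟩
  have hc : Matrix.mulVec (resMatrix k n) c = 0 :=
    resHom_injective ((d_comp_resHom n c).symm.trans (hf.trans resHom_zero.symm))
  obtain ⟨-, rfl⟩ | ⟨m, b, rfl, rfl⟩ := h c hc
  · simp only [resHom_zero]
    exact (resolutionDD k).extMk_zero _ rfl
  · exact ((resolutionDD k).extMk_eq_zero_iff _ _ rfl hf m rfl).2 ⟨resHom b, d_comp_resHom m b⟩

lemma mulVec_zero (c : Fin 1 → DD k) :
    Matrix.mulVec (resMatrix k 0) c = (![uu k * c 0, dd k * c 0] : Fin 2 → DD k) := by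
  funext j
  change ∑ i : Fin 1, (![uu k, dd k] : Fin 2 → DD k) j * c i = _
  rw [Fin.sum_univ_one]
  revert j
  change ∀ j : Fin 2, _
  intro j
  fin_cases j <;> rfl

lemma mulVec_one (c : Fin 2 → DD k) :
    Matrix.mulVec (resMatrix k 1) c = (![-(dd k * uu k) * c 0 + uu k * uu k * c 1,
      -(dd k * dd k) * c 0 + uu k * dd k * c 1] : Fin 2 → DD k) := by
  funext j
  change ∑ i : Fin 2, (![![-(dd k * uu k), uu k * uu k], ![-(dd k * dd k), uu k * dd k]] :
    Fin 2 → Fin 2 → DD k) j i * c i = _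
  rw [Fin.sum_univ_two]
  revert j
  change ∀ j : Fin 2, _
  intro j
  fin_cases j <;> rfl

lemma mulVec_two (c : Fin 2 → DD k) :
    Matrix.mulVec (resMatrix k 2) c = (fun _ => dd k * c 0 + -uu k * c 1 : Fin 1 → DD k) := by
  funext j
  change ∑ i : Fin 2, (![dd k, -uu k] : Fin 2 → DD k) i * c i = _
  rw [Fin.sum_univ_two]
  rfl

lemma subsingleton_ext : ∀ n ≠ 3,
    Subsingleton (Ext.{u} (trivialModule (gradingDD k)) (ModuleCat.of (DD k) (DD k)) n)
  | 0, _ => by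
    refine subsingleton_ext_of_exact 0 ?_
    change ∀ c : Fin 1 → DD k, _
    intro c hc
    refine Or.inl ⟨rfl, ?_⟩
    rw [mulVec_zero] at hc
    have h0 : uu k * c 0 = 0 := congrFun hc (0 : Fin 2)
    funext (i : Fin 1)
    rw [Subsingleton.elim i 0]
    exact uu_mul_injective (h0.trans (mul_zero _).symm)
  | 1, _ => by
    refine subsingleton_ext_of_exact 1 ?_
    change ∀ c : Fin 2 → DD k, _
    intro c hc
    rw [mulVec_one] at hc
    have h0 : -(dd k * uu k) * c 0 + uu k * uu k * c 1 = 0 := congrFun hc (0 : Fin 2)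
    obtain ⟨b, h1, h2⟩ := exact_left_one (c₁ := c 0) (c₂ := c 1) (by
      rw [DD_neg_mul, neg_add_eq_zero] at h0
      rw [← mul_assoc, ← mul_assoc, h0])
    refine Or.inr ⟨0, fun _ => b, rfl, Eq.trans ?_ (mulVec_zero _).symm⟩
    funext (i : Fin 2)
    fin_cases i
    exacts [h1, h2]
  | 2, _ => by
    refine subsingleton_ext_of_exact 2 ?_
    change ∀ c : Fin 2 → DD k, _
    intro c hc
    rw [mulVec_two] at hc
    have h0 : dd k * c 0 + -uu k * c 1 = 0 := congrFun hc (0 : Fin 1)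
    obtain ⟨b, b', h1, h2⟩ := exact_left_two (e₁ := c 0) (e₂ := c 1) (by
      rw [DD_neg_mul, ← sub_eq_add_neg, sub_eq_zero] at h0
      exact h0)
    refine Or.inr ⟨1, ![b, b'], rfl, Eq.trans ?_ (mulVec_one _).symm⟩
    funext (i : Fin 2)
    fin_cases i
    · change c 0 = -(dd k * uu k) * b + uu k * uu k * b'
      rw [h1, DD_neg_mul, mul_assoc, mul_assoc]
      abel
    · change c 1 = -(dd k * dd k) * b + uu k * dd k * b'
      rw [h2, DD_neg_mul, mul_assoc, mul_assoc]
      abel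
  | 3, h => absurd rfl h
  | n + 4, _ => by
    refine subsingleton_ext_of_exact (n + 4) ?_
    change ∀ c : Fin 0 → DD k, _
    intro c _
    exact Or.inr ⟨n + 3, 0, rfl, funext fun i : Fin 0 => i.elim0⟩

lemma d_comp_eq_zero (f : (resolutionDD k).complex.X 3 ⟶ ModuleCat.of (DD k) (DD k)) :
    (resolutionDD k).complex.d 4 3 ≫ f = 0 := by
  rw [eq_resHom f, d_comp_resHom, ← resHom_zero]
  congr 1
  exact funext fun i : Fin 0 => i.elim0

/-- The value at the generator of the last term of the resolution. -/
def topEval (f : (resolutionDD k).complex.X 3 ⟶ ModuleCat.of (DD k) (DD k)) : DD k :=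
  f.hom (fun _ => 1 : Fin 1 → DD k)

/-- The map from the last term of the resolution with given value at the generator. -/
def topHom (a : DD k) : (resolutionDD k).complex.X 3 ⟶ ModuleCat.of (DD k) (DD k) :=
  resHom (n := 3) fun _ => a

lemma topEval_topHom (a : DD k) : topEval (topHom a) = a := by
  refine (Fin.sum_univ_one fun _ => (1 : DD k) * a).trans ?_
  rw [one_mul]

lemma eq_topHom_topEval (f : (resolutionDD k).complex.X 3 ⟶ ModuleCat.of (DD k) (DD k)) :
    f = topHom (topEval f) := by
  refine (eq_resHom f).trans (congrArg resHom ?_)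
  have h : ∀ i : Fin 1, (Pi.single i 1 : Fin 1 → DD k) = fun _ => 1 := fun i => funext fun j => by
    rw [Subsingleton.elim j i, Pi.single_eq_same]
  funext (i : Fin 1)
  exact congrArg f.hom (h i)

lemma d_comp_resHom_two (a b : DD k) :
    (resolutionDD k).complex.d 3 2 ≫ resHom (n := 2) (![a, b] : Fin 2 → DD k) =
      topHom (dd k * a + -uu k * b) :=
  (d_comp_resHom 2 _).trans (congrArg resHom (mulVec_two _))

lemma eq_resHom_two (g : (resolutionDD k).complex.X 2 ⟶ ModuleCat.of (DD k) (DD k)) :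
    ∃ a b, g = resHom (n := 2) (![a, b] : Fin 2 → DD k) := by
  obtain ⟨c, rfl⟩ : ∃ c, g = resHom c := ⟨_, eq_resHom g⟩
  refine ⟨c (0 : Fin 2), c (1 : Fin 2), congrArg resHom ?_⟩
  funext (i : Fin 2)
  fin_cases i <;> rfl

/-- The coboundaries in top degree take on the generator exactly the values in `dD + uD`, the kernel
of the augmentation. -/
lemma extMk_eq_zero_iff_evalDD (f : (resolutionDD k).complex.X 3 ⟶ ModuleCat.of (DD k) (DD k)) :
    (resolutionDD k).extMk f 4 rfl (d_comp_eq_zero f) = 0 ↔ evalDD k (topEval f) = 0 := by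
  rw [(resolutionDD k).extMk_eq_zero_iff f 4 rfl _ 2 rfl]
  constructor
  · rintro ⟨g, rfl⟩
    obtain ⟨a, b, rfl⟩ := eq_resHom_two g
    refine (congrArg (fun f => evalDD k (topEval f)) (d_comp_resHom_two a b)).trans ?_
    rw [topEval_topHom]
    simp
  · intro hf
    obtain ⟨a, b, hab⟩ := exists_of_evalDD_eq_zero hf
    refine ⟨resHom (n := 2) (![a, -b] : Fin 2 → DD k), (d_comp_resHom_two _ _).trans
      (Eq.trans (congrArg topHom ?_) (eq_topHom_topEval f).symm)⟩
    rw [hab, DD_neg_mul, DD_mul_neg, neg_neg]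

/-- The generator of `Ext³`. -/
def extGenerator (k : Type u) [Field k] :
    Ext.{u} (trivialModule (gradingDD k)) (ModuleCat.of (DD k) (DD k)) 3 :=
  (resolutionDD k).extMk (topHom 1) 4 rfl (d_comp_eq_zero _)

lemma extGenerator_ne_zero : extGenerator k ≠ 0 := by
  rw [extGenerator, Ne, extMk_eq_zero_iff_evalDD, topEval_topHom]
  simp

lemma extTrivialModule_gradingDD : ExtTrivialModule (gradingDD k) 3 where
  vanishing := subsingleton_ext
  finrank_eq_one := by
    rw [finrank_eq_one_iff_of_nonzero' (extGenerator k) extGenerator_ne_zero]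
    intro x
    obtain ⟨f, hf, rfl⟩ := (resolutionDD k).extMk_surjective x 4 rfl
    refine ⟨evalDD k (topEval f), ?_⟩
    rw [extGenerator, Ext.smul_eq_comp_mk₀, ProjectiveResolution.extMk_comp_mk₀, ← sub_eq_zero,
      ProjectiveResolution.sub_extMk, extMk_eq_zero_iff_evalDD]
    change evalDD k (evalDD k (topEval f) • topEval (topHom 1) - topEval f) = 0
    rw [topEval_topHom, map_sub, map_smul]
    simp

lemma basisFun_mem_freePiece {n : ℕ} (γ : Fin n → DihedralGroup 4) (i : Fin n) :
    Pi.basisFun (DD k) (Fin n) i ∈ freePiece γ (γ i) := by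
  intro j
  rw [Pi.basisFun_apply, Pi.single_apply]
  split_ifs with h
  · rw [h, mul_inv_cancel]
    exact one_mem_component k
  · exact zero_mem _

/-- A class of degree `g⁻¹`, pulled back to the explicit resolution, takes on the generator of
degree `ρ²` a value in `D_{ρ² g⁻¹}`. Unless `g = ρ²` the augmentation kills this value, hence the
class. Conversely, the value `1` realises `ρ²`. -/
lemma isHomologicalCodeterminant_iff (g : DihedralGroup 4) :
    IsHomologicalCodeterminant (gradingDD k) (dihedralCoaction k) g ↔ g = rho8 ^ 2 := by
  constructor
  · rintro ⟨n, hn, e, he, P, f, hf, hfh, rfl⟩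
    obtain rfl : n = 3 := by
      by_contra h
      have := subsingleton_ext (k := k) n h
      exact he (Subsingleton.elim _ _)
    -- The class may live on an arbitrary graded resolution `P`; a homogeneous lift of the identity
    -- brings it to the explicit one.
    obtain ⟨φ, hφ⟩ := exists_graded_comparison (fun g hg a ha =>
      mem_augmentationIdeal_gradingDD.2 (evalDD_of_mem_component hg ha)) (gradedResolutionDD k) P
      (ι := fun n => Fin (resRank n)) (fun n => Pi.basisFun (DD k) (Fin (resRank n))) resDeg
      (fun n i => basisFun_mem_freePiece (resDeg n) i) (fun n h x hx i => hx i)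
    have h1 := ProjectiveResolution.mk₀_comp_extMk f 4 rfl hf φ
    rw [Ext.mk₀_id_comp] at h1
    by_contra hg
    refine he (h1.trans ((extMk_eq_zero_iff_evalDD _).2 ?_))
    have h2 : (fun _ => 1 : Fin 1 → DD k) ∈ (gradedResolutionDD k).piece 3 (rho8 ^ 2) := by
      intro i
      have h3 : resDeg 3 i = rho8 ^ 2 := rfl
      rw [h3, mul_inv_cancel]
      exact one_mem_component k
    refine evalDD_of_mem_component (fun h => hg ?_) (hfh _ _ (hφ 3 _ _ h2))
    exact (mul_inv_eq_one.1 h).symm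
  · rintro rfl
    refine ⟨3, extTrivialModule_gradingDD, extGenerator k, extGenerator_ne_zero,
      gradedResolutionDD k, topHom 1, d_comp_eq_zero _, fun h x hx => ?_, rfl⟩
    refine Set.mem_of_eq_of_mem (Fin.sum_univ_one fun i => x i * 1) ?_
    rw [mul_one]
    exact hx (0 : Fin 1)

end Codeterminant

end

/-! ### The theorem -/

theorem mainTheorem2 (k : Type u) [Field k] [IsAlgClosed k] [CharZero k] :
    -- the coaction: a homogeneous coaction, that is, a grading by the group, with
    -- the degrees of the generators generating the group
    (IsConnectedGraded (gradingDD k) ∧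
      IsCoaction (dihedralCoaction k) ∧
      DirectSum.IsInternal (component (dihedralCoaction k)) ∧
      (∀ g h a b, a ∈ component (dihedralCoaction k) g → b ∈ component (dihedralCoaction k) h →
        a * b ∈ component (dihedralCoaction k) (g * h)) ∧
      (∀ n, gradingDD k n = ⨆ g, gradingDD k n ⊓ component (dihedralCoaction k) g) ∧
      uu k ∈ component (dihedralCoaction k) rho8 ∧
      dd k ∈ component (dihedralCoaction k) refl8 ∧
      Subgroup.closure {rho8, refl8} = ⊤) ∧
    -- the homological codeterminant is nontrivial
    (ExtTrivialModule (gradingDD k) 3 ∧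
      (∀ g, IsHomologicalCodeterminant (gradingDD k) (dihedralCoaction k) g ↔ g = rho8 ^ 2) ∧
      rho8 ^ 2 ≠ 1) ∧
    -- the fixed subring
    (fixedDD k =
        Algebra.adjoin k {(dd k * uu k) ^ 2, (uu k * dd k) ^ 2, dd k ^ 2, uu k ^ 4} ∧
      (∃ e : (MvPolynomial (Fin 4) k ⧸ (Ideal.span {MvPolynomial.X 0 * MvPolynomial.X 1 -
            MvPolynomial.X 2 * MvPolynomial.X 3 ^ 2} : Ideal (MvPolynomial (Fin 4) k)))
          ≃ₐ[k] fixedDD k,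
        (e (Ideal.Quotient.mk _ (MvPolynomial.X 0)) : DD k) = (dd k * uu k) ^ 2 ∧
        (e (Ideal.Quotient.mk _ (MvPolynomial.X 1)) : DD k) = (uu k * dd k) ^ 2 ∧
        (e (Ideal.Quotient.mk _ (MvPolynomial.X 2)) : DD k) = uu k ^ 4 ∧
        (e (Ideal.Quotient.mk _ (MvPolynomial.X 3)) : DD k) = dd k ^ 2) ∧
      (∀ a b : fixedDD k, a * b = b * a) ∧
      IsCompleteIntersection (A := fixedDD k) (gradingFixedDD k) ∧
      (∃ n, IsASGorenstein (A := fixedDD k) (gradingFixedDD k) n) ∧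
      ¬ ∃ n, IsASRegular (A := fixedDD k) (gradingFixedDD k) n) ∧
    -- the components, as right modules over the fixed subring
    (((compDD k 1 : Set (DD k)) = fixedDD k ∧
        compDD k 1 = Submodule.span (fixedDD k).op {1}) ∧
      (compDD k rho8 = Submodule.span (fixedDD k).op {uu k} ∧
        ShiftIso k 1 (compDD k 1) (compDD k rho8)) ∧
      (compDD k (rho8 ^ 2) = Submodule.span (fixedDD k).op {uu k ^ 2} ∧
        ShiftIso k 2 (compDD k 1) (compDD k (rho8 ^ 2))) ∧
      compDD k (rho8 ^ 3) =
        Submodule.span (fixedDD k).op {uu k ^ 3, dd k * uu k * dd k} ∧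
      compDD k refl8 =
        Submodule.span (fixedDD k).op {dd k, uu k * dd k * uu k} ∧
      (compDD k (rho8 * refl8) =
          Submodule.span (fixedDD k).op {uu k * dd k, uu k ^ 2 * (dd k * uu k)} ∧
        compDD k (rho8 * refl8) = (compDD k refl8).map (leftMul (fixedDD k) (uu k))) ∧
      (compDD k (rho8 ^ 2 * refl8) =
          Submodule.span (fixedDD k).op {uu k ^ 2 * dd k, uu k ^ 3 * (dd k * uu k)} ∧
        compDD k (rho8 ^ 2 * refl8) =
          (compDD k refl8).map (leftMul (fixedDD k) (uu k ^ 2))) ∧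
      compDD k (rho8 ^ 3 * refl8) =
        Submodule.span (fixedDD k).op {uu k ^ 3 * dd k, dd k * uu k}) := by
  refine ⟨⟨isConnectedGraded_gradingDD, isCoaction_dihedralCoaction, isInternal_component,
    fun g h a b => mul_mem_component _, gradingDD_eq_iSup, dihedralCoaction_uu, dihedralCoaction_dd,
    closure_rho8_refl8⟩, ⟨?_, ?_, by decide⟩, ⟨fixedDD_eq_adjoin, exists_hypersurfaceQuot_algEquiv,
    fun a b => Subtype.ext (commute_of_mem_fixedDD a.2 b.2), isCompleteIntersection_gradingFixedDD,
    ⟨3, homological_fixedDD.1⟩, fun ⟨n, hn⟩ => homological_fixedDD.2 hn.globalDimension_left⟩,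
    ⟨⟨coe_compDD_one, compDD_one⟩, ⟨compDD_rho, ?_⟩,
      ⟨compDD_rho_sq, shiftIso_compDD 2 compDD_rho_sq⟩, compDD_rho_cube, compDD_refl,
      ⟨compDD_rho_refl, ?_⟩, ⟨compDD_rho_sq_refl, ?_⟩, compDD_rho_cube_refl⟩⟩
  · exact extTrivialModule_gradingDD
  · exact isHomologicalCodeterminant_iff
  · refine shiftIso_compDD 1 ?_
    rw [pow_one]
    exact compDD_rho
  · have h := map_leftMul_compDD_refl (k := k) 1
    rw [pow_one] at h
    rw [h]
    exact compDD_rho_refl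
  · rw [map_leftMul_compDD_refl]
    exact compDD_rho_sq_refl
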